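/- **Setting.** Let $\nu$ be a finite nonnegative measure on $[-1,1]$ and $p_0,p_1,\dots$ real polynomials with $\deg p_i=i$ and $\int p_ip_j\,d\nu=\delta_{ij}$. For $N\ge 1$ let $\lambda_0<\dots<\lambda_{N-1}$ be the roots of $p_N$, $\theta_i=\arccos\lambda_i$, $w_i=1/\sum_{j<N}p_j(\lambda_i)^2$, and let $F_N$ be the $N\times N$ orthogonal matrix with entries $F_N[i,j]=\sqrt{w_i}\,p_j(\lambda_i)$. Write $\hat x=F_Nx$ and $U=\max_{i,j}|F_N^{-1}[i,j]|$. The family is *$(C_0,C_1,\gamma_0)$-dense* ($0<C_0<C_1$) if for all large enough $d$, with $\theta_0,\dots,\theta_{d-1}$ the angles of the roots of $p_d$, for every $i<d$ and every $\gamma$ with $\gamma_0/d\le\gamma\le 2\pi$, $$C_0\gamma d\le\left|\{\theta_0,\dots,\theta_{d-1}\}\cap[\theta_i-\tfrac\gamma2,\theta_i+\tfrac\gamma2]\right|\le C_1\gamma d .$$ For $0\le\sigma<1$, a vector in $\mathbb R^N$ is *$(k,\sigma)$-sparsely separated* if it has exactly $k$ non-zero entries and any two of their indices differ by more than $\sigma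 N$; $\mathrm{large}(s,x)$ is the $s$-th largest absolute value of an entry of $x$. **One-sparse recovery.** A randomized algorithm $\mathcal A$ with query access to a vector $y\in\mathbb R^N$ is an $(N,\epsilon,\delta,\mu)$ one-sparse recovery algorithm for $F_N$ with query complexity $Q$ and time complexity $T$ if for all $y,v,h,w$ with $F_Ny=v\,e_h+w$ and $\|w\|_2\le\epsilon|v|$: it makes at most $Q$ queries to $y$, and with probability at least $1-\mu$ it outputs $\tilde v e_h$ with $|v-\tilde v|\le\delta|v|$ within time $T$. (Nothing is required for other $y$.) **Machine model.** Algorithms that call $\mathcal A$ are programs of a randomized RAM with registers and arrays of natural numbers and of real numbers, indirect addressing, addition and truncated subtraction of natural numbers, exact arithmetic on reals, comparisons, bounded loops, uniformly random natural numbers, queries to the input vector, and calls of the black box $\mathcal A$ whose queries are answered by a subroutine; every instruction, test, loop iteration and step of $\mathcal A$ costs one unit of time. Each run of $\mathcal A$ is stopped after $Q$ queries or $T$ steps. Before the input is accessed, the memory contains preprocessed data, which do not depend on the input vector or on $\mathcal A$. **Theorem.** There are absolute constants $\delta_0,C'>0$, $e\in\mathbb N$ and a fixed program $\textsc{Recover}$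 such that for every constant $C\ge C'$ there is $K=K(C)>0$ with the following property. Let $p_0,p_1,\dots$ be a $(C_0,C_1,\gamma_0)$-dense orthonormal polynomial family as above. Then for all large enough $N$ (depending on the family and on $C_0,C_1,\gamma_0$), for all integers $1\le k<N$ and all reals $0<\delta<\delta_0$, $0<\mu<1$, $\gamma\ge\gamma_0/N$ with $C_1\gamma<1$, put $$\mu_0=\frac{\mu^2C_0^2\gamma^2}{k^2},\qquad X=\frac{k\,(1+\log(1/\mu))}{\gamma\,\delta\,C_0}.$$ There are preprocessed data of size at most $K(NX)^e$ such that for every $(N,\frac{6\delta}{C},\delta,\frac{\mu_0}{2})$ one-sparse recovery algorithm $\mathcal A$ for $F_N$ with query complexity $Q$ and time complexity $T$, and all $x,w\in\mathbb R^N$ such that $\hat x=F_Nx$ is $(k,C_1\gamma)$-sparsely separated and $\hat w=F_Nw$ satisfies $\|\hat w\|_2\le\frac{\delta}{2C}\,\mathrm{large}(k,\hat x)$, the program $\textsc{Recover}$, with query access to $v=x+w$ and black-box access to $\mathcal A$, outputs with probability at least $1-\mu$ a vector $\hat z$ (as a sparse list) with $$\|\hat x-\hat z\|_2\le 3\delta\|x\|_2\quad\text{and}\quad\|\hat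 v-\hat z\|_2\le 3\delta\|x\|_2+\|w\|_2 ,$$ where $\hat v=\hat x+\hat w$. It always makes at most $K X^e\,(NU^2+Q)$ queries to $v$ and always takes at most $K X^e\,(NU^2+T)$ time. -/

import Mathlib

open Polynomial MeasureTheory Filter

/-! ## Orthonormal polynomial families and their transforms -/

/-- `p 0, p 1, …` is a normalized orthogonal polynomial family: `p i` has degree `i`, and the `p i`
are orthonormal with respect to the (finite, nonnegative) measure `ν`, which is carried by
`[-1, 1]`. -/
structure IsOrthonormalFamily (p : ℕ → ℝ[X]) (ν : Measure ℝ) : Prop where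
  finite : IsFiniteMeasure ν
  support : ν (Set.Icc (-1) 1)ᶜ = 0
  degree : ∀ i, (p i).degree = i
  orthonormal : ∀ i j, ∫ t, (p i).eval t * (p j).eval t ∂ν = if i = j then 1 else 0

/-- The `i`-th root `λ_i` of `p d`, the roots being listed in increasing order (`i < d`). -/
noncomputable def opRoot (p : ℕ → ℝ[X]) (d : ℕ) (i : Fin d) : ℝ :=
  ((p d).roots.sort (· ≤ ·)).getD i 0

/-- The angle `θ_i = arccos λ_i`. -/
noncomputable def opAngle (p : ℕ → ℝ[X]) (d : ℕ) (i : Fin d) : ℝ :=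
  Real.arccos (opRoot p d i)

/-- The Gaussian quadrature weight `1 / ∑_{j < N} p_j(λ_i)^2`. -/
noncomputable def quadWeight (p : ℕ → ℝ[X]) (N : ℕ) (i : Fin N) : ℝ :=
  1 / ∑ j : Fin N, (p j).eval (opRoot p N i) ^ 2

/-- The transform `F_N = D_w^{1/2} P_N`, where `P_N[i,j] = p_j(λ_i)`. -/
noncomputable def opTransform (p : ℕ → ℝ[X]) (N : ℕ) : Matrix (Fin N) (Fin N) ℝ :=
  Matrix.diagonal (fun i => Real.sqrt (quadWeight p N i)) *
    Matrix.of (fun i j : Fin N => (p j).eval (opRoot p N i))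

/-- `(C₀, C₁, γ₀)`-density. The window width `γ` ranges over `γ₀ / d ≤ γ ≤ 2π`: a window of
width `2π` centred at an angle already contains all the angles, and no family could satisfy the
lower bound for arbitrarily large `γ`. -/
def IsDenseFamily (p : ℕ → ℝ[X]) (C₀ C₁ γ₀ : ℝ) : Prop :=
  0 < C₀ ∧ C₀ < C₁ ∧
    ∀ᶠ d : ℕ in atTop, ∀ i : Fin d, ∀ γ : ℝ, γ₀ / d ≤ γ → γ ≤ 2 * Real.pi →
      C₀ * γ * d ≤ ((Set.range (opAngle p d) ∩
          Set.Icc (opAngle p d i - γ / 2) (opAngle p d i + γ / 2)).ncard : ℝ) ∧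
      ((Set.range (opAngle p d) ∩
          Set.Icc (opAngle p d i - γ / 2) (opAngle p d i + γ / 2)).ncard : ℝ) ≤ C₁ * γ * d

/-- The largest absolute value of an entry of a matrix. -/
noncomputable def maxAbsEntry {N : ℕ} (M : Matrix (Fin N) (Fin N) ℝ) : ℝ :=
  ⨆ ij : Fin N × Fin N, |M ij.1 ij.2|

/-! ## Vectors -/

/-- The Euclidean norm. -/
noncomputable abbrev l2 {N : ℕ} (x : Fin N → ℝ) : ℝ := ‖WithLp.toLp 2 x‖

/-- The magnitude of the `s`-th largest entry of `x` by absolute value (`1 ≤ s ≤ N`). -/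
noncomputable def large {N : ℕ} (s : ℕ) (x : Fin N → ℝ) : ℝ :=
  ((Finset.univ.val.map fun i => |x i|).sort (· ≥ ·)).getD (s - 1) 0

/-- `(k, σ)`-sparsely separated vectors. -/
def SparselySeparated {N : ℕ} (k : ℕ) (σ : ℝ) (x : Fin N → ℝ) : Prop :=
  0 ≤ σ ∧ σ < 1 ∧ {i | x i ≠ 0}.ncard = k ∧
    ∀ i j : Fin N, x i ≠ 0 → x j ≠ 0 → i ≠ j → σ * N < |((i : ℕ) : ℝ) - ((j : ℕ) : ℝ)|

/-- The vector `a • e_h` of length `N`. -/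
def spike (N : ℕ) (h : ℕ) (a : ℝ) : Fin N → ℝ := fun i => if (i : ℕ) = h then a else 0

/-! ## Randomized query procedures (the one-sparse recovery black box)

A procedure with query access to a vector `y` of length `N`: an adaptive decision tree whose nodes
are unit-time steps. No restriction is put on how the next step is determined from the information
gathered so far, so that an algorithm in any reasonable machine model is such a procedure, with
`step` nodes for its local computation steps. -/
inductive QueryProc (N : ℕ) : Type
  /-- stop and output the one-sparse vector `a • e_h` -/
  | ret (h : ℕ) (a : ℝ)
  /-- a step of local computation -/
  | step (next : QueryProc N)
  /-- query the entry `y[j]` -/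
  | query (j : Fin N) (next : ℝ → QueryProc N)
  /-- draw a uniformly random element of `{0, …, m}` -/
  | rand (m : ℕ) (next : Fin (m + 1) → QueryProc N)

/-- The result of one execution of a procedure: output `val • e_idx`, number of queries, time. -/
structure QueryOutcome where
  idx : ℕ
  val : ℝ
  queries : ℕ
  time : ℕ

namespace QueryProc

/-- The distribution of the result when the procedure has query access to `y`. -/
noncomputable def eval {N : ℕ} (y : Fin N → ℝ) : QueryProc N → PMF QueryOutcome
  | ret h a => PMF.pure ⟨h, a, 0, 0⟩
  | step next => (next.eval y).map fun o => ⟨o.idx, o.val, o.queries, o.time + 1⟩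
  | query j next => ((next (y j)).eval y).map fun o => ⟨o.idx, o.val, o.queries + 1, o.time + 1⟩
  | rand m next => (PMF.uniformOfFintype (Fin (m + 1))).bind fun c =>
      ((next c).eval y).map fun o => ⟨o.idx, o.val, o.queries, o.time + 1⟩

/-- The procedure run with a clock: it is aborted, with output `0`, as soon as it would make more
than `Q` queries or take more than `T` steps. -/
def clock {N : ℕ} : QueryProc N → ℕ → ℕ → QueryProc N
  | ret h a, _, _ => ret h a
  | step next, Q, T + 1 => step (next.clock Q T)
  | query j next, Q + 1, T + 1 => query j fun a => (next a).clock Q T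
  | rand m next, Q, T + 1 => rand m fun c => (next c).clock Q T
  | _, _, _ => ret 0 0

/-- `A` is an `(N, ε, δ, μ)` one-sparse recovery algorithm for the matrix `F` with query complexity
`Q` and time complexity `T`: whenever `F y = v • e_h + w` with `‖w‖₂ ≤ ε |v|`, it makes at most `Q`
queries to `y` and, with probability at least `1 - μ`, outputs `v' • e_h` with `|v - v'| ≤ δ |v|` in
time at most `T`. Nothing is required on other vectors `y`. -/
def IsOneSparseRecovery {N : ℕ} (A : QueryProc N) (F : Matrix (Fin N) (Fin N) ℝ) (ε δ μ : ℝ)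
    (Q T : ℕ) : Prop :=
  ∀ (y : Fin N → ℝ) (v : ℝ) (h : Fin N) (w : Fin N → ℝ),
    F.mulVec y = spike N h v + w → l2 w ≤ ε * |v| →
      (∀ o ∈ (A.eval y).support, o.queries ≤ Q) ∧
      ENNReal.ofReal (1 - μ) ≤ (A.eval y).toOuterMeasure
        {o | (∃ v' : ℝ, |v - v'| ≤ δ * |v| ∧ spike N o.idx o.val = spike N h v') ∧ o.time ≤ T}

end QueryProc

/-! ## A randomized real RAM with query access and a black-box subroutine -/

/-- The memory: registers and arrays for natural numbers (indices, counters) and for reals. -/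
structure Mem where
  ireg : ℕ → ℕ
  rreg : ℕ → ℝ
  iarr : ℕ → ℕ → ℕ
  rarr : ℕ → ℕ → ℝ

/-- The memory occupies only cells, registers and arrays with numbers up to `B`, and the natural
numbers stored in it are at most `B`. -/
def Mem.SizeAtMost (m : Mem) (B : ℝ) : Prop :=
  (∀ i, (m.ireg i : ℝ) ≤ B) ∧ (∀ a i, (m.iarr a i : ℝ) ≤ B) ∧
  (∀ i : ℕ, B < i → m.ireg i = 0 ∧ m.rreg i = 0) ∧
  (∀ a i : ℕ, B < a ∨ B < i → m.iarr a i = 0 ∧ m.rarr a i = 0)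

/-- A vector given as a sparse list: the length of the list is in integer register `0`, its
indices are in integer array `0` and its values are in real array `0`. -/
noncomputable def Mem.output (m : Mem) (N : ℕ) : Fin N → ℝ :=
  ∑ i ∈ Finset.range (m.ireg 0), spike N (m.iarr 0 i) (m.rarr 0 i)

/-- A configuration: the memory together with the number of queries to the input vector and the
number of time steps so far. -/
structure Config where
  mem : Mem
  queries : ℕ
  time : ℕ

namespace Config

/-- One time step. -/
def tick (s : Config) : Config := ⟨s.mem, s.queries, s.time + 1⟩

/-- One query to the input vector. -/
def countQuery (s : Config) : Config := ⟨s.mem, s.queries + 1, s.time⟩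

def setI (s : Config) (d n : ℕ) : Config :=
  ⟨⟨Function.update s.mem.ireg d n, s.mem.rreg, s.mem.iarr, s.mem.rarr⟩, s.queries, s.time⟩

noncomputable def setR (s : Config) (d : ℕ) (c : ℝ) : Config :=
  ⟨⟨s.mem.ireg, Function.update s.mem.rreg d c, s.mem.iarr, s.mem.rarr⟩, s.queries, s.time⟩

def storeI (s : Config) (a i n : ℕ) : Config :=
  ⟨⟨s.mem.ireg, s.mem.rreg, Function.update s.mem.iarr a (Function.update (s.mem.iarr a) i n),
    s.mem.rarr⟩, s.queries, s.time⟩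

noncomputable def storeR (s : Config) (a i : ℕ) (c : ℝ) : Config :=
  ⟨⟨s.mem.ireg, s.mem.rreg, s.mem.iarr,
    Function.update s.mem.rarr a (Function.update (s.mem.rarr a) i c)⟩, s.queries, s.time⟩

end Config

/-- Real arithmetic operations. -/
inductive RealOp
  | add
  | sub
  | mul
  | div

noncomputable def RealOp.apply : RealOp → ℝ → ℝ → ℝ
  | .add, a, b => a + b
  | .sub, a, b => a - b
  | .mul, a, b => a * b
  | .div, a, b => a / b

/-- Programs. All arguments of type `ℕ`, except the constants `n`, are names of registers or of
arrays. -/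
inductive Prog
  | skip
  | seq (c₁ c₂ : Prog)
  /-- `ireg d := n` -/
  | constI (d n : ℕ)
  /-- `ireg d := ireg a + ireg b` -/
  | addI (d a b : ℕ)
  /-- `ireg d := ireg a - ireg b` (truncated at zero) -/
  | subI (d a b : ℕ)
  /-- `ireg d := (iarr arr)[ireg i]` -/
  | loadI (d arr i : ℕ)
  /-- `(iarr arr)[ireg i] := ireg a` -/
  | saveI (arr i a : ℕ)
  /-- `rreg d := n` -/
  | constR (d n : ℕ)
  /-- `rreg d := rreg a ∘ rreg b` for an arithmetic operation `∘` -/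
  | opR (op : RealOp) (d a b : ℕ)
  /-- `rreg d := (rarr arr)[ireg i]` -/
  | loadR (d arr i : ℕ)
  /-- `(rarr arr)[ireg i] := rreg a` -/
  | saveR (arr i a : ℕ)
  /-- query the input vector: `rreg d := v[ireg i]` -/
  | query (d i : ℕ)
  /-- `ireg d :=` a uniformly random element of `{0, …, ireg b}` -/
  | rand (d b : ℕ)
  /-- branch on `ireg a ≤ ireg b` -/
  | ifI (a b : ℕ) (c₁ c₂ : Prog)
  /-- branch on `rreg a ≤ rreg b` -/
  | ifR (a b : ℕ) (c₁ c₂ : Prog)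
  /-- execute `body` `ireg n` times (the number is fixed when the loop is entered) -/
  | loop (n : ℕ) (body : Prog)
  /-- Run the black-box procedure with fresh randomness. A query of the procedure at index `j` is
  answered by executing `body` with `j` in integer register `qi`, the answer being the content of
  real register `qr` afterwards. The output `a • e_h` is placed in `ireg d` and `rreg e`. -/
  | call (body : Prog) (qi qr d e : ℕ)

/-- Run a black-box procedure from the configuration `s`, with its queries answered by `answer`;
every step of the procedure costs one unit of time, in addition to the cost of the answers. -/
noncomputable def QueryProc.simulate {N : ℕ} (answer : ℕ → Config → PMF (ℝ × Config)) :
    QueryProc N → Config → PMF (ℕ × ℝ × Config)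
  | .ret h a, s => PMF.pure (h, a, s)
  | .step next, s => next.simulate answer s.tick
  | .query j next, s => (answer j s.tick).bind fun r => (next r.1).simulate answer r.2
  | .rand m next, s => (PMF.uniformOfFintype (Fin (m + 1))).bind fun c =>
      (next c).simulate answer s.tick

/-- `n` consecutive executions of `f`, each with one time step for the loop counter. -/
noncomputable def iterate (f : Config → PMF Config) : ℕ → Config → PMF Config
  | 0, s => PMF.pure s
  | n + 1, s => (f s.tick).bind (iterate f n)

open Classical in
/-- The distribution of the final configuration of a program started in the configuration `s`, with
query access to the vector `v` and with the procedure `A` as its black box. Every instruction,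
test and loop iteration takes one unit of time. -/
noncomputable def Prog.run {N : ℕ} (v : Fin N → ℝ) (A : QueryProc N) : Prog → Config → PMF Config
  | .skip, s => PMF.pure s
  | .seq c₁ c₂, s => (c₁.run v A s).bind (c₂.run v A)
  | .constI d n, s => PMF.pure (s.tick.setI d n)
  | .addI d a b, s => PMF.pure (s.tick.setI d (s.mem.ireg a + s.mem.ireg b))
  | .subI d a b, s => PMF.pure (s.tick.setI d (s.mem.ireg a - s.mem.ireg b))
  | .loadI d arr i, s => PMF.pure (s.tick.setI d (s.mem.iarr arr (s.mem.ireg i)))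
  | .saveI arr i a, s => PMF.pure (s.tick.storeI arr (s.mem.ireg i) (s.mem.ireg a))
  | .constR d n, s => PMF.pure (s.tick.setR d (n : ℝ))
  | .opR op d a b, s => PMF.pure (s.tick.setR d (op.apply (s.mem.rreg a) (s.mem.rreg b)))
  | .loadR d arr i, s => PMF.pure (s.tick.setR d (s.mem.rarr arr (s.mem.ireg i)))
  | .saveR arr i a, s => PMF.pure (s.tick.storeR arr (s.mem.ireg i) (s.mem.rreg a))
  | .query d i, s => PMF.pure (s.tick.countQuery.setR d
      (if h : s.mem.ireg i < N then v ⟨s.mem.ireg i, h⟩ else 0))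
  | .rand d b, s => (PMF.uniformOfFintype (Fin (s.mem.ireg b + 1))).map fun c => s.tick.setI d c
  | .ifI a b c₁ c₂, s =>
      if s.mem.ireg a ≤ s.mem.ireg b then c₁.run v A s.tick else c₂.run v A s.tick
  | .ifR a b c₁ c₂, s =>
      if s.mem.rreg a ≤ s.mem.rreg b then c₁.run v A s.tick else c₂.run v A s.tick
  | .loop n body, s => iterate (body.run v A) (s.mem.ireg n) s.tick
  | .call body qi qr d e, s =>
      (A.simulate (fun j s' => (body.run v A (s'.setI qi j)).map fun s'' => (s''.mem.rreg qr, s''))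
        s.tick).map fun r => (r.2.2.setI d r.1).setR e r.2.1

/-! Multiplying the coefficients `F v` pointwise by `f(λ_i)`, for a polynomial `f`, corresponds to
applying the matrix `Fᵀ diag(f(λ_i)) F` to `v`. If `f` has degree at most `D`, this matrix vanishes
at distance more than `D` from the diagonal (`filterMatrix_banded`): `f p_b` is a combination of
`p_0, …, p_{D+b}`, and `F` is orthogonal. Hence each entry of the filtered vector costs at most `2D
+ 1` queries to `v`, and the filtered vector can be offered to the black box without ever being
written down.

The filters are `(1 - (x - a)²/4)^m`, with `a` running over a grid of mesh `1/m` in `[-1, 1]`. Such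
a filter is at least `3/4` at roots within `1/m` of `a` and at most `4/(m d²)` at roots at distance
`d` or more. The upper density bound turns index separation `C₁ γ N` into angle separation `γ/2`
(`angle_gap`), and then into root separation `γ²/20` (`root_gap`). For `m` of order `C k / (δ² γ⁴)`,
the filter whose centre is next to `λ_h` therefore turns the spectrum into one spike at `h` plus a
perturbation within the tolerance of the black box, provided that the coefficient at `h` is not
negligible (`isolate`).

Only the index returned by the black box is used. Its coefficient `∑ F[h,j] v_j` is estimated afresh
from uniformly sampled entries, as a median of means; the variance is governed by `N U² ‖v‖²`, since
`|F[h,j]| ≤ U`. An index is recorded at most once, so a meaningless answer of the black box, for a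
filter that isolates nothing, merely adds one more accurately estimated coefficient of `v`.

With `M = 2m + 1` filters, each estimate has error at most `ρ = (3/2) δ ‖x‖ / M`. The total error
consists of negligible coefficients that were missed (at most `δ ‖x‖`), noise (at most `(δ/2) ‖x‖`)
and estimation errors (at most `M ρ`), which add up to `3 δ ‖x‖` (`output_error`, `main_holds`). The
failure probability `μ` is shared equally between at most `k` relevant calls and `M` estimates. Time
and queries are bounded syntactically, because no register that controls a loop is ever written
(`Prog.run_cost`). -/

open scoped ENNReal

/-! ### Zeros of orthogonal polynomials and the Christoffel–Darboux kernel -/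

namespace IsOrthonormalFamily

variable {p : ℕ → ℝ[X]} {ν : Measure ℝ}

theorem ae_mem (hp : IsOrthonormalFamily p ν) : ∀ᵐ t ∂ν, t ∈ Set.Icc (-1 : ℝ) 1 :=
  hp.support

theorem integrable (hp : IsOrthonormalFamily p ν) (q : ℝ[X]) :
    Integrable (fun t => q.eval t) ν := by
  have := hp.finite
  obtain ⟨C, hC⟩ := isCompact_Icc.exists_bound_of_continuousOn
    (s := Set.Icc (-1 : ℝ) 1) (f := fun t => q.eval t) q.continuous.continuousOn
  exact Integrable.of_bound q.continuous.aestronglyMeasurable C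
    (hp.ae_mem.mono fun t ht => hC t ht)

theorem ne_zero (hp : IsOrthonormalFamily p ν) (i : ℕ) : p i ≠ 0 := fun h => by
  simpa [h] using hp.degree i

theorem natDegree (hp : IsOrthonormalFamily p ν) (i : ℕ) : (p i).natDegree = i :=
  natDegree_eq_of_degree_eq_some (hp.degree i)

theorem exists_expansion (hp : IsOrthonormalFamily p ν) (n : ℕ) :
    ∀ q : ℝ[X], q.degree < n → ∃ c : ℕ → ℝ, q = ∑ i ∈ Finset.range n, C (c i) * p i := by
  induction n with
  | zero =>
    intro q hq
    exact ⟨0, by simpa [degree_lt_iff_coeff_zero, Polynomial.ext_iff] using hq⟩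
  | succ n ih =>
    intro q hq
    have hl : (p n).coeff n ≠ 0 := by
      have := leadingCoeff_ne_zero.2 (hp.ne_zero n)
      rwa [leadingCoeff, hp.natDegree] at this
    obtain ⟨c, hc⟩ := ih (q - C (q.coeff n / (p n).coeff n) * p n) (by
      rw [degree_lt_iff_coeff_zero] at hq ⊢
      intro m hm
      rcases hm.eq_or_lt with rfl | hm
      · simp [div_mul_cancel₀ _ hl]
      · have h2 : (p n).coeff m = 0 :=
          coeff_eq_zero_of_natDegree_lt (by rw [hp.natDegree]; exact hm)
        simp [hq m hm, h2])
    refine ⟨fun i => if i = n then q.coeff n / (p n).coeff n else c i, ?_⟩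
    rw [Finset.sum_range_succ, Finset.sum_congr rfl (g := fun i => C (c i) * p i), ← hc]
    · simp
    · intro i hi
      simp [(Finset.mem_range.1 hi).ne]

theorem integral_expansion_mul (hp : IsOrthonormalFamily p ν) (n : ℕ) (c : ℕ → ℝ) (j : ℕ) :
    ∫ t, (∑ i ∈ Finset.range n, C (c i) * p i).eval t * (p j).eval t ∂ν =
      if j < n then c j else 0 := by
  have h : ∀ i ∈ Finset.range n,
      Integrable (fun t => c i * ((p i).eval t * (p j).eval t)) ν := fun i _ => by
    simpa using (hp.integrable (p i * p j)).const_mul (c i)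
  calc _ = ∫ t, ∑ i ∈ Finset.range n, c i * ((p i).eval t * (p j).eval t) ∂ν := by
        simp only [eval_finsetSum, Finset.sum_mul, eval_mul, eval_C, mul_assoc]
    _ = ∑ i ∈ Finset.range n, c i * if i = j then 1 else 0 := by
        rw [integral_finsetSum _ h]
        simp only [integral_const_mul, hp.orthonormal]
    _ = _ := by simp

theorem integral_mul_eq_zero (hp : IsOrthonormalFamily p ν) {n : ℕ} {q : ℝ[X]}
    (hq : q.degree < n) : ∫ t, q.eval t * (p n).eval t ∂ν = 0 := by
  obtain ⟨c, rfl⟩ := hp.exists_expansion n q hq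
  simp [hp.integral_expansion_mul]

/-- `p n` has no non-constant divisor that is positive on `[-1, 1]`. -/
theorem not_dvd_of_pos (hp : IsOrthonormalFamily p ν) {n : ℕ} {a : ℝ[X]}
    (ha : a ∣ p n) (ha0 : 0 < a.natDegree) (hpos : ∀ t ∈ Set.Icc (-1 : ℝ) 1, 0 < a.eval t) :
    False := by
  obtain ⟨s, hs⟩ := ha
  have hs0 : s ≠ 0 := fun h => hp.ne_zero n (by simp [hs, h])
  have ha1 : a ≠ 0 := fun h => by simp [h] at ha0
  have hdeg : s.degree < n := by
    have := hp.natDegree n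
    rw [hs, natDegree_mul ha1 hs0] at this
    rw [degree_eq_natDegree hs0]
    exact_mod_cast (by omega : s.natDegree < n)
  -- With `p n = a s`, the integrand is `s · p n`, and `s` has degree below `n`. Positivity of `a`
  -- then makes `s`, and with it `p n`, vanish almost everywhere, against `∫ (p n)² = 1`.
  have h0 : ∫ t, (a * s ^ 2).eval t ∂ν = 0 := by
    rw [← hp.integral_mul_eq_zero hdeg, hs]
    refine integral_congr_ae (Eventually.of_forall fun t => ?_)
    simp only [eval_mul, eval_pow]; ring
  have h1 : (fun t => (a * s ^ 2).eval t) =ᵐ[ν] 0 := by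
    refine (integral_eq_zero_iff_of_nonneg_ae ?_ (hp.integrable _)).1 h0
    filter_upwards [hp.ae_mem] with t ht
    simp only [eval_mul, eval_pow, Pi.zero_apply]
    exact mul_nonneg (hpos t ht).le (sq_nonneg _)
  have h2 : ∫ t, (p n).eval t * (p n).eval t ∂ν = 0 := by
    rw [← integral_zero ℝ ℝ (μ := ν)]
    refine integral_congr_ae ?_
    filter_upwards [hp.ae_mem, h1] with t ht h
    have h3 : s.eval t = 0 := by simpa [(hpos t ht).ne'] using h
    simp [hs, h3]
  rw [hp.orthonormal, if_pos rfl] at h2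
  exact one_ne_zero h2

/-- An irreducible real factor of degree other than one has no real zero, hence constant sign, so it
or its negative is excluded by `not_dvd_of_pos`. -/
theorem splits (hp : IsOrthonormalFamily p ν) (n : ℕ) : (p n).Splits := by
  suffices h : ∀ g : ℝ[X], Irreducible g → g ∣ p n → g.degree = 1 by
    obtain ⟨u, hu⟩ := UniqueFactorizationMonoid.factors_prod (hp.ne_zero n)
    rw [← hu]
    exact (Splits.multisetProd fun g hg => Splits.of_degree_eq_one
      (h g (UniqueFactorizationMonoid.irreducible_of_factor g hg)
        (UniqueFactorizationMonoid.dvd_of_mem_factors hg))).mul u.isUnit.splits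
  intro g hg hdvd
  by_contra hne
  have hnr : ∀ t, g.eval t ≠ 0 := fun t ht =>
    hne (degree_eq_one_of_irreducible_of_root hg ht)
  have hd : 0 < g.natDegree := hg.natDegree_pos
  have hsign : (∀ t, 0 < g.eval t) ∨ ∀ t, g.eval t < 0 := by
    by_contra hcon
    push Not at hcon
    obtain ⟨⟨a, ha⟩, b, hb⟩ := hcon
    obtain ⟨t, ht⟩ := mem_range_of_exists_le_of_exists_ge g.continuous ⟨a, ha⟩ ⟨b, hb⟩
    exact hnr t ht
  rcases hsign with h | h
  · exact hp.not_dvd_of_pos hdvd hd fun t _ => h t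
  · exact hp.not_dvd_of_pos (a := -g) (by simpa using hdvd) (by simpa using hd)
      fun t _ => by simpa using h t

/-- A zero `r` outside the interval would make `X - r` or `r - X` a positive divisor there. -/
theorem root_mem (hp : IsOrthonormalFamily p ν) {n : ℕ} {r : ℝ} (hr : (p n).eval r = 0) :
    r ∈ Set.Icc (-1 : ℝ) 1 := by
  have hdvd : X - C r ∣ p n := dvd_iff_isRoot.2 hr
  constructor
  · by_contra h
    exact hp.not_dvd_of_pos hdvd (by simp) fun t ht => by simp; linarith [ht.1]
  · by_contra h
    refine hp.not_dvd_of_pos (a := -(X - C r)) (by rwa [neg_dvd]) (by rw [natDegree_neg]; simp)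
      fun t ht => by simp; linarith [ht.2]

/-- The quotient of `p n` by `X - r` is a non-zero multiple of the Christoffel–Darboux kernel. -/
theorem exists_kernel (hp : IsOrthonormalFamily p ν) {n : ℕ} {r : ℝ} {q : ℝ[X]}
    (hq : p n = (X - C r) * q) : ∃ S : ℝ, S ≠ 0 ∧
      ∀ t, q.eval t = S * ∑ i ∈ Finset.range n, (p i).eval r * (p i).eval t := by
  have hq0 : q ≠ 0 := fun h => hp.ne_zero n (by simp [hq, h])
  have hnat : q.natDegree + 1 = n := by
    have := hp.natDegree n
    rw [hq, natDegree_mul (X_sub_C_ne_zero r) hq0, natDegree_X_sub_C] at this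
    omega
  have hdeg : q.degree < n := by
    rw [degree_eq_natDegree hq0]
    exact_mod_cast (by omega : q.natDegree < n)
  obtain ⟨c, hc⟩ := hp.exists_expansion n q hdeg
  -- Write `p i = (X - r) g + p i (r)`. Since `q (X - r) = p n` is orthogonal to `g`, testing `q`
  -- against `p i` sees only the constant `p i (r)`.
  have key : ∀ i < n, c i = (p i).eval r * ∫ t, q.eval t ∂ν := by
    intro i hi
    have h1 := hp.integral_expansion_mul n c i
    rw [if_pos hi, ← hc] at h1
    obtain ⟨g, hg⟩ : X - C r ∣ p i - C ((p i).eval r) := dvd_iff_isRoot.2 (by simp)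
    have hg' : p i = (X - C r) * g + C ((p i).eval r) := by rw [← hg]; ring
    have hgdeg : g.degree < n := by
      by_cases hg0 : g = 0
      · simp [hg0]
      have h3 : (p i - C ((p i).eval r)).natDegree ≤ i := by
        rw [natDegree_sub_C, hp.natDegree]
      rw [hg, natDegree_mul (X_sub_C_ne_zero r) hg0, natDegree_X_sub_C] at h3
      rw [degree_eq_natDegree hg0]
      exact_mod_cast (by omega : g.natDegree < n)
    have h4 : ∀ t, q.eval t * (p i).eval t =
        g.eval t * (p n).eval t + (p i).eval r * q.eval t := by
      intro t
      have : (p i).eval t = (t - r) * g.eval t + (p i).eval r := by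
        conv_lhs => rw [hg']
        simp
      rw [this, hq]; simp; ring
    simp only [h4] at h1
    rw [integral_add (by simpa using hp.integrable (g * p n))
      ((hp.integrable q).const_mul _), hp.integral_mul_eq_zero hgdeg,
      integral_const_mul, zero_add] at h1
    exact h1.symm
  have hfin : ∀ t, q.eval t =
      (∫ t, q.eval t ∂ν) * ∑ i ∈ Finset.range n, (p i).eval r * (p i).eval t := by
    intro t
    conv_lhs => rw [hc]
    rw [eval_finsetSum, Finset.mul_sum]
    refine Finset.sum_congr rfl fun i hi => ?_
    rw [eval_mul, eval_C, key i (Finset.mem_range.1 hi)]; ring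
  refine ⟨∫ t, q.eval t ∂ν, fun h0 => hq0 (Polynomial.funext fun t => ?_), hfin⟩
  rw [hfin t, h0, zero_mul, eval_zero]

theorem kernel_pos (hp : IsOrthonormalFamily p ν) {n : ℕ} (hn : 0 < n) (r : ℝ) :
    0 < ∑ i ∈ Finset.range n, (p i).eval r ^ 2 := by
  refine Finset.sum_pos' (fun i _ => sq_nonneg _) ⟨0, Finset.mem_range.2 hn, ?_⟩
  have h := hp.degree 0
  rw [Nat.cast_zero] at h
  rw [eq_C_of_degree_eq_zero h]
  have : (p 0).coeff 0 ≠ 0 := fun h0 => by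
    have := eq_C_of_degree_eq_zero h
    rw [h0, map_zero] at this
    exact hp.ne_zero 0 this
  simpa using pow_pos (abs_pos.2 this) 2 |>.trans_eq (sq_abs _)

/-- The quotient of `p n` by `X - r` keeps every other zero of `p n` and is a non-zero multiple of
the kernel at `r`. This is what makes distinct rows of the transform orthogonal. -/
theorem kernel_eq_zero (hp : IsOrthonormalFamily p ν) {n : ℕ} {r t : ℝ}
    (hr : (p n).eval r = 0) (ht : (p n).eval t = 0) (hne : r ≠ t) :
    ∑ i ∈ Finset.range n, (p i).eval r * (p i).eval t = 0 := by
  obtain ⟨q, hq⟩ : X - C r ∣ p n := dvd_iff_isRoot.2 hr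
  obtain ⟨S, hS, h⟩ := hp.exists_kernel hq
  have h1 : q.eval t = 0 := by
    rw [hq] at ht
    simpa [sub_ne_zero.2 hne.symm] using ht
  simpa [hS, h1] using (h t).symm

/-- At a double zero `r` the quotient of `p n` by `X - r` would vanish at `r`, but there it is a
non-zero multiple of `∑ p_i(r)² > 0`. -/
theorem nodup_roots (hp : IsOrthonormalFamily p ν) (n : ℕ) : (p n).roots.Nodup := by
  rw [Multiset.nodup_iff_count_le_one]
  intro r
  rw [count_roots]
  by_contra hcon
  push Not at hcon
  obtain ⟨g, hg⟩ := (le_rootMultiplicity_iff (hp.ne_zero n)).1 hcon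
  have hn : 0 < n := by
    rcases Nat.eq_zero_or_pos n with rfl | h
    · have h1 := (hp.splits 0).natDegree_eq_card_roots
      rw [hp.natDegree] at h1
      have h2 : (p 0).roots = 0 := Multiset.card_eq_zero.1 h1.symm
      have h3 := count_roots (a := r) (p 0)
      rw [h2, Multiset.count_zero] at h3
      omega
    · exact h
  obtain ⟨S, hS, h⟩ := hp.exists_kernel (n := n) (r := r) (q := (X - C r) * g) (by rw [hg]; ring)
  have h0 := h r
  have := (hp.kernel_pos hn r).ne'
  simp only [← sq] at h0
  simp [hS, this] at h0

end IsOrthonormalFamily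

/-! ## Norms and orthogonal matrices -/

theorem l2_sq {N : ℕ} (x : Fin N → ℝ) : l2 x ^ 2 = ∑ i, x i ^ 2 := by
  simp [l2, EuclideanSpace.norm_sq_eq]

theorem l2_nonneg {N : ℕ} (x : Fin N → ℝ) : 0 ≤ l2 x := norm_nonneg _

theorem l2_add_le {N : ℕ} (x y : Fin N → ℝ) : l2 (x + y) ≤ l2 x + l2 y := by
  simpa [l2] using norm_add_le (WithLp.toLp 2 x) (WithLp.toLp 2 y)

theorem l2_sub_le {N : ℕ} (x y : Fin N → ℝ) : l2 (x - y) ≤ l2 x + l2 y := by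
  simpa [l2] using norm_sub_le (WithLp.toLp 2 x) (WithLp.toLp 2 y)

theorem abs_le_l2 {N : ℕ} (x : Fin N → ℝ) (i : Fin N) : |x i| ≤ l2 x := by
  refine abs_le_of_sq_le_sq ?_ (l2_nonneg x)
  rw [l2_sq]
  exact Finset.single_le_sum (f := fun i => x i ^ 2) (fun i _ => sq_nonneg _) (Finset.mem_univ i)

theorem l2_le_mul_l2 {N : ℕ} {x y : Fin N → ℝ} {c : ℝ} (hc : 0 ≤ c)
    (h : ∀ i, |x i| ≤ c * |y i|) : l2 x ≤ c * l2 y := by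
  refine (sq_le_sq₀ (l2_nonneg x) (mul_nonneg hc (l2_nonneg y))).1 ?_
  rw [mul_pow, l2_sq, l2_sq, Finset.mul_sum]
  refine Finset.sum_le_sum fun i _ => ?_
  rw [← sq_abs (x i), ← sq_abs (y i), ← mul_pow]
  exact pow_le_pow_left₀ (abs_nonneg _) (h i) 2

theorem l2_le_of_abs_le {N : ℕ} {x y : Fin N → ℝ} (h : ∀ i, |x i| ≤ |y i|) : l2 x ≤ l2 y := by
  simpa using l2_le_mul_l2 (c := 1) zero_le_one (by simpa using h)

theorem l2_mulVec {N : ℕ} {F : Matrix (Fin N) (Fin N) ℝ} (hF : F.transpose * F = 1)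
    (x : Fin N → ℝ) : l2 (F.mulVec x) = l2 x := by
  rw [← sq_eq_sq₀ (l2_nonneg _) (l2_nonneg _), l2_sq, l2_sq]
  have h : F.mulVec x ⬝ᵥ F.mulVec x = x ⬝ᵥ x := by
    rw [Matrix.dotProduct_mulVec, Matrix.vecMul_mulVec, hF, Matrix.vecMul_one]
  simpa [dotProduct, sq] using h

/-! ## Roots and angles -/

namespace IsOrthonormalFamily

variable {p : ℕ → ℝ[X]} {ν : Measure ℝ}

theorem length_sort_roots (hp : IsOrthonormalFamily p ν) (N : ℕ) :
    ((p N).roots.sort (· ≤ ·)).length = N := by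
  rw [Multiset.length_sort, ← (hp.splits N).natDegree_eq_card_roots, hp.natDegree]

theorem opRoot_eq (hp : IsOrthonormalFamily p ν) {N : ℕ} (i : Fin N) :
    opRoot p N i = ((p N).roots.sort (· ≤ ·))[(i : ℕ)]'(by
      rw [hp.length_sort_roots]; exact i.2) := by
  rw [opRoot, List.getD_eq_getElem]

theorem eval_opRoot (hp : IsOrthonormalFamily p ν) {N : ℕ} (i : Fin N) :
    (p N).eval (opRoot p N i) = 0 := by
  have h : opRoot p N i ∈ (p N).roots := by
    rw [← Multiset.mem_sort (r := (· ≤ ·)), hp.opRoot_eq]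
    exact List.getElem_mem _
  exact (mem_roots'.1 h).2

theorem opRoot_strictMono (hp : IsOrthonormalFamily p ν) (N : ℕ) :
    StrictMono (opRoot p N) := by
  have hnd : ((p N).roots.sort (· ≤ ·)).Nodup := by
    rw [← Multiset.coe_nodup, Multiset.sort_eq]
    exact hp.nodup_roots N
  have hs := ((p N).roots.pairwise_sort (· ≤ ·)).sortedLE.sortedLT_of_nodup hnd
  intro i j hij
  rw [hp.opRoot_eq, hp.opRoot_eq]
  exact hs.strictMono_get (a := ⟨i, _⟩) (b := ⟨j, _⟩) hij

theorem opRoot_mem (hp : IsOrthonormalFamily p ν) {N : ℕ} (i : Fin N) :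
    opRoot p N i ∈ Set.Icc (-1 : ℝ) 1 :=
  hp.root_mem (hp.eval_opRoot i)

theorem cos_opAngle (hp : IsOrthonormalFamily p ν) {N : ℕ} (i : Fin N) :
    Real.cos (opAngle p N i) = opRoot p N i :=
  Real.cos_arccos (hp.opRoot_mem i).1 (hp.opRoot_mem i).2

theorem opAngle_strictAnti (hp : IsOrthonormalFamily p ν) (N : ℕ) :
    StrictAnti (opAngle p N) := fun i j hij =>
  Real.strictAntiOn_arccos (hp.opRoot_mem i) (hp.opRoot_mem j) (hp.opRoot_strictMono N hij)

/-! ## The transform is orthogonal -/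

theorem quadWeight_pos (hp : IsOrthonormalFamily p ν) {N : ℕ} (i : Fin N) :
    0 < quadWeight p N i := by
  have h := hp.kernel_pos i.pos (opRoot p N i)
  rw [← Fin.sum_univ_eq_sum_range (fun j => (p j).eval (opRoot p N i) ^ 2)] at h
  exact one_div_pos.2 h

theorem opTransform_apply (p : ℕ → ℝ[X]) {N : ℕ} (i j : Fin N) :
    opTransform p N i j = Real.sqrt (quadWeight p N i) * (p j).eval (opRoot p N i) := by
  simp [opTransform]

theorem opTransform_mul_transpose (hp : IsOrthonormalFamily p ν) (N : ℕ) :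
    opTransform p N * (opTransform p N).transpose = 1 := by
  ext i l
  have h : (opTransform p N * (opTransform p N).transpose) i l =
      Real.sqrt (quadWeight p N i) * Real.sqrt (quadWeight p N l) *
        ∑ j : Fin N, (p j).eval (opRoot p N i) * (p j).eval (opRoot p N l) := by
    simp only [Matrix.mul_apply, Matrix.transpose_apply, opTransform_apply, Finset.mul_sum]
    exact Finset.sum_congr rfl fun j _ => by ring
  rw [h]
  by_cases hil : i = l
  · subst hil
    rw [Real.mul_self_sqrt (hp.quadWeight_pos i).le, Matrix.one_apply_eq, quadWeight]
    simp only [← sq]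
    refine one_div_mul_cancel ?_
    rw [Fin.sum_univ_eq_sum_range (fun j => (p j).eval (opRoot p N i) ^ 2)]
    exact (hp.kernel_pos i.pos _).ne'
  · rw [Matrix.one_apply_ne hil,
      Fin.sum_univ_eq_sum_range
        (fun j => (p j).eval (opRoot p N i) * (p j).eval (opRoot p N l)),
      hp.kernel_eq_zero (hp.eval_opRoot i) (hp.eval_opRoot l)
        ((hp.opRoot_strictMono N).injective.ne hil), mul_zero]

theorem opTransform_transpose_mul (hp : IsOrthonormalFamily p ν) (N : ℕ) :
    (opTransform p N).transpose * opTransform p N = 1 :=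
  mul_eq_one_comm.1 (hp.opTransform_mul_transpose N)

theorem opTransform_inv (hp : IsOrthonormalFamily p ν) (N : ℕ) :
    (opTransform p N)⁻¹ = (opTransform p N).transpose :=
  Matrix.inv_eq_right_inv (hp.opTransform_mul_transpose N)

/-- The matrix of multiplication by `f` in the frequency domain. -/
noncomputable def _root_.filterMatrix (p : ℕ → ℝ[X]) (N : ℕ) (f : ℝ[X]) :
    Matrix (Fin N) (Fin N) ℝ :=
  (opTransform p N).transpose *
    (Matrix.diagonal (fun i => f.eval (opRoot p N i)) * opTransform p N)

theorem opTransform_mulVec_filterMatrix (hp : IsOrthonormalFamily p ν) (N : ℕ) (f : ℝ[X])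
    (v : Fin N → ℝ) : (opTransform p N).mulVec ((filterMatrix p N f).mulVec v) =
      fun i => f.eval (opRoot p N i) * (opTransform p N).mulVec v i := by
  rw [filterMatrix, Matrix.mulVec_mulVec, ← mul_assoc, hp.opTransform_mul_transpose, one_mul,
    ← Matrix.mulVec_mulVec]
  ext i
  rw [Matrix.mulVec_diagonal]

theorem filterMatrix_apply (N : ℕ) (f : ℝ[X]) (a b : Fin N) :
    filterMatrix p N f a b = ∑ i, quadWeight p N i * ((p a).eval (opRoot p N i) *
      (f.eval (opRoot p N i) * (p b).eval (opRoot p N i))) := by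
  rw [filterMatrix, Matrix.mul_apply]
  refine Finset.sum_congr rfl fun i _ => ?_
  have h : Real.sqrt (quadWeight p N i) * Real.sqrt (quadWeight p N i) = quadWeight p N i :=
    Real.mul_self_sqrt (by unfold quadWeight; positivity)
  rw [Matrix.diagonal_mul, Matrix.transpose_apply, opTransform_apply, opTransform_apply]
  conv_rhs => rw [← h]
  ring

/-- Since `f p_b` has degree below `a`, it is a combination of `p_j` with `j < a`. The entry becomes
the same combination of the entries `(a, j)` of the filter matrix of `1`, which is the identity by
orthogonality of the transform. -/
theorem filterMatrix_eq_zero_of_lt (hp : IsOrthonormalFamily p ν) (N : ℕ) (f : ℝ[X])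
    {a b : Fin N} (h : f.natDegree + b < a) : filterMatrix p N f a b = 0 := by
  have hdeg : (f * p b).degree < (a : ℕ) := by
    refine lt_of_le_of_lt degree_le_natDegree ?_
    have h1 := natDegree_mul_le (p := f) (q := p b)
    rw [hp.natDegree] at h1
    exact_mod_cast lt_of_le_of_lt h1 h
  obtain ⟨c, hc⟩ := hp.exists_expansion a (f * p b) hdeg
  have h2 : ∀ i : Fin N, quadWeight p N i * ((p a).eval (opRoot p N i) *
      (f.eval (opRoot p N i) * (p b).eval (opRoot p N i))) =
      ∑ j ∈ Finset.range a, c j * (quadWeight p N i * ((p a).eval (opRoot p N i) *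
        ((1 : ℝ[X]).eval (opRoot p N i) * (p j).eval (opRoot p N i)))) := by
    intro i
    rw [← eval_mul, hc, eval_finsetSum, Finset.mul_sum, Finset.mul_sum]
    refine Finset.sum_congr rfl fun j _ => ?_
    simp; ring
  rw [filterMatrix_apply, Finset.sum_congr rfl fun i _ => h2 i, Finset.sum_comm]
  refine Finset.sum_eq_zero fun j hj => ?_
  have hja := Finset.mem_range.1 hj
  have h3 := filterMatrix_apply (p := p) N 1 a ⟨j, hja.trans a.2⟩
  rw [← Finset.mul_sum, ← h3]
  have h4 : filterMatrix p N 1 = 1 := by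
    simp [filterMatrix, hp.opTransform_transpose_mul]
  rw [h4, Matrix.one_apply_ne (by simpa [Fin.ext_iff] using hja.ne'), mul_zero]

theorem filterMatrix_comm (N : ℕ) (f : ℝ[X]) (a b : Fin N) :
    filterMatrix p N f a b = filterMatrix p N f b a := by
  rw [filterMatrix_apply, filterMatrix_apply]
  exact Finset.sum_congr rfl fun i _ => by ring

/-- The filter matrices are banded. -/
theorem filterMatrix_banded (hp : IsOrthonormalFamily p ν) (N : ℕ) (f : ℝ[X]) {D : ℕ}
    (hD : f.natDegree ≤ D) {a b : Fin N} (h : D + b < a ∨ D + a < b) :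
    filterMatrix p N f a b = 0 := by
  rcases h with h | h
  · exact hp.filterMatrix_eq_zero_of_lt N f (by omega)
  · rw [filterMatrix_comm]
    exact hp.filterMatrix_eq_zero_of_lt N f (by omega)

/-! ## Separation of roots -/

/-- Angles are monotone in the index, so if two of them were within `γ / 2`, the window around the
first would contain all `|i - j| + 1` angles in between, more than `B`. -/
theorem angle_gap (hp : IsOrthonormalFamily p ν) {N : ℕ} {B γ : ℝ}
    (hub : ∀ i, ((Set.range (opAngle p N) ∩
      Set.Icc (opAngle p N i - γ / 2) (opAngle p N i + γ / 2)).ncard : ℝ) ≤ B)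
    {i j : Fin N} (hij : B < |((i : ℕ) : ℝ) - ((j : ℕ) : ℝ)|) :
    γ / 2 < |opAngle p N i - opAngle p N j| := by
  wlog hlt : i ≤ j generalizing i j
  · rw [abs_sub_comm]
    exact this (by rwa [abs_sub_comm]) (le_of_not_ge hlt)
  by_contra hcon
  push Not at hcon
  have hanti := hp.opAngle_strictAnti N
  have hsub : opAngle p N '' Set.Icc i j ⊆ Set.range (opAngle p N) ∩
      Set.Icc (opAngle p N i - γ / 2) (opAngle p N i + γ / 2) := by
    rintro _ ⟨l, hl, rfl⟩
    have h1 := hanti.antitone hl.1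
    have h2 := hanti.antitone hl.2
    have h3 := abs_le.1 hcon
    have h4 := hanti.antitone hlt
    exact ⟨⟨l, rfl⟩, by linarith, by linarith⟩
  have hcard := Set.ncard_le_ncard hsub (Set.toFinite _)
  rw [Set.ncard_image_of_injective _ hanti.injective, ← Finset.coe_Icc, Set.ncard_coe_finset,
    Fin.card_Icc] at hcard
  have h5 : ((j : ℕ) : ℝ) + 1 - (i : ℕ) ≤ B := by
    refine le_trans ?_ (hub i)
    have : (j : ℕ) + 1 - i + i = (j : ℕ) + 1 := by have : (i : ℕ) ≤ j := hlt; omega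
    have h6 : (((j : ℕ) + 1 - i : ℕ) : ℝ) + (i : ℕ) = (j : ℕ) + 1 := by exact_mod_cast this
    have h7 : (((j : ℕ) + 1 - i : ℕ) : ℝ) ≤ _ := Nat.cast_le.2 hcard
    linarith
  have h6 : ((i : ℕ) : ℝ) ≤ (j : ℕ) := by exact_mod_cast hlt
  rw [abs_sub_comm, abs_of_nonneg (by linarith)] at hij
  linarith

/-- The difference is `2 sin((a+b)/2) sin((b-a)/2)`. Both sines are at least `(b-a)/π`, by Jordan's
inequality for the second and `sin((a+b)/2) ≥ sin((b-a)/2)` for the first; finally `π² ≤ 10`. The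
bound is quadratic because cosine is flat at `0` and `π`. -/
theorem _root_.cos_sub_cos_ge {a b : ℝ} (ha : 0 ≤ a) (hab : a ≤ b) (hb : b ≤ Real.pi) :
    (b - a) ^ 2 / 5 ≤ Real.cos a - Real.cos b := by
  have hpi := Real.pi_pos
  rw [Real.cos_sub_cos]
  have h1 : 2 / Real.pi * ((b - a) / 2) ≤ Real.sin ((b - a) / 2) :=
    Real.mul_le_sin (by linarith) (by linarith)
  have h2 : Real.sin ((b - a) / 2) ≤ Real.sin ((a + b) / 2) := by
    have h : Real.sin ((a + b) / 2) - Real.sin ((b - a) / 2) =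
        2 * Real.sin (a / 2) * Real.cos (b / 2) := by
      have e1 : (a + b) / 2 = a / 2 + b / 2 := by ring
      have e2 : (b - a) / 2 = b / 2 - a / 2 := by ring
      rw [e1, e2, Real.sin_add, Real.sin_sub]; ring
    have h3 : 0 ≤ Real.sin (a / 2) := Real.sin_nonneg_of_nonneg_of_le_pi (by linarith) (by linarith)
    have h4 : 0 ≤ Real.cos (b / 2) := Real.cos_nonneg_of_mem_Icc ⟨by linarith, by linarith⟩
    nlinarith [mul_nonneg h3 h4]
  have h5 : 0 ≤ 2 / Real.pi * ((b - a) / 2) := by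
    have : 0 ≤ b - a := by linarith
    positivity
  have h6 : Real.sin ((a - b) / 2) = -Real.sin ((b - a) / 2) := by
    rw [← Real.sin_neg]; congr 1; ring
  rw [h6]
  have h7 : (2 / Real.pi * ((b - a) / 2)) ^ 2 ≤ Real.sin ((a + b) / 2) * Real.sin ((b - a) / 2) := by
    rw [sq]; exact mul_le_mul (h1.trans h2) h1 h5 (h5.trans (h1.trans h2))
  have h8 : (2 / Real.pi * ((b - a) / 2)) ^ 2 = (b - a) ^ 2 / Real.pi ^ 2 := by
    field_simp
  have h9 : (b - a) ^ 2 / 10 ≤ (b - a) ^ 2 / Real.pi ^ 2 := by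
    refine div_le_div_of_nonneg_left (sq_nonneg _) (by positivity) ?_
    nlinarith [Real.pi_lt_d2]
  linarith

theorem root_gap (hp : IsOrthonormalFamily p ν) {N : ℕ} {γ : ℝ} (hγ : 0 ≤ γ) {i j : Fin N}
    (h : γ / 2 < |opAngle p N i - opAngle p N j|) :
    γ ^ 2 / 20 ≤ |opRoot p N i - opRoot p N j| := by
  wlog hle : opAngle p N i ≤ opAngle p N j generalizing i j
  · rw [abs_sub_comm]
    exact this (by rwa [abs_sub_comm]) (le_of_not_ge hle)
  have h1 := cos_sub_cos_ge (a := opAngle p N i) (b := opAngle p N j) (Real.arccos_nonneg _) hle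
    (Real.arccos_le_pi _)
  rw [hp.cos_opAngle, hp.cos_opAngle] at h1
  rw [abs_sub_comm, abs_of_nonneg (by linarith)] at h
  refine le_trans ?_ (h1.trans (le_abs_self _))
  nlinarith

end IsOrthonormalFamily

/-! ## The filters -/

/-- A polynomial of degree `2 m` which is concentrated around `a` on `[-1, 1]`. -/
noncomputable def bump (m : ℕ) (a : ℝ) : ℝ[X] := (1 - C (1 / 4) * (X - C a) ^ 2) ^ m

theorem natDegree_bump_le (m : ℕ) (a : ℝ) : (bump m a).natDegree ≤ 2 * m := by
  unfold bump
  compute_degree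
  omega

theorem eval_bump (m : ℕ) (a x : ℝ) : (bump m a).eval x = (1 - (x - a) ^ 2 / 4) ^ m := by
  simp [bump]; ring

theorem bump_base_mem {a x : ℝ} (ha : a ∈ Set.Icc (-1 : ℝ) 1) (hx : x ∈ Set.Icc (-1 : ℝ) 1) :
    0 ≤ 1 - (x - a) ^ 2 / 4 := by
  have : (x - a) ^ 2 ≤ 2 ^ 2 := sq_le_sq' (by linarith [ha.2, hx.1]) (by linarith [ha.1, hx.2])
  linarith

theorem eval_bump_nonneg {a x : ℝ} (m : ℕ) (ha : a ∈ Set.Icc (-1 : ℝ) 1)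
    (hx : x ∈ Set.Icc (-1 : ℝ) 1) : 0 ≤ (bump m a).eval x := by
  rw [eval_bump]; exact pow_nonneg (bump_base_mem ha hx) m

theorem eval_bump_le_one {a x : ℝ} (m : ℕ) (ha : a ∈ Set.Icc (-1 : ℝ) 1)
    (hx : x ∈ Set.Icc (-1 : ℝ) 1) : (bump m a).eval x ≤ 1 := by
  rw [eval_bump]
  exact pow_le_one₀ (bump_base_mem ha hx) (by linarith [sq_nonneg (x - a)])

/-- By Bernoulli's inequality the value is at least `1 - m (x - a)² / 4`, and `m · (1/m)² ≤ 1`. -/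
theorem eval_bump_ge {a x : ℝ} {m : ℕ} (hm : 0 < m) (h : |x - a| ≤ 1 / m) :
    3 / 4 ≤ (bump m a).eval x := by
  have hm' : (1 : ℝ) ≤ m := by exact_mod_cast hm
  have h1 : (x - a) ^ 2 ≤ (1 / m : ℝ) ^ 2 := by
    rw [← sq_abs]; exact pow_le_pow_left₀ (abs_nonneg _) h 2
  have h3 : (m : ℝ) * (1 / m : ℝ) ^ 2 ≤ 1 := by
    rw [div_pow, one_pow, mul_one_div, sq, div_mul_eq_div_div, div_self (by positivity)]
    exact (div_le_one (by positivity)).2 hm'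
  have h4 : (1 / m : ℝ) ^ 2 ≤ 1 := by nlinarith [sq_nonneg (1 / m : ℝ)]
  have h2 := one_add_mul_le_pow (a := -((x - a) ^ 2 / 4)) (by linarith) m
  rw [eval_bump, sub_eq_add_neg]
  refine le_trans ?_ h2
  nlinarith

/-- With `u = (x - a)² / 4`, use `(1 - u)^m (1 + u)^m ≤ 1` and Bernoulli's inequality for the second
factor. Polynomial decay in `m` is enough for polynomial complexity. -/
theorem eval_bump_le {a x d : ℝ} {m : ℕ} (hm : 0 < m) (ha : a ∈ Set.Icc (-1 : ℝ) 1)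
    (hx : x ∈ Set.Icc (-1 : ℝ) 1) (hd : 0 < d) (h : d ≤ |x - a|) :
    (bump m a).eval x ≤ 4 / (m * d ^ 2) := by
  have hm' : (1 : ℝ) ≤ m := by exact_mod_cast hm
  have h0 := bump_base_mem ha hx
  have h1 : d ^ 2 ≤ (x - a) ^ 2 := by
    rw [← sq_abs (x - a)]; exact pow_le_pow_left₀ hd.le h 2
  have h2 := one_add_mul_le_pow (a := (x - a) ^ 2 / 4) (by nlinarith [sq_nonneg (x - a)]) m
  have h3 : (1 - (x - a) ^ 2 / 4) ^ m * (1 + (x - a) ^ 2 / 4) ^ m ≤ 1 := by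
    rw [← mul_pow]
    refine pow_le_one₀ (mul_nonneg h0 (by positivity)) ?_
    nlinarith [sq_nonneg ((x - a) ^ 2)]
  rw [eval_bump, le_div_iff₀ (by positivity)]
  have h4 := pow_nonneg h0 m
  have h5 : (m : ℝ) * d ^ 2 ≤ m * (x - a) ^ 2 := by gcongr
  nlinarith

/-- The grid of filter centres. -/
noncomputable def centre (m t : ℕ) : ℝ := -1 + t / m

theorem centre_mem {m t : ℕ} (hm : 0 < m) (ht : t ≤ 2 * m) :
    centre m t ∈ Set.Icc (-1 : ℝ) 1 := by
  have hm' : (0 : ℝ) < m := by exact_mod_cast hm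
  have ht' : (t : ℝ) ≤ 2 * m := by exact_mod_cast ht
  have h1 : (t : ℝ) / m ≤ 2 := (div_le_iff₀ hm').2 ht'
  have h2 : (0 : ℝ) ≤ t / m := by positivity
  exact ⟨by unfold centre; linarith, by unfold centre; linarith⟩

theorem exists_centre {m : ℕ} (hm : 0 < m) {x : ℝ} (hx : x ∈ Set.Icc (-1 : ℝ) 1) :
    ∃ t ≤ 2 * m, |x - centre m t| ≤ 1 / m := by
  have hm' : (0 : ℝ) < m := by exact_mod_cast hm
  have h0 : 0 ≤ (x + 1) * m := mul_nonneg (by linarith [hx.1]) hm'.le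
  refine ⟨⌊(x + 1) * m⌋₊, ?_, ?_⟩
  · refine Nat.floor_le_of_le ?_
    push_cast
    nlinarith [hx.2]
  · have h1 := Nat.floor_le h0
    have h2 := Nat.lt_floor_add_one ((x + 1) * m)
    have h3 : x - centre m ⌊(x + 1) * m⌋₊ = ((x + 1) * m - ⌊(x + 1) * m⌋₊) / m := by
      unfold centre; field_simp; ring
    rw [h3, abs_of_nonneg (by apply div_nonneg <;> linarith)]
    gcongr
    linarith

/-! ## The largest entries -/

/-- Otherwise the `k` largest entries all exceed `|x h|` strictly; they are then non-zero, and
together with `h` they make `k + 1` non-zero entries. -/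
theorem large_le_abs {N k : ℕ} {x : Fin N → ℝ} (hk : {i | x i ≠ 0}.ncard = k) {h : Fin N}
    (hx : x h ≠ 0) : large k x ≤ |x h| := by
  set l := (Finset.univ.val.map fun i => |x i|).sort (· ≥ ·) with hl
  have hlen : l.length = N := by simp [hl]
  have hkN : k ≤ N := by
    rw [← hk]
    simpa using Set.ncard_le_card (s := {i | x i ≠ 0})
  have hk0 : 0 < k := by
    rw [← hk]; exact (Set.ncard_pos (Set.toFinite _)).2 ⟨h, hx⟩
  by_contra hcon
  push Not at hcon
  have hlt : k - 1 < l.length := by omega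
  rw [large, ← hl, List.getD_eq_getElem _ _ hlt] at hcon
  have hs : l.Pairwise (· ≥ ·) := Multiset.pairwise_sort _ _
  have h1 : (l.take k).countP (fun a => |x h| < a) = k := by
    rw [List.countP_eq_length.2, List.length_take, hlen, min_eq_left hkN]
    intro a ha
    obtain ⟨n, hn, rfl⟩ := List.getElem_of_mem ha
    rw [List.getElem_take]
    rw [List.length_take, hlen, min_eq_left hkN] at hn
    have : l[k - 1] ≤ l[n] := by
      rcases (show n ≤ k - 1 by omega).eq_or_lt with rfl | hlt'
      · exact le_rfl
      · exact List.pairwise_iff_getElem.1 hs n (k - 1) (by omega) hlt hlt'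
    simpa using hcon.trans_le this
  have h2 : k ≤ l.countP (fun a => |x h| < a) := by
    rw [← h1]; exact (List.take_sublist k l).countP_le
  have h3 : l.countP (fun a => |x h| < a) =
      (Finset.univ.filter fun i => |x h| < |x i|).card := by
    rw [← Multiset.coe_countP, hl, Multiset.sort_eq, Multiset.countP_map]
    rfl
  have h4 : (Finset.univ.filter fun i => |x h| < |x i|) ⊂ Finset.univ.filter fun i => x i ≠ 0 := by
    refine Finset.ssubset_iff_of_subset (fun i => ?_) |>.2 ⟨h, by simpa using hx, by simp⟩
    simp only [Finset.mem_filter, Finset.mem_univ, true_and]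
    intro hi
    exact abs_pos.1 ((abs_nonneg _).trans_lt hi)
  have h5 := Finset.card_lt_card h4
  have h6 : (Finset.univ.filter fun i => x i ≠ 0).card = k := by
    rw [← hk, ← Set.ncard_coe_finset]; simp
  omega

/-! ## Expectations and failure probabilities -/

namespace PMF

variable {α β : Type*}

/-- The expectation of a nonnegative function. -/
noncomputable def expect (q : PMF α) (Φ : α → ℝ≥0∞) : ℝ≥0∞ := ∑' a, q a * Φ a

/-- `P` holds except with probability at most `ε`. -/
def Holds (q : PMF α) (P : α → Prop) (ε : ℝ≥0∞) : Prop := q.toOuterMeasure {a | ¬P a} ≤ ε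

theorem expect_pure (a : α) (Φ : α → ℝ≥0∞) : (PMF.pure a).expect Φ = Φ a := by
  rw [expect, tsum_eq_single a]
  · simp
  · intro b hb; simp [PMF.pure_apply, hb]

theorem expect_bind (q : PMF α) (f : α → PMF β) (Φ : β → ℝ≥0∞) :
    (q.bind f).expect Φ = q.expect fun a => (f a).expect Φ := by
  simp only [expect, PMF.bind_apply, ← ENNReal.tsum_mul_right, ← ENNReal.tsum_mul_left]
  rw [ENNReal.tsum_comm]
  simp only [mul_assoc]

theorem expect_map (q : PMF α) (g : α → β) (Φ : β → ℝ≥0∞) :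
    (q.map g).expect Φ = q.expect fun a => Φ (g a) := by
  simp only [← PMF.bind_pure_comp, expect_bind, Function.comp_def, expect_pure]

theorem expect_monad_pure {α : Type} (a : α) (Φ : α → ℝ≥0∞) :
    (Pure.pure a : PMF α).expect Φ = Φ a :=
  expect_pure a Φ

theorem expect_monad_bind {α β : Type} (q : PMF α) (f : α → PMF β) (Φ : β → ℝ≥0∞) :
    (q >>= f).expect Φ = q.expect fun a => (f a).expect Φ :=
  expect_bind q f Φ

theorem expect_mono {q : PMF α} {Φ Ψ : α → ℝ≥0∞} (h : ∀ a ∈ q.support, Φ a ≤ Ψ a) :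
    q.expect Φ ≤ q.expect Ψ := by
  refine ENNReal.tsum_le_tsum fun a => ?_
  by_cases ha : q a = 0
  · simp [ha]
  · gcongr
    exact h a ((PMF.mem_support_iff q a).2 ha)

theorem expect_congr {q : PMF α} {Φ Ψ : α → ℝ≥0∞} (h : ∀ a ∈ q.support, Φ a = Ψ a) :
    q.expect Φ = q.expect Ψ :=
  le_antisymm (expect_mono fun a ha => (h a ha).le) (expect_mono fun a ha => (h a ha).ge)

theorem expect_const (q : PMF α) (c : ℝ≥0∞) : (q.expect fun _ => c) = c := by
  rw [expect, ENNReal.tsum_mul_right, q.tsum_coe, one_mul]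

theorem expect_add (q : PMF α) (Φ Ψ : α → ℝ≥0∞) :
    (q.expect fun a => Φ a + Ψ a) = q.expect Φ + q.expect Ψ := by
  simp only [expect, mul_add, ENNReal.tsum_add]

theorem expect_const_mul (q : PMF α) (c : ℝ≥0∞) (Φ : α → ℝ≥0∞) :
    (q.expect fun a => c * Φ a) = c * q.expect Φ := by
  simp only [expect, ← ENNReal.tsum_mul_left]
  exact tsum_congr fun a => mul_left_comm _ _ _

open Classical in
theorem toOuterMeasure_eq_expect (q : PMF α) (P : α → Prop) :
    q.toOuterMeasure {a | ¬P a} = q.expect fun a => if P a then 0 else 1 := by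
  rw [PMF.toOuterMeasure_apply, expect]
  refine tsum_congr fun a => ?_
  by_cases h : P a <;> simp [h]

open Classical in
theorem holds_iff_expect {q : PMF α} {P : α → Prop} {ε : ℝ≥0∞} :
    q.Holds P ε ↔ (q.expect fun a => if P a then 0 else 1) ≤ ε := by
  rw [Holds, toOuterMeasure_eq_expect]

theorem toOuterMeasure_add_compl (q : PMF α) (P : α → Prop) :
    q.toOuterMeasure {a | P a} + q.toOuterMeasure {a | ¬P a} = 1 := by
  classical
  have h := toOuterMeasure_eq_expect q fun a => ¬P a
  simp only [not_not] at h
  rw [h, toOuterMeasure_eq_expect, ← expect_add]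
  refine Eq.trans (expect_congr fun a _ => ?_) (expect_const q 1)
  by_cases hP : P a <;> simp [hP]

theorem holds_ofReal_iff {q : PMF α} {P : α → Prop} {μ : ℝ} (h0 : 0 ≤ μ) (h1 : μ ≤ 1) :
    q.Holds P (ENNReal.ofReal μ) ↔ ENNReal.ofReal (1 - μ) ≤ q.toOuterMeasure {a | P a} := by
  have h := toOuterMeasure_add_compl q P
  have hμ : ENNReal.ofReal (1 - μ) + ENNReal.ofReal μ = 1 := by
    rw [← ENNReal.ofReal_add (by linarith) h0]; simp
  have ht : q.toOuterMeasure {a | ¬P a} ≠ ∞ := fun e => by simp [e] at h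
  rw [Holds]
  constructor
  · intro hle
    refine (ENNReal.add_le_add_iff_right (ENNReal.ofReal_ne_top (r := μ))).1 ?_
    rw [hμ, ← h]
    gcongr
  · intro hle
    refine (ENNReal.add_le_add_iff_left (ENNReal.ofReal_ne_top (r := 1 - μ))).1 ?_
    rw [hμ, ← h]
    gcongr

theorem holds_zero_iff {q : PMF α} {P : α → Prop} : q.Holds P 0 ↔ ∀ a ∈ q.support, P a := by
  rw [Holds, nonpos_iff_eq_zero, PMF.toOuterMeasure_apply_eq_zero_iff, Set.disjoint_left]
  simp

theorem Holds.mono {q : PMF α} {P Q : α → Prop} {ε ε' : ℝ≥0∞} (h : q.Holds P ε)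
    (hPQ : ∀ a ∈ q.support, P a → Q a) (hε : ε ≤ ε') : q.Holds Q ε' := by
  classical
  rw [holds_iff_expect] at h ⊢
  refine (expect_mono fun a ha => ?_).trans (h.trans hε)
  by_cases hP : P a
  · simp [hP, hPQ a ha hP]
  · simp only [hP, if_false]; split_ifs <;> simp

theorem Holds.and {q : PMF α} {P Q : α → Prop} {ε₁ ε₂ : ℝ≥0∞} (h₁ : q.Holds P ε₁)
    (h₂ : q.Holds Q ε₂) : q.Holds (fun a => P a ∧ Q a) (ε₁ + ε₂) := by
  classical
  rw [holds_iff_expect] at h₁ h₂ ⊢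
  refine (expect_mono fun a _ => ?_).trans ((expect_add q _ _).trans_le (add_le_add h₁ h₂))
  by_cases hP : P a <;> by_cases hQ : Q a <;> simp [hP, hQ]

theorem Holds.forall_finset {ι : Type*} {q : PMF α} {P : ι → α → Prop} {ε : ι → ℝ≥0∞}
    {t : Finset ι} (h : ∀ i ∈ t, q.Holds (P i) (ε i)) :
    q.Holds (fun a => ∀ i ∈ t, P i a) (∑ i ∈ t, ε i) := by
  classical
  induction t using Finset.induction_on with
  | empty => exact (holds_zero_iff.2 (by simp)).mono (fun _ _ h => h) (by simp)
  | insert i t hi ih =>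
    rw [Finset.sum_insert hi]
    refine ((h i (Finset.mem_insert_self i t)).and
      (ih fun j hj => h j (Finset.mem_insert_of_mem hj))).mono (fun a _ ha => ?_) le_rfl
    simpa using ha

theorem Holds.bind {q : PMF α} {f : α → PMF β} {P : α → Prop} {Q : β → Prop} {ε₁ ε₂ : ℝ≥0∞}
    (h : q.Holds P ε₁) (hf : ∀ a ∈ q.support, P a → (f a).Holds Q ε₂) :
    (q.bind f).Holds Q (ε₁ + ε₂) := by
  classical
  simp only [holds_iff_expect] at h hf ⊢
  rw [expect_bind]
  calc _ ≤ q.expect fun a => (if P a then 0 else 1) + ε₂ := by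
        refine expect_mono fun a ha => ?_
        by_cases hP : P a
        · simpa [hP] using hf a ha hP
        · simp only [hP, if_false]
          refine le_trans ((expect_mono (Ψ := fun _ => 1) fun b _ => ?_).trans_eq
            (expect_const _ _)) le_self_add
          split_ifs <;> simp
    _ ≤ _ := by
        rw [expect_add, expect_const]
        gcongr

/-- Markov's inequality. -/
theorem holds_of_expect_le {q : PMF α} {P : α → Prop} {Φ : α → ℝ≥0∞} {c ε : ℝ≥0∞}
    (hc0 : c ≠ 0) (hct : c ≠ ∞) (h : ∀ a ∈ q.support, ¬P a → c ≤ Φ a)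
    (hΦ : q.expect Φ ≤ c * ε) : q.Holds P ε := by
  classical
  rw [holds_iff_expect, ← ENNReal.mul_le_mul_iff_right hc0 hct, ← expect_const_mul]
  refine le_trans (expect_mono fun a ha => ?_) hΦ
  by_cases hP : P a
  · simp [hP]
  · simpa [hP] using h a ha hP

theorem expect_uniform (b : ℕ) (Φ : Fin (b + 1) → ℝ≥0∞) :
    (PMF.uniformOfFintype (Fin (b + 1))).expect Φ = ((b + 1 : ℕ) : ℝ≥0∞)⁻¹ * ∑ j, Φ j := by
  simp [expect, tsum_fintype, PMF.uniformOfFintype_apply, Finset.mul_sum]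

end PMF

/-! ## Loops -/

theorem holds_iterate {f : Config → PMF Config} (I : ℕ → Config → Prop) (ε : ℕ → ℝ≥0∞) (n : ℕ)
    (h : ∀ t < n, ∀ s, I t s → (f s.tick).Holds (I (t + 1)) (ε t)) (s : Config) (hs : I 0 s) :
    (iterate f n s).Holds (I n) (∑ t ∈ Finset.range n, ε t) := by
  induction n generalizing I ε s with
  | zero => exact (PMF.holds_zero_iff.2 (by simpa [iterate] using hs)).mono (fun _ _ h => h) (by simp)
  | succ n ih =>
    rw [iterate, Finset.sum_range_succ', add_comm _ (ε 0)]
    -- `iterate` peels off the first pass, so the induction hypothesis is applied to the invariant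
    -- and the error shifted by one.
    exact (h 0 n.succ_pos s hs).bind fun a _ ha =>
      ih (fun t => I (t + 1)) (fun t => ε (t + 1)) (fun t ht => h (t + 1) (by omega)) a ha

theorem iterate_support {f : Config → PMF Config} (I : ℕ → Config → Prop) {n : ℕ}
    (h : ∀ t < n, ∀ s, I t s → ∀ s' ∈ (f s.tick).support, I (t + 1) s') {s : Config}
    (hs : I 0 s) : ∀ s' ∈ (iterate f n s).support, I n s' := by
  have := holds_iterate I (fun _ => 0) n (fun t ht s hs => PMF.holds_zero_iff.2 (h t ht s hs)) s hs
  rw [Finset.sum_const_zero] at this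
  exact PMF.holds_zero_iff.1 this

/-! ## Black-box procedures -/

namespace QueryProc

variable {N : ℕ}

theorem expect_simulate {answer : ℕ → Config → PMF (ℝ × Config)} {y : Fin N → ℝ}
    {Inv : Config → Prop} (htick : ∀ s, Inv s → Inv s.tick)
    (hans : ∀ (j : Fin N) s, Inv s → ∀ r ∈ (answer j s).support, r.1 = y j ∧ Inv r.2)
    (Φ : ℕ → ℝ≥0∞) (A : QueryProc N) (s : Config) (hs : Inv s) :
    ((A.simulate answer s).expect fun r => Φ r.1) = (A.eval y).expect fun o => Φ o.idx := by
  induction A generalizing s with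
  | ret h a => simp [simulate, eval, PMF.expect_pure]
  | step next ih => simpa [simulate, eval, PMF.expect_map] using ih _ (htick s hs)
  | query j next ih =>
    simp only [simulate, eval, PMF.expect_map, PMF.expect_bind]
    rw [← PMF.expect_const (answer j s.tick) (((next (y j)).eval y).expect fun o => Φ o.idx)]
    refine PMF.expect_congr fun r hr => ?_
    obtain ⟨h1, h2⟩ := hans j _ (htick s hs) r hr
    rw [ih _ _ h2, h1]
  | rand m next ih =>
    simp only [simulate, eval, PMF.expect_map, PMF.expect_bind]
    exact PMF.expect_congr fun c _ => ih c _ (htick s hs)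

theorem simulate_cost {answer : ℕ → Config → PMF (ℝ × Config)} {ct cq : ℕ}
    {Inv : Config → Prop} (htick : ∀ s, Inv s → Inv s.tick)
    (hans : ∀ (j : Fin N) s, Inv s → ∀ r ∈ (answer j s).support,
      Inv r.2 ∧ r.2.time ≤ s.time + ct ∧ r.2.queries ≤ s.queries + cq)
    (A : QueryProc N) (Q T : ℕ) (s : Config) (hs : Inv s) :
    ∀ r ∈ ((A.clock Q T).simulate answer s).support, Inv r.2.2 ∧
      r.2.2.time ≤ s.time + T * (ct + 1) ∧ r.2.2.queries ≤ s.queries + Q * cq := by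
  induction A generalizing s Q T with
  | ret h a => simp [clock, simulate, hs]
  | step next ih =>
    cases T with
    | zero => simp [clock, simulate, hs]
    | succ T =>
      intro r hr
      simp only [clock, simulate] at hr
      obtain ⟨h1, h2, h3⟩ := ih Q T _ (htick s hs) r hr
      refine ⟨h1, ?_, h3⟩
      simp only [Config.tick] at h2
      nlinarith
  | query j next ih =>
    match Q, T with
    | 0, T => simp [clock, simulate, hs]
    | Q + 1, 0 => simp [clock, simulate, hs]
    | Q + 1, T + 1 =>
      intro r hr
      simp only [clock, simulate, PMF.mem_support_bind_iff] at hr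
      obtain ⟨a, ha, hr⟩ := hr
      obtain ⟨g1, g2, g3⟩ := hans j _ (htick s hs) a ha
      obtain ⟨h1, h2, h3⟩ := ih _ Q T _ g1 r hr
      simp only [Config.tick] at g2 g3
      exact ⟨h1, by nlinarith, by nlinarith⟩
  | rand m next ih =>
    cases T with
    | zero => simp [clock, simulate, hs]
    | succ T =>
      intro r hr
      simp only [clock, simulate, PMF.mem_support_bind_iff] at hr
      obtain ⟨a, ha, hr⟩ := hr
      obtain ⟨h1, h2, h3⟩ := ih a Q T _ (htick s hs) r hr
      refine ⟨h1, ?_, h3⟩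
      simp only [Config.tick] at h2
      nlinarith

-- The clock does not alter runs that stay within the limits, and runs that exceed them already
-- count as failures on the right. Where the clock cuts the run, the right-hand side equals `1`.
open Classical in
theorem expect_clock_le (y : Fin N → ℝ) (P : ℕ → Prop) (A : QueryProc N) (Q T : ℕ) :
    (((A.clock Q T).eval y).expect fun o => if P o.idx then 0 else 1) ≤
      (A.eval y).expect fun o => if P o.idx ∧ o.queries ≤ Q ∧ o.time ≤ T then 0 else 1 := by
  have hle : ∀ q : PMF QueryOutcome, (q.expect fun o => if P o.idx then 0 else 1) ≤ 1 := fun q =>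
    (PMF.expect_mono (Ψ := fun _ => 1) fun o _ => by split_ifs <;> simp).trans_eq
      (PMF.expect_const _ _)
  induction A generalizing Q T with
  | ret h a => simp [clock, eval, PMF.expect_pure]
  | step next ih =>
    cases T with
    | zero =>
      refine (hle _).trans_eq ?_
      simp [eval, PMF.expect_map, PMF.expect_const]
    | succ T => simpa [clock, eval, PMF.expect_map] using ih Q T
  | query j next ih =>
    match Q, T with
    | 0, T =>
      refine (hle _).trans_eq ?_
      simp [eval, PMF.expect_map, PMF.expect_const]
    | Q + 1, 0 =>
      refine (hle _).trans_eq ?_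
      simp [eval, PMF.expect_map, PMF.expect_const]
    | Q + 1, T + 1 => simpa [clock, eval, PMF.expect_map] using ih (y j) Q T
  | rand m next ih =>
    cases T with
    | zero =>
      refine (hle _).trans_eq ?_
      simp [eval, PMF.expect_map, PMF.expect_bind, PMF.expect_const]
    | succ T =>
      simp only [clock, eval, PMF.expect_map, PMF.expect_bind, add_le_add_iff_right]
      exact PMF.expect_mono fun c _ => ih c Q T

theorem holds_clock {y : Fin N → ℝ} {P : ℕ → Prop} {A : QueryProc N} {Q T : ℕ} {ε : ℝ≥0∞}
    (h : (A.eval y).Holds (fun o => P o.idx ∧ o.queries ≤ Q ∧ o.time ≤ T) ε) :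
    ((A.clock Q T).eval y).Holds (fun o => P o.idx) ε := by
  rw [PMF.holds_iff_expect] at h ⊢
  refine (expect_clock_le y P A Q T).trans (le_of_eq_of_le ?_ h)
  exact PMF.expect_congr fun o _ => by split_ifs <;> rfl

end QueryProc

/-! ## Frames -/

/-- A register or an array. -/
inductive Cell
  | ireg (r : ℕ)
  | rreg (r : ℕ)
  | iarr (a : ℕ)
  | rarr (a : ℕ)

/-- The type of the contents of a register or an array. -/
def Cell.Val : Cell → Type
  | ireg _ => ℕ
  | rreg _ => ℝ
  | iarr _ => ℕ → ℕ
  | rarr _ => ℕ → ℝ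

/-- The contents of a register or an array. -/
def Cell.get : (c : Cell) → Mem → c.Val
  | ireg r, m => m.ireg r
  | rreg r, m => m.rreg r
  | iarr a, m => m.iarr a
  | rarr a, m => m.rarr a

/-- The program may write to the register or array `c`. -/
def Prog.Writes (c : Cell) : Prog → Prop
  | .skip => False
  | .seq c₁ c₂ => c₁.Writes c ∨ c₂.Writes c
  | .constI d _ => c = .ireg d
  | .addI d _ _ => c = .ireg d
  | .subI d _ _ => c = .ireg d
  | .loadI d _ _ => c = .ireg d
  | .saveI arr _ _ => c = .iarr arr
  | .constR d _ => c = .rreg d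
  | .opR _ d _ _ => c = .rreg d
  | .loadR d _ _ => c = .rreg d
  | .saveR arr _ _ => c = .rarr arr
  | .query d _ => c = .rreg d
  | .rand d _ => c = .ireg d
  | .ifI _ _ c₁ c₂ => c₁.Writes c ∨ c₂.Writes c
  | .ifR _ _ c₁ c₂ => c₁.Writes c ∨ c₂.Writes c
  | .loop _ body => body.Writes c
  | .call body qi _ d e => body.Writes c ∨ c = .ireg qi ∨ c = .ireg d ∨ c = .rreg e

theorem Cell.get_setI {c : Cell} {s : Config} {d n : ℕ} (h : c ≠ .ireg d) :
    c.get (s.setI d n).mem = c.get s.mem := by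
  cases c with
  | ireg r => exact Function.update_of_ne (fun e => h (congrArg Cell.ireg e)) _ _
  | _ => rfl

theorem Cell.get_setR {c : Cell} {s : Config} {d : ℕ} {a : ℝ} (h : c ≠ .rreg d) :
    c.get (s.setR d a).mem = c.get s.mem := by
  cases c with
  | rreg r => exact Function.update_of_ne (fun e => h (congrArg Cell.rreg e)) _ _
  | _ => rfl

theorem Cell.get_storeI {c : Cell} {s : Config} {d i n : ℕ} (h : c ≠ .iarr d) :
    c.get (s.storeI d i n).mem = c.get s.mem := by
  cases c with
  | iarr r => exact Function.update_of_ne (fun e => h (congrArg Cell.iarr e)) _ _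
  | _ => rfl

theorem Cell.get_storeR {c : Cell} {s : Config} {d i : ℕ} {a : ℝ} (h : c ≠ .rarr d) :
    c.get (s.storeR d i a).mem = c.get s.mem := by
  cases c with
  | rarr r => exact Function.update_of_ne (fun e => h (congrArg Cell.rarr e)) _ _
  | _ => rfl

theorem QueryProc.simulate_frame {N : ℕ} {answer : ℕ → Config → PMF (ℝ × Config)} {c : Cell}
    (hans : ∀ j s, ∀ r ∈ (answer j s).support, c.get r.2.mem = c.get s.mem)
    (A : QueryProc N) (s : Config) :
    ∀ r ∈ (A.simulate answer s).support, c.get r.2.2.mem = c.get s.mem := by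
  induction A generalizing s with
  | ret h a => simp [simulate]
  | step next ih => exact ih s.tick
  | query j next ih =>
    intro r hr
    simp only [simulate, PMF.mem_support_bind_iff] at hr
    obtain ⟨a, ha, hr⟩ := hr
    exact (ih _ _ r hr).trans (hans j s.tick a ha)
  | rand m next ih =>
    intro r hr
    simp only [simulate, PMF.mem_support_bind_iff] at hr
    obtain ⟨a, ha, hr⟩ := hr
    exact ih a s.tick r hr

/-- A program does not change what it does not write to. -/
theorem Prog.frame {N : ℕ} {v : Fin N → ℝ} {A : QueryProc N} {c : Cell} {P : Prog}
    (hP : ¬P.Writes c) {s : Config} :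
    ∀ s' ∈ (P.run v A s).support, c.get s'.mem = c.get s.mem := by
  have htick : ∀ s : Config, c.get s.tick.mem = c.get s.mem := fun _ => rfl
  induction P generalizing s with
  | skip => simp [run]
  | seq c₁ c₂ ih₁ ih₂ =>
    simp only [Writes, not_or] at hP
    intro s' hs'
    simp only [run, PMF.mem_support_bind_iff] at hs'
    obtain ⟨a, ha, hs'⟩ := hs'
    exact (ih₂ hP.2 s' hs').trans (ih₁ hP.1 a ha)
  | ifI a b c₁ c₂ ih₁ ih₂ =>
    simp only [Writes, not_or] at hP
    intro s' hs'
    rw [run] at hs'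
    split_ifs at hs'
    · exact ih₁ hP.1 (s := s.tick) s' hs'
    · exact ih₂ hP.2 (s := s.tick) s' hs'
  | ifR a b c₁ c₂ ih₁ ih₂ =>
    simp only [Writes, not_or] at hP
    intro s' hs'
    rw [run] at hs'
    split_ifs at hs'
    · exact ih₁ hP.1 (s := s.tick) s' hs'
    · exact ih₂ hP.2 (s := s.tick) s' hs'
  | loop n body ih =>
    exact iterate_support (fun _ s' => c.get s'.mem = c.get s.mem)
      (fun _ _ a ha s' hs' => (ih hP s' hs').trans ha) rfl
  | call body qi qr d e ih =>
    simp only [Writes, not_or] at hP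
    intro s' hs'
    simp only [run, PMF.mem_support_map_iff] at hs'
    obtain ⟨r, hr, rfl⟩ := hs'
    rw [Cell.get_setR hP.2.2.2, Cell.get_setI hP.2.2.1]
    refine QueryProc.simulate_frame (fun j a r hr => ?_) A s.tick r hr
    simp only [PMF.mem_support_map_iff] at hr
    obtain ⟨b, hb, rfl⟩ := hr
    exact (ih hP.1 b hb).trans (Cell.get_setI hP.2.1)
  | saveI arr i a =>
    simp only [run, PMF.mem_support_pure_iff, forall_eq]
    exact (Cell.get_storeI hP).trans (htick s)
  | saveR arr i a =>
    simp only [run, PMF.mem_support_pure_iff, forall_eq]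
    exact (Cell.get_storeR hP).trans (htick s)
  | query d i =>
    simp only [run, PMF.mem_support_pure_iff, forall_eq]
    exact (Cell.get_setR hP).trans (htick s)
  | rand d b =>
    intro s' hs'
    simp only [run, PMF.mem_support_map_iff] at hs'
    obtain ⟨r, hr, rfl⟩ := hs'
    exact (Cell.get_setI hP).trans (htick s)
  | constI | addI | subI | loadI =>
    simp only [run, PMF.mem_support_pure_iff, forall_eq]
    exact (Cell.get_setI hP).trans (htick s)
  | constR | opR | loadR =>
    simp only [run, PMF.mem_support_pure_iff, forall_eq]
    exact (Cell.get_setR hP).trans (htick s)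

/-! ## Static cost bounds -/

namespace Prog

/-- The register `r` controls a loop of the program. -/
def LoopReg (r : ℕ) : Prog → Prop
  | .seq c₁ c₂ => c₁.LoopReg r ∨ c₂.LoopReg r
  | .ifI _ _ c₁ c₂ => c₁.LoopReg r ∨ c₂.LoopReg r
  | .ifR _ _ c₁ c₂ => c₁.LoopReg r ∨ c₂.LoopReg r
  | .loop n body => r = n ∨ body.LoopReg r
  | .call body _ _ _ _ => body.LoopReg r
  | _ => False

/-- A bound on the running time when the loop registers have the same contents as in `m`. -/
def timeBound (m : Mem) (T : ℕ) : Prog → ℕ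
  | .skip => 0
  | .seq c₁ c₂ => c₁.timeBound m T + c₂.timeBound m T
  | .ifI _ _ c₁ c₂ => 1 + c₁.timeBound m T + c₂.timeBound m T
  | .ifR _ _ c₁ c₂ => 1 + c₁.timeBound m T + c₂.timeBound m T
  | .loop n body => 1 + m.ireg n * (body.timeBound m T + 1)
  | .call body _ _ _ _ => 1 + T * (body.timeBound m T + 1)
  | _ => 1

/-- A bound on the number of queries when the loop registers have the same contents as in `m`. -/
def queryBound (m : Mem) (Q : ℕ) : Prog → ℕ
  | .seq c₁ c₂ => c₁.queryBound m Q + c₂.queryBound m Q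
  | .ifI _ _ c₁ c₂ => c₁.queryBound m Q + c₂.queryBound m Q
  | .ifR _ _ c₁ c₂ => c₁.queryBound m Q + c₂.queryBound m Q
  | .loop n body => m.ireg n * body.queryBound m Q
  | .call body _ _ _ _ => Q * body.queryBound m Q
  | .query _ _ => 1
  | _ => 0

/-- The memory of `s` agrees with `m` on everything that `P` does not write to. -/
def Agrees (P : Prog) (m : Mem) (s : Config) : Prop :=
  ∀ c : Cell, ¬P.Writes c → c.get s.mem = c.get m

theorem Agrees.of_run {P P₀ : Prog} {m : Mem} {s s' : Config} {N : ℕ} {v : Fin N → ℝ}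
    {A : QueryProc N} (hs : P₀.Agrees m s) (hsub : ∀ c, P.Writes c → P₀.Writes c)
    (hs' : s' ∈ (P.run v A s).support) : P₀.Agrees m s' := fun c hc =>
  (frame (fun h => hc (hsub c h)) s' hs').trans (hs c hc)

/-- Loop counters that the whole program `P₀` never writes keep their value from `m`, so every loop
length is known in advance. Separating the subprogram `P` from `P₀` is what lets the induction go
through. -/
theorem run_cost {N : ℕ} {v : Fin N → ℝ} {A : QueryProc N} {Q T : ℕ} {m : Mem} {P₀ : Prog}
    (P : Prog) (hsub : ∀ c, P.Writes c → P₀.Writes c)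
    (hloop : ∀ r, P.LoopReg r → ¬P₀.Writes (.ireg r)) {s : Config} (hs : P₀.Agrees m s) :
    ∀ s' ∈ (P.run v (A.clock Q T) s).support,
      s'.time ≤ s.time + P.timeBound m T ∧ s'.queries ≤ s.queries + P.queryBound m Q := by
  induction P generalizing s with
  | skip => simp [run]
  | seq c₁ c₂ ih₁ ih₂ =>
    intro s' hs'
    simp only [run, PMF.mem_support_bind_iff] at hs'
    obtain ⟨a, ha, hs'⟩ := hs'
    have h1 := ih₁ (fun c h => hsub c (.inl h)) (fun r h => hloop r (.inl h)) hs a ha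
    have h2 := ih₂ (fun c h => hsub c (.inr h)) (fun r h => hloop r (.inr h))
      (hs.of_run (fun c h => hsub c (.inl h)) ha) s' hs'
    simp only [timeBound, queryBound]
    omega
  | ifI a b c₁ c₂ ih₁ ih₂ =>
    intro s' hs'
    rw [run] at hs'
    simp only [timeBound, queryBound]
    split_ifs at hs'
    · have := ih₁ (fun c h => hsub c (.inl h)) (fun r h => hloop r (.inl h)) (s := s.tick) hs s' hs'
      simp only [Config.tick] at this
      omega
    · have := ih₂ (fun c h => hsub c (.inr h)) (fun r h => hloop r (.inr h)) (s := s.tick) hs s' hs'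
      simp only [Config.tick] at this
      omega
  | ifR a b c₁ c₂ ih₁ ih₂ =>
    intro s' hs'
    rw [run] at hs'
    simp only [timeBound, queryBound]
    split_ifs at hs'
    · have := ih₁ (fun c h => hsub c (.inl h)) (fun r h => hloop r (.inl h)) (s := s.tick) hs s' hs'
      simp only [Config.tick] at this
      omega
    · have := ih₂ (fun c h => hsub c (.inr h)) (fun r h => hloop r (.inr h)) (s := s.tick) hs s' hs'
      simp only [Config.tick] at this
      omega
  | loop n body ih =>
    intro s' hs'
    have hn : s.mem.ireg n = m.ireg n := hs (.ireg n) (hloop n (.inl rfl))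
    simp only [run, hn] at hs'
    have key := iterate_support (s := s.tick) (fun t s' => P₀.Agrees m s' ∧
        s'.time ≤ s.time + 1 + t * (body.timeBound m T + 1) ∧
        s'.queries ≤ s.queries + t * body.queryBound m Q)
      (fun t _ a ha s' hs' => by
        have h := ih hsub (fun r h => hloop r (.inr h)) (s := a.tick) ha.1 s' hs'
        refine ⟨Agrees.of_run (P := body) (s := a.tick) ha.1 hsub hs', ?_, ?_⟩
        · have := ha.2.1
          have := h.1
          simp only [Config.tick] at this
          rw [add_mul]; omega
        · have := ha.2.2
          have := h.2
          simp only [Config.tick] at this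
          rw [add_mul]; omega)
      ⟨hs, by simp [Config.tick], by simp [Config.tick]⟩ s' hs'
    simp only [timeBound, queryBound]
    omega
  | call body qi qr d e ih =>
    intro s' hs'
    simp only [run, PMF.mem_support_map_iff] at hs'
    obtain ⟨r, hr, rfl⟩ := hs'
    have key := QueryProc.simulate_cost (ct := body.timeBound m T) (cq := body.queryBound m Q)
      (Inv := P₀.Agrees m) (fun _ h => h) (fun j a ha r hr => by
        simp only [PMF.mem_support_map_iff] at hr
        obtain ⟨b, hb, rfl⟩ := hr
        have hq : P₀.Agrees m (a.setI qi j) := fun c hc => by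
          rw [Cell.get_setI (fun h => hc (hsub c (.inr (.inl h)))), ha c hc]
        exact ⟨hq.of_run (fun c h => hsub c (.inl h)) hb,
          ih (fun c h => hsub c (.inl h)) hloop hq b hb⟩) A Q T s.tick hs r hr
    simp only [Config.setR, Config.setI, timeBound, queryBound]
    simp only [Config.tick] at key
    omega
  | rand d b =>
    intro s' hs'
    simp only [run, PMF.mem_support_map_iff] at hs'
    obtain ⟨r, hr, rfl⟩ := hs'
    simp [Config.setI, Config.tick, timeBound]
  | _ => simp [run, Config.setI, Config.setR, Config.storeI, Config.storeR, Config.tick,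
      Config.countQuery, timeBound, queryBound]

end Prog

/-! ## The program -/

namespace Recover

open Prog

/-- One summand of an entry of a filtered vector. -/
def answerStep : Prog :=
  .seq (.subI 14 13 3) <| .seq (.query 2 14) <| .seq (.loadR 3 1 12) <|
  .seq (.opR .mul 2 2 3) <| .seq (.opR .add 1 1 2) <| .seq (.addI 12 12 1) (.addI 13 13 1)

/-- Compute the entry with index `ireg 10` of the current filtered vector. -/
def answer : Prog :=
  .seq (.loadI 12 1 10) <| .seq (.addI 12 12 11) <| .seq (.constR 1 0) <|
  .seq (.addI 13 10 9) (.loop 2 answerStep)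

/-- Add a random sample to the accumulator. -/
def sampleStep : Prog :=
  .seq (.rand 18 6) <| .seq (.addI 19 17 18) <| .seq (.query 2 18) <| .seq (.loadR 3 2 19) <|
  .seq (.opR .mul 2 2 3) (.opR .add 4 4 2)

/-- Store the scaled sum of a group of samples. -/
def group : Prog :=
  .seq (.constR 4 0) <| .seq (.loop 7 sampleStep) <| .seq (.opR .mul 4 4 5) <|
  .seq (.saveR 3 20 4) (.addI 20 20 1)

/-- Compare a group with the current candidate for the median. -/
def compareStep : Prog :=
  .seq (.loadR 8 3 24) <| .seq (.ifR 8 7 (.addI 22 22 1) .skip) <|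
  .seq (.ifR 7 8 (.addI 23 23 1) .skip) (.addI 24 24 1)

/-- Test whether a group is a median. -/
def medianStep : Prog :=
  .seq (.loadR 7 3 21) <| .seq (.constI 22 0) <| .seq (.constI 23 0) <| .seq (.constI 24 0) <|
  .seq (.loop 8 compareStep) <|
  .seq (.ifI 25 22 (.ifI 25 23 (.opR .add 6 7 9) .skip) .skip) (.addI 21 21 1)

/-- Estimate the coefficient with index `ireg 15`. -/
def estimate : Prog :=
  .seq (.loadI 17 2 15) <| .seq (.constI 20 0) <| .seq (.loop 8 group) <|
  .seq (.constI 21 0) (.loop 8 medianStep)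

/-- Mark the index `ireg 15` and append it to the output, with its estimate. -/
def record : Prog :=
  .seq (.saveI 3 15 1) <| .seq estimate <| .seq (.saveI 0 0 15) <| .seq (.saveR 0 0 6)
  (.addI 0 0 1)

/-- Treat one filter. -/
def round : Prog :=
  .seq (.call answer 10 1 15 0) <| .seq (.loadI 16 3 15) <| .seq (.ifI 16 9 record .skip)
  (.addI 11 11 5)

/-- The recovery algorithm. -/
def main : Prog := .loop 4 round

/-- The parameters in the preprocessed memory: length `N`, width `W` and offset `D` of the bands,
number `M` of filters, number `S` of samples in a group, half the number `G` of groups, pointers to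
the rows of the filter matrices and of the transform, and the entries of these matrices. -/
structure Params where
  N : ℕ
  W : ℕ
  D : ℕ
  M : ℕ
  S : ℕ
  G : ℕ
  scale : ℝ
  filterPtr : ℕ → ℕ
  rowPtr : ℕ → ℕ
  filter : ℕ → ℝ
  row : ℕ → ℝ

/-- The preprocessed memory. -/
noncomputable def Params.mem (p : Params) : Mem where
  ireg r := match r with
    | 1 => 1
    | 2 => p.W
    | 3 => p.D
    | 4 => p.M
    | 5 => p.N * p.W
    | 6 => p.N - 1
    | 7 => p.S
    | 8 => 2 * p.G
    | 25 => p.G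
    | _ => 0
  rreg r := if r = 5 then p.scale else 0
  iarr a := if a = 1 then p.filterPtr else if a = 2 then p.rowPtr else 0
  rarr a := if a = 1 then p.filter else if a = 2 then p.row else 0

/-- The input vector, extended by zero. -/
noncomputable def ext {N : ℕ} (v : Fin N → ℝ) (i : ℕ) : ℝ := if h : i < N then v ⟨i, h⟩ else 0

theorem main_timeBound (p : Params) (T : ℕ) : main.timeBound p.mem T =
    1 + p.M * (T * (8 * p.W + 6) + 2 * p.G * (7 * p.S + 14 * p.G + 16) + 14) := by
  simp [main, round, record, estimate, medianStep, compareStep, group, sampleStep, answer,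
    answerStep, timeBound, Params.mem]
  exact Or.inl (by ring)

theorem main_queryBound (p : Params) (Q : ℕ) :
    main.queryBound p.mem Q = p.M * (Q * p.W + 2 * p.G * p.S) := by
  simp [main, round, record, estimate, medianStep, compareStep, group, sampleStep, answer,
    answerStep, queryBound, Params.mem]

theorem not_writes_loopReg {r : ℕ} (h : main.LoopReg r) : ¬main.Writes (.ireg r) := by
  simp [main, round, record, estimate, medianStep, compareStep, group, sampleStep, answer,
    answerStep, LoopReg, Writes] at h ⊢
  omega

variable {p : Params} {s : Config}

/-- The constants that the program finds in the memory. -/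
structure Consts (p : Params) (s : Config) : Prop where
  i1 : s.mem.ireg 1 = 1
  i2 : s.mem.ireg 2 = p.W
  i3 : s.mem.ireg 3 = p.D
  i5 : s.mem.ireg 5 = p.N * p.W
  i6 : s.mem.ireg 6 = p.N - 1
  i7 : s.mem.ireg 7 = p.S
  i8 : s.mem.ireg 8 = 2 * p.G
  i9 : s.mem.ireg 9 = 0
  i25 : s.mem.ireg 25 = p.G
  r5 : s.mem.rreg 5 = p.scale
  r9 : s.mem.rreg 9 = 0
  ia1 : s.mem.iarr 1 = p.filterPtr
  ia2 : s.mem.iarr 2 = p.rowPtr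
  ra1 : s.mem.rarr 1 = p.filter
  ra2 : s.mem.rarr 2 = p.row

/-- None of these cells is written by `main`. The registers numbered `9` serve as zeros: adding them
copies a register, and comparing with integer register `9` tests for zero. -/
theorem consts (hs : main.Agrees p.mem s) : Consts p s := by
  have hi : ∀ r, ¬main.Writes (.ireg r) → s.mem.ireg r = p.mem.ireg r := fun r h => hs (.ireg r) h
  have hr : ∀ r, ¬main.Writes (.rreg r) → s.mem.rreg r = p.mem.rreg r := fun r h => hs (.rreg r) h
  have hia : ∀ r, ¬main.Writes (.iarr r) → s.mem.iarr r = p.mem.iarr r := fun r h => hs (.iarr r) h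
  have hra : ∀ r, ¬main.Writes (.rarr r) → s.mem.rarr r = p.mem.rarr r := fun r h => hs (.rarr r) h
  constructor
  all_goals first
    | rw [hi _ (by simp [main, round, record, estimate, medianStep, compareStep, group, sampleStep,
        answer, answerStep, Writes])]
    | rw [hr _ (by simp [main, round, record, estimate, medianStep, compareStep, group, sampleStep,
        answer, answerStep, Writes])]
    | rw [hia _ (by simp [main, round, record, estimate, medianStep, compareStep, group,
        sampleStep, answer, answerStep, Writes])]
    | rw [hra _ (by simp [main, round, record, estimate, medianStep, compareStep, group,
        sampleStep, answer, answerStep, Writes])]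
  all_goals simp [Params.mem]

end Recover

namespace Recover

open Prog

variable {p : Params} {s : Config} {N : ℕ} {v : Fin N → ℝ} {A : QueryProc N}

/-! ## Filtered vectors -/

theorem _root_.Cell.get_tick (c : Cell) : c.get s.tick.mem = c.get s.mem := rfl

theorem answerStep_writes {c : Cell} (h : answerStep.Writes c) : main.Writes c := by
  simp only [main, round, answer, Writes]
  tauto

theorem answer_writes {c : Cell} (h : answer.Writes c) : main.Writes c := by
  simp only [main, round, Writes]
  tauto

theorem group_writes {c : Cell} (h : group.Writes c) : main.Writes c := by
  simp only [main, round, record, estimate, Writes]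
  tauto

theorem sampleStep_writes {c : Cell} (h : sampleStep.Writes c) : main.Writes c :=
  group_writes (by simp only [group, Writes]; tauto)

theorem medianStep_writes {c : Cell} (h : medianStep.Writes c) : main.Writes c := by
  simp only [main, round, record, estimate, Writes]
  tauto

theorem compareStep_writes {c : Cell} (h : compareStep.Writes c) : main.Writes c :=
  medianStep_writes (by simp only [medianStep, Writes]; tauto)

theorem estimate_writes {c : Cell} (h : estimate.Writes c) : main.Writes c := by
  simp only [main, round, record, Writes]
  tauto

theorem answerStep_spec (hs : Consts p s) :
    ∀ s' ∈ (answerStep.run v A s).support,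
      s'.mem.ireg 12 = s.mem.ireg 12 + 1 ∧ s'.mem.ireg 13 = s.mem.ireg 13 + 1 ∧
      s'.mem.rreg 1 = s.mem.rreg 1 +
        ext v (s.mem.ireg 13 - p.D) * p.filter (s.mem.ireg 12) := by
  simp [answerStep, run, PMF.pure_bind, Config.tick, Config.setI, Config.setR, Config.countQuery,
    hs.i1, hs.i3, hs.ra1, RealOp.apply, ext]

/-- The subtraction of `p.D` is truncated, so near the left end entry `0` may be queried repeatedly.
The stored filter coefficients are zero at those positions, see `params_filter`. -/
theorem answer_spec (hs : main.Agrees p.mem s) :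
    ∀ s' ∈ (answer.run v A s).support, main.Agrees p.mem s' ∧
      s'.mem.rreg 1 = ∑ u ∈ Finset.range p.W, ext v (s.mem.ireg 10 + u - p.D) *
        p.filter (p.filterPtr (s.mem.ireg 10) + s.mem.ireg 11 + u) := by
  intro s' hs'
  refine ⟨hs.of_run (fun c => answer_writes) hs', ?_⟩
  have hc := consts hs
  simp only [answer, run, PMF.pure_bind] at hs'
  have key := iterate_support (fun t s' => main.Agrees p.mem s' ∧
      s'.mem.ireg 12 = p.filterPtr (s.mem.ireg 10) + s.mem.ireg 11 + t ∧
      s'.mem.ireg 13 = s.mem.ireg 10 + t ∧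
      s'.mem.rreg 1 = ∑ u ∈ Finset.range t, ext v (s.mem.ireg 10 + u - p.D) *
        p.filter (p.filterPtr (s.mem.ireg 10) + s.mem.ireg 11 + u))
    (fun t _ a ha s' hs' => by
      obtain ⟨h1, h2, h3, h4⟩ := ha
      obtain ⟨g1, g2, g3⟩ := answerStep_spec (s := a.tick) (consts h1) s' hs'
      refine ⟨Agrees.of_run (s := a.tick) h1 (fun c => answerStep_writes) hs', ?_, ?_, ?_⟩
      · rw [g1]; simp [Config.tick, h2]; ring
      · rw [g2]; simp [Config.tick, h3]; ring
      · rw [g3, Finset.sum_range_succ]; simp [Config.tick, h2, h3, h4])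
    ⟨?_, ?_, ?_, ?_⟩ s' hs'
  · have h := key.2.2.2
    simpa [Config.tick, Config.setI, Config.setR, hc.i2] using h
  · intro c hw
    have h := mt answer_writes hw
    simp only [answer, Writes, not_or] at h
    rw [Cell.get_tick, Cell.get_setI h.2.2.2.1, Cell.get_tick, Cell.get_setR h.2.2.1, Cell.get_tick,
      Cell.get_setI h.2.1, Cell.get_tick, Cell.get_setI h.1, Cell.get_tick]
    exact hs c hw
  · simp [Config.tick, Config.setI, Config.setR, hc.ia1]
  · simp [Config.tick, Config.setI, Config.setR, hc.i9]
  · simp [Config.tick, Config.setI, Config.setR]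

/-- The vector that the black box sees if the pointer to the filter matrix is `P`. -/
theorem call_spec {P : ℕ} {y : Fin N → ℝ} {F : Matrix (Fin N) (Fin N) ℝ} {ε δ μ : ℝ} {Q T : ℕ}
    (hy : ∀ j : Fin N, ∑ u ∈ Finset.range p.W, ext v (j + u - p.D) *
      p.filter (p.filterPtr j + P + u) = y j)
    (hA : A.IsOneSparseRecovery F ε δ μ Q T) {a : ℝ} {h : Fin N} {w : Fin N → ℝ}
    (hF : F.mulVec y = spike N h a + w) (hw : l2 w ≤ ε * |a|) (ha : a ≠ 0) (hδ : δ < 1) (hμ0 : 0 ≤ μ) (hμ1 : μ ≤ 1)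
    (hs : main.Agrees p.mem s) (hP : s.mem.ireg 11 = P) :
    ((Prog.call answer 10 1 15 0).run v (A.clock Q T) s).Holds (fun s' => s'.mem.ireg 15 = h)
      (ENNReal.ofReal μ) := by
  classical
  obtain ⟨hq, hgood⟩ := hA y a h w hF hw
  rw [PMF.holds_iff_expect]
  have h1 := QueryProc.expect_simulate (y := y)
    (answer := fun j s' => (answer.run v (A.clock Q T) (s'.setI 10 j)).map
      fun s'' => (s''.mem.rreg 1, s''))
    (Inv := fun s => main.Agrees p.mem s ∧ s.mem.ireg 11 = P) (fun s h => h)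
    (fun j s hs r hr => by
      simp only [PMF.mem_support_map_iff] at hr
      obtain ⟨b, hb, rfl⟩ := hr
      have hq : main.Agrees p.mem (s.setI 10 j) := fun c hc => by
        rw [Cell.get_setI, hs.1 c hc]
        rintro rfl
        exact hc (by simp [main, round, Writes])
      obtain ⟨g1, g2⟩ := answer_spec hq b hb
      refine ⟨?_, g1, ?_⟩
      · rw [← hy j, g2]
        simp [Config.setI, hs.2]
      · have := frame (c := .ireg 11) (by simp [answer, answerStep, Writes]) b hb
        refine this.trans ?_
        exact hs.2)
    (fun i => if i = (h : ℕ) then 0 else 1) (A.clock Q T) s.tick ⟨hs, hP⟩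
  have h2 : (((Prog.call answer 10 1 15 0).run v (A.clock Q T) s).expect
      fun s' => if s'.mem.ireg 15 = h then 0 else 1) =
      (((A.clock Q T).eval y).expect fun o => if o.idx = (h : ℕ) then 0 else 1) := by
    rw [← h1, run, PMF.expect_map]
    simp [Config.setR, Config.setI]
  have h4 : (A.eval y).Holds (fun o => o.idx = (h : ℕ) ∧ o.queries ≤ Q ∧ o.time ≤ T)
      (ENNReal.ofReal μ) := by
    refine ((PMF.holds_ofReal_iff hμ0 hμ1).2 hgood).mono (fun o ho hg => ?_) le_rfl
    obtain ⟨⟨v', hv', he⟩, ht⟩ := hg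
    refine ⟨?_, hq o ho, ht⟩
    -- Relative error `δ < 1` forbids the value zero, and two non-zero spikes agree only if their
    -- indices do.
    have hv0 : v' ≠ 0 := by
      rintro rfl
      rw [sub_zero] at hv'
      nlinarith [abs_pos.2 ha]
    by_contra hne
    have := congrFun he h
    simp [spike, Ne.symm hne, hv0.symm] at this
  have h3 := PMF.holds_iff_expect.1 (QueryProc.holds_clock (P := fun i => i = (h : ℕ)) h4)
  refine le_trans (le_of_eq ?_) h3
  convert h2

end Recover

namespace Recover

open Prog

variable {p : Params} {s : Config} {N : ℕ} {v : Fin N → ℝ} {A : QueryProc N}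

/-! ## Sampling -/

theorem sampleStep_expect (hs : Consts p s) (hN : 0 < p.N) (Ψ : ℝ → ℝ≥0∞) :
    ((sampleStep.run v A s).expect fun s' => Ψ (s'.mem.rreg 4)) =
      (p.N : ℝ≥0∞)⁻¹ * ∑ j ∈ Finset.range p.N,
        Ψ (s.mem.rreg 4 + ext v j * p.row (s.mem.ireg 17 + j)) := by
  -- A free variable `b` in place of the register content allows rewriting with `b + 1 = p.N` under
  -- the type `Fin (b + 1)`.
  have h : ∀ b : ℕ, b + 1 = p.N → ((PMF.uniformOfFintype (Fin (b + 1))).expect fun c =>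
      Ψ (s.mem.rreg 4 + ext v c * p.row (s.mem.ireg 17 + c))) =
      (p.N : ℝ≥0∞)⁻¹ * ∑ j ∈ Finset.range p.N,
        Ψ (s.mem.rreg 4 + ext v j * p.row (s.mem.ireg 17 + j)) := by
    intro b hb
    rw [PMF.expect_uniform, hb, ← Fin.sum_univ_eq_sum_range
      (fun j => Ψ (s.mem.rreg 4 + ext v j * p.row (s.mem.ireg 17 + j))), ← hb]
  rw [← h _ (show s.mem.ireg 6 + 1 = p.N by rw [hs.i6]; omega)]
  simp only [sampleStep, run, PMF.expect_bind, PMF.expect_map, PMF.expect_pure,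
    PMF.expect_monad_bind, PMF.expect_monad_pure]
  simp [Config.tick, Config.setI, Config.setR, Config.countQuery, hs.ra2, RealOp.apply, ext]

/-- This is the bound of the variance of one uniform sample by its second moment. -/
theorem sum_sq_shift (n : ℕ) (hn : 0 < n) (Y : ℕ → ℝ) (b c : ℝ) :
    (n : ℝ)⁻¹ * ∑ j ∈ Finset.range n, ((b + Y j) ^ 2 + c) ≤
      (b + (n : ℝ)⁻¹ * ∑ j ∈ Finset.range n, Y j) ^ 2 +
        ((n : ℝ)⁻¹ * ∑ j ∈ Finset.range n, Y j ^ 2) + c := by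
  have hn' : (n : ℝ) ≠ 0 := by positivity
  have h : ∑ j ∈ Finset.range n, ((b + Y j) ^ 2 + c) =
      n * b ^ 2 + 2 * b * ∑ j ∈ Finset.range n, Y j + ∑ j ∈ Finset.range n, Y j ^ 2 + n * c := by
    simp only [add_sq, Finset.sum_add_distrib, ← Finset.mul_sum, Finset.sum_const,
      Finset.card_range, nsmul_eq_mul]
  rw [h]
  have e : (n : ℝ)⁻¹ * (n * b ^ 2 + 2 * b * ∑ j ∈ Finset.range n, Y j +
      ∑ j ∈ Finset.range n, Y j ^ 2 + n * c) =
      b ^ 2 + 2 * b * ((n : ℝ)⁻¹ * ∑ j ∈ Finset.range n, Y j) +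
        (n : ℝ)⁻¹ * ∑ j ∈ Finset.range n, Y j ^ 2 + c := by
    field_simp
  rw [e]
  nlinarith [sq_nonneg ((n : ℝ)⁻¹ * ∑ j ∈ Finset.range n, Y j)]

/-- One conditions on the first sample: the bound for the remaining ones is a shifted square plus a
constant, and averaging it with `sum_sq_shift` adds one mean inside the square and one second moment
outside. Independence of the samples is not needed as a separate notion. -/
theorem samples_expect (hN : 0 < p.N) {base : ℕ} {Y : ℕ → ℝ}
    (hY : ∀ j, Y j = ext v j * p.row (base + j)) (b : ℝ) (n : ℕ) (hs : main.Agrees p.mem s)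
    (hbase : s.mem.ireg 17 = base) :
    ((iterate (sampleStep.run v A) n s).expect fun s' => ENNReal.ofReal ((s'.mem.rreg 4 - b) ^ 2)) ≤
      ENNReal.ofReal ((s.mem.rreg 4 + n * ((p.N : ℝ)⁻¹ * ∑ j ∈ Finset.range p.N, Y j) - b) ^ 2 +
        n * ((p.N : ℝ)⁻¹ * ∑ j ∈ Finset.range p.N, Y j ^ 2)) := by
  set μ := (p.N : ℝ)⁻¹ * ∑ j ∈ Finset.range p.N, Y j with hμ
  set V := (p.N : ℝ)⁻¹ * ∑ j ∈ Finset.range p.N, Y j ^ 2 with hV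
  have hV0 : 0 ≤ V := by positivity
  induction n generalizing s with
  | zero => simp [iterate, PMF.expect_pure]
  | succ n ih =>
    rw [iterate, PMF.expect_bind]
    have hs' : main.Agrees p.mem s.tick := hs
    calc _ ≤ ((sampleStep.run v A s.tick).expect fun s' =>
          ENNReal.ofReal ((s'.mem.rreg 4 + n * μ - b) ^ 2 + n * V)) := by
          refine PMF.expect_mono fun a ha => ih (hs'.of_run (fun c => sampleStep_writes) ha) ?_
          exact (frame (c := .ireg 17) (by simp [sampleStep, Writes]) a ha).trans hbase
      _ = ENNReal.ofReal ((p.N : ℝ)⁻¹ * ∑ j ∈ Finset.range p.N,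
            (((s.mem.rreg 4 + n * μ - b) + Y j) ^ 2 + n * V)) := by
          rw [sampleStep_expect (consts hs') hN
              (fun r => ENNReal.ofReal ((r + n * μ - b) ^ 2 + n * V)),
            ENNReal.ofReal_mul (by positivity), ENNReal.ofReal_inv_of_pos (by exact_mod_cast hN),
            ENNReal.ofReal_natCast, ENNReal.ofReal_sum_of_nonneg (fun j _ => by positivity)]
          congr 1
          refine Finset.sum_congr rfl fun j _ => ?_
          rw [hY, show s.tick.mem.ireg 17 = base from hbase]
          congr 2
          simp only [Config.tick]
          ring
      _ ≤ _ := by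
          refine ENNReal.ofReal_le_ofReal ((sum_sq_shift p.N hN Y _ _).trans_eq ?_)
          rw [← hμ, ← hV]
          push_cast
          ring

/-- One group of samples gives a good estimate with probability at least `8 / 9`. -/
theorem group_spec (hN : 0 < p.N) (hS : 0 < p.S) (hsc : p.scale = p.N / p.S) {base : ℕ} {ρ : ℝ}
    (hρ : 0 < ρ)
    (hvar : 9 * (p.N * ∑ j ∈ Finset.range p.N, (ext v j * p.row (base + j)) ^ 2) ≤ p.S * ρ ^ 2)
    (hs : main.Agrees p.mem s) (hbase : s.mem.ireg 17 = base) :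
    (∀ s' ∈ (group.run v A s).support, main.Agrees p.mem s' ∧ s'.mem.ireg 17 = base ∧
      s'.mem.ireg 20 = s.mem.ireg 20 + 1 ∧
      ∃ z, s'.mem.rarr 3 = Function.update (s.mem.rarr 3) (s.mem.ireg 20) z) ∧
    (group.run v A s).Holds (fun s' => |s'.mem.rarr 3 (s.mem.ireg 20) -
      ∑ j ∈ Finset.range p.N, ext v j * p.row (base + j)| ≤ ρ) 9⁻¹ := by
  have hc := consts hs
  have hNR : (0 : ℝ) < p.N := by exact_mod_cast hN
  have hSR : (0 : ℝ) < p.S := by exact_mod_cast hS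
  have hs0 : main.Agrees p.mem (s.tick.setR 4 0).tick := fun c hw => by
    have h : c ≠ .rreg 4 := fun h => hw (group_writes (h ▸ by simp [group, Writes]))
    rw [Cell.get_tick, Cell.get_setR h, Cell.get_tick, hs c hw]
  have hrun : group.run v A s = (iterate (sampleStep.run v A) p.S (s.tick.setR 4 0).tick).bind
      fun a => PMF.pure ((((a.tick.setR 4 (a.mem.rreg 4 * a.mem.rreg 5)).tick.storeR 3
        (a.mem.ireg 20) (a.mem.rreg 4 * a.mem.rreg 5))).tick.setI 20
          (a.mem.ireg 20 + a.mem.ireg 1)) := by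
    simp [group, run, RealOp.apply, Config.tick, Config.setI, Config.setR, Config.storeR, hc.i7]
  have hmid : ∀ a ∈ (iterate (sampleStep.run v A) p.S (s.tick.setR 4 0).tick).support,
      main.Agrees p.mem a ∧ a.mem.ireg 20 = s.mem.ireg 20 ∧ a.mem.rarr 3 = s.mem.rarr 3 :=
    iterate_support (fun _ a => main.Agrees p.mem a ∧ a.mem.ireg 20 = s.mem.ireg 20 ∧
      a.mem.rarr 3 = s.mem.rarr 3) (fun t _ a ha b hb =>
        ⟨Agrees.of_run (s := a.tick) ha.1 (fun c => sampleStep_writes) hb,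
          (frame (c := .ireg 20) (by simp [sampleStep, Writes]) b hb).trans ha.2.1,
          (frame (c := .rarr 3) (by simp [sampleStep, Writes]) b hb).trans ha.2.2⟩)
      ⟨hs0, rfl, rfl⟩
  constructor
  · intro s' hs'
    refine ⟨hs.of_run (fun c => group_writes) hs',
      (frame (c := .ireg 17) (by simp [group, sampleStep, Writes]) s' hs').trans hbase, ?_⟩
    rw [hrun] at hs'
    simp only [PMF.mem_support_bind_iff, PMF.mem_support_pure_iff] at hs'
    obtain ⟨a, ha, rfl⟩ := hs'
    obtain ⟨h1, h2, h3⟩ := hmid a ha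
    refine ⟨?_, a.mem.rreg 4 * a.mem.rreg 5, ?_⟩
    · simp [Config.tick, Config.setI, Config.setR, Config.storeR, h2, (consts h1).i1]
    · simp [Config.tick, Config.setI, Config.setR, Config.storeR, h2, h3]
  · rw [hrun, ← zero_add (9⁻¹ : ℝ≥0∞), add_comm]
    set c := ∑ j ∈ Finset.range p.N, ext v j * p.row (base + j) with hcdef
    -- Before scaling by `N / S`, the accumulator has mean `S c / N`, and the tolerance `ρ` reads `ρ
    -- S / N`. Chebyshev's inequality gives failure probability `1 / 9` because of the factor `9` in
    -- `hvar`.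
    refine PMF.Holds.bind (P := fun a => |a.mem.rreg 4 - p.S * ((p.N : ℝ)⁻¹ * c)| ≤ ρ * p.S / p.N)
      ?_ fun a ha hP => PMF.holds_zero_iff.2 ?_
    · refine PMF.holds_of_expect_le (c := ENNReal.ofReal ((ρ * p.S / p.N) ^ 2))
        (ENNReal.ofReal_pos.2 (by positivity)).ne' ENNReal.ofReal_ne_top
        (Φ := fun a => ENNReal.ofReal ((a.mem.rreg 4 - p.S * ((p.N : ℝ)⁻¹ * c)) ^ 2)) ?_ ?_
      · intro a _ hP
        refine ENNReal.ofReal_le_ofReal ?_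
        rw [← sq_abs (a.mem.rreg 4 - _)]
        exact pow_le_pow_left₀ (by positivity) (not_le.1 hP).le 2
      · refine (samples_expect hN (fun _ => rfl) _ p.S hs0 hbase).trans ?_
        rw [show (9 : ℝ≥0∞)⁻¹ = ENNReal.ofReal (9⁻¹) by
          rw [ENNReal.ofReal_inv_of_pos (by norm_num)]; norm_num,
          ← ENNReal.ofReal_mul (by positivity)]
        refine ENNReal.ofReal_le_ofReal ?_
        rw [← hcdef]
        simp only [Config.tick, Config.setR, Function.update_self, zero_add, sub_self]
        rw [div_pow, mul_pow, div_mul_eq_mul_div, le_div_iff₀ (by positivity)]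
        have e : (0 ^ 2 + (p.S : ℝ) * ((p.N : ℝ)⁻¹ *
            ∑ j ∈ Finset.range p.N, (ext v j * p.row (base + j)) ^ 2)) * p.N ^ 2 =
            p.S * (p.N * ∑ j ∈ Finset.range p.N, (ext v j * p.row (base + j)) ^ 2) := by
          field_simp
          ring
        rw [e]
        nlinarith
    · obtain ⟨h1, h2, h3⟩ := hmid a ha
      simp only [PMF.mem_support_pure_iff, forall_eq]
      simp only [Config.tick, Config.setI, Config.setR, Config.storeR, h2, Function.update_self,
        (consts h1).r5, hsc]
      have e : a.mem.rreg 4 * (p.N / p.S) - c =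
          (a.mem.rreg 4 - p.S * ((p.N : ℝ)⁻¹ * c)) * (p.N / p.S) := by field_simp
      rw [e, abs_mul, abs_of_pos (a := (p.N : ℝ) / p.S) (by positivity)]
      calc _ ≤ ρ * p.S / p.N * (p.N / p.S) := by gcongr
        _ = ρ := by field_simp

end Recover

theorem Prog.Agrees.setI {P : Prog} {m : Mem} {s : Config} (hs : P.Agrees m s) {d : ℕ} (n : ℕ)
    (h : P.Writes (.ireg d)) : P.Agrees m (s.tick.setI d n) := fun c hc =>
  (Cell.get_setI (c := c) fun e => hc (by rw [e]; exact h)).trans (hs c hc)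

theorem Prog.Agrees.setR {P : Prog} {m : Mem} {s : Config} (hs : P.Agrees m s) {d : ℕ} (a : ℝ)
    (h : P.Writes (.rreg d)) : P.Agrees m (s.tick.setR d a) := fun c hc =>
  (Cell.get_setR (c := c) fun e => hc (by rw [e]; exact h)).trans (hs c hc)

theorem Prog.Agrees.storeI {P : Prog} {m : Mem} {s : Config} (hs : P.Agrees m s) {d : ℕ} (i n : ℕ)
    (h : P.Writes (.iarr d)) : P.Agrees m (s.tick.storeI d i n) := fun c hc =>
  (Cell.get_storeI (c := c) fun e => hc (by rw [e]; exact h)).trans (hs c hc)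

namespace Recover

open Prog

variable {p : Params} {s : Config} {N : ℕ} {v : Fin N → ℝ} {A : QueryProc N}

/-! ## Groups of samples -/

/-- The number of indices below `g` at which `r` is farther than `ρ` from `c`. -/
noncomputable def badCount (c ρ : ℝ) (r : ℕ → ℝ) (g : ℕ) : ℕ :=
  ((Finset.range g).filter fun i => ρ < |r i - c|).card

theorem badCount_update (c ρ : ℝ) (r : ℕ → ℝ) (g : ℕ) (z : ℝ) :
    badCount c ρ (Function.update r g z) (g + 1) =
      badCount c ρ r g + if ρ < |z - c| then 1 else 0 := by
  have h : (Finset.range g).filter (fun i => ρ < |Function.update r g z i - c|) =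
      (Finset.range g).filter fun i => ρ < |r i - c| :=
    Finset.filter_congr fun i hi => by
      rw [Function.update_of_ne (Finset.mem_range.1 hi).ne]
  rw [badCount, Finset.range_add_one, Finset.filter_insert, h, Function.update_self]
  split_ifs
  · rw [Finset.card_insert_of_notMem (by simp), badCount]
  · rfl

/-- The hypotheses on the row of the transform that starts at `base` under which `c` is estimated
up to `ρ`. -/
structure Samplable (p : Params) (v : Fin N → ℝ) (base : ℕ) (c ρ : ℝ) : Prop where
  hN : 0 < p.N
  hS : 0 < p.S
  scale : p.scale = p.N / p.S
  pos : 0 < ρ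
  mean : ∑ j ∈ Finset.range p.N, ext v j * p.row (base + j) = c
  var : 9 * (p.N * ∑ j ∈ Finset.range p.N, (ext v j * p.row (base + j)) ^ 2) ≤ p.S * ρ ^ 2

/-- A bad group multiplies `4 ^ badCount` by `4` and has probability at most `1 / 9`, so the
expected factor is at most `1 + 3 / 9`. This exponential moment replaces a Chernoff bound. -/
theorem group_expect {base : ℕ} {c ρ : ℝ} (h : Samplable p v base c ρ)
    (hs : main.Agrees p.mem s) (hbase : s.mem.ireg 17 = base) :
    ((group.run v A s).expect fun s' =>
      (4 : ℝ≥0∞) ^ badCount c ρ (s'.mem.rarr 3) (s'.mem.ireg 20)) ≤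
      ENNReal.ofReal (4 / 3) * 4 ^ badCount c ρ (s.mem.rarr 3) (s.mem.ireg 20) := by
  classical
  obtain ⟨h1, h2⟩ := group_spec (A := A) h.hN h.hS h.scale h.pos h.var hs hbase
  rw [h.mean, PMF.holds_iff_expect] at h2
  refine (PMF.expect_mono (Ψ := fun s' => 4 ^ badCount c ρ (s.mem.rarr 3) (s.mem.ireg 20) *
    (1 + 3 * if |s'.mem.rarr 3 (s.mem.ireg 20) - c| ≤ ρ then 0 else 1)) fun a ha => ?_).trans ?_
  · obtain ⟨-, -, h3, z, h4⟩ := h1 a ha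
    rw [h3, h4, badCount_update, Function.update_self, pow_add]
    gcongr
    by_cases hz : |z - c| ≤ ρ
    · simp [hz, not_lt.2 hz]
    · simp only [hz, not_le.1 hz, if_true, if_false]
      norm_num
  · rw [PMF.expect_const_mul, PMF.expect_add, PMF.expect_const, PMF.expect_const_mul, mul_comm]
    gcongr
    calc _ ≤ 1 + 3 * (9 : ℝ≥0∞)⁻¹ := by
          gcongr
      _ = _ := by
          rw [show (9 : ℝ≥0∞)⁻¹ = ENNReal.ofReal (9⁻¹) by
            rw [ENNReal.ofReal_inv_of_pos (by norm_num)]; norm_num,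
            show (3 : ℝ≥0∞) = ENNReal.ofReal 3 by norm_num, ← ENNReal.ofReal_mul (by norm_num),
            ← ENNReal.ofReal_one, ← ENNReal.ofReal_add (by norm_num) (by norm_num)]
          norm_num

theorem groups_expect {base : ℕ} {c ρ : ℝ} (h : Samplable p v base c ρ) (n : ℕ)
    (hs : main.Agrees p.mem s) (hbase : s.mem.ireg 17 = base) :
    ((iterate (group.run v A) n s).expect fun s' =>
      (4 : ℝ≥0∞) ^ badCount c ρ (s'.mem.rarr 3) (s'.mem.ireg 20)) ≤
      ENNReal.ofReal (4 / 3) ^ n * 4 ^ badCount c ρ (s.mem.rarr 3) (s.mem.ireg 20) := by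
  induction n generalizing s with
  | zero => simp [iterate, PMF.expect_pure]
  | succ n ih =>
    rw [iterate, PMF.expect_bind]
    have hs' : main.Agrees p.mem s.tick := hs
    have h1 := (group_spec (A := A) h.hN h.hS h.scale h.pos h.var hs' hbase).1
    refine (PMF.expect_mono fun a ha => ih (h1 a ha).1 (h1 a ha).2.1).trans ?_
    rw [PMF.expect_const_mul, pow_succ, mul_assoc]
    gcongr
    exact group_expect h hs' hbase

/-- Most groups are good with high probability. -/
theorem groups_holds {base : ℕ} {c ρ : ℝ} (h : Samplable p v base c ρ)
    (hs : main.Agrees p.mem s) (hbase : s.mem.ireg 17 = base) (h0 : s.mem.ireg 20 = 0) :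
    (iterate (group.run v A) (2 * p.G) s).Holds (fun s' => main.Agrees p.mem s' ∧
      badCount c ρ (s'.mem.rarr 3) (2 * p.G) < p.G) (ENNReal.ofReal ((4 / 9) ^ p.G)) := by
  have hdet := iterate_support (f := group.run v A) (n := 2 * p.G)
    (fun t a => main.Agrees p.mem a ∧ a.mem.ireg 17 = base ∧ a.mem.ireg 20 = t)
    (fun t _ a ha b hb => by
      obtain ⟨g1, g2, g3, -⟩ := (group_spec (A := A) (s := a.tick) h.hN h.hS h.scale h.pos h.var
        ha.1 ha.2.1).1 b hb
      exact ⟨g1, g2, g3.trans (congrArg (· + 1) ha.2.2)⟩) ⟨hs, hbase, h0⟩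
  refine PMF.holds_of_expect_le (c := 4 ^ p.G) (by simp) (by simp)
    (Φ := fun s' => 4 ^ badCount c ρ (s'.mem.rarr 3) (s'.mem.ireg 20)) (fun a ha hP => ?_) ?_
  · obtain ⟨g1, -, g3⟩ := hdet a ha
    have : p.G ≤ badCount c ρ (a.mem.rarr 3) (2 * p.G) := by
      by_contra hlt; exact hP ⟨g1, not_le.1 hlt⟩
    rw [g3]
    gcongr
    norm_num
  -- Markov's inequality at level `4 ^ G`: `(4/3) ^ (2G) = 4 ^ G · (4/9) ^ G`.
  · refine (groups_expect h _ hs hbase).trans_eq ?_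
    rw [h0, badCount, Finset.range_zero, Finset.filter_empty, Finset.card_empty, pow_zero, mul_one,
      show (4 : ℝ≥0∞) = ENNReal.ofReal 4 by norm_num, ← ENNReal.ofReal_pow (by norm_num),
      ← ENNReal.ofReal_pow (by norm_num), ← ENNReal.ofReal_mul (by positivity), pow_mul, ← mul_pow]
    norm_num

/-! ## The median -/

/-- `r i` is a median of `r 0, …, r (2 G - 1)`. -/
def IsMedian (r : ℕ → ℝ) (G i : ℕ) : Prop :=
  G ≤ ((Finset.range (2 * G)).filter fun j => r j ≤ r i).card ∧
  G ≤ ((Finset.range (2 * G)).filter fun j => r i ≤ r j).card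

/-- Among the indices with at least `G` values below or equal, take one of least value. If fewer
than `G` values were at least as large, more than `G` would be strictly smaller, and the largest of
these would qualify with a smaller value. -/
theorem exists_isMedian (r : ℕ → ℝ) {G : ℕ} (hG : 0 < G) : ∃ i < 2 * G, IsMedian r G i := by
  set R := Finset.range (2 * G) with hR
  have hRc : R.card = 2 * G := Finset.card_range _
  set T := R.filter fun i => G ≤ (R.filter fun j => r j ≤ r i).card with hT
  have hne : T.Nonempty := by
    obtain ⟨i, hi, hmax⟩ := R.exists_max_image r (Finset.card_pos.1 (by omega))
    refine ⟨i, Finset.mem_filter.2 ⟨hi, ?_⟩⟩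
    rw [Finset.filter_true_of_mem hmax]
    omega
  obtain ⟨i, hi, hmin⟩ := T.exists_min_image r hne
  obtain ⟨hiR, hi1⟩ := Finset.mem_filter.1 hi
  refine ⟨i, Finset.mem_range.1 hiR, hi1, ?_⟩
  by_contra hlt
  rw [← hR, not_le] at hlt
  have hsum := Finset.card_filter_add_card_filter_not (s := R) (fun j => r i ≤ r j)
  obtain ⟨j, hj, hmax⟩ := (R.filter fun j => ¬r i ≤ r j).exists_max_image r
    (Finset.card_pos.1 (by omega))
  obtain ⟨hjR, hj1⟩ := Finset.mem_filter.1 hj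
  have hjT : j ∈ T := by
    refine Finset.mem_filter.2 ⟨hjR, ?_⟩
    have hsub : (R.filter fun j => ¬r i ≤ r j) ⊆ R.filter fun l => r l ≤ r j := fun l hl =>
      Finset.mem_filter.2 ⟨(Finset.mem_filter.1 hl).1, hmax l hl⟩
    have := Finset.card_le_card hsub
    omega
  exact hj1 (hmin j hjT)

/-- If a median were too large, the `G` values that are at least as large would all be bad;
symmetrically if it were too small. -/
theorem IsMedian.abs_sub_le {r : ℕ → ℝ} {G i : ℕ} {c ρ : ℝ} (h : IsMedian r G i)
    (hbad : badCount c ρ r (2 * G) < G) : |r i - c| ≤ ρ := by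
  by_contra hlt
  push Not at hlt
  rcases lt_abs.1 hlt with h1 | h1
  · refine absurd h.2 (not_le.2 (lt_of_le_of_lt (Finset.card_le_card ?_) hbad))
    refine Finset.monotone_filter_right _ fun j _ hj => lt_abs.2 (Or.inl ?_)
    linarith
  · refine absurd h.1 (not_le.2 (lt_of_le_of_lt (Finset.card_le_card ?_) hbad))
    refine Finset.monotone_filter_right _ fun j _ hj => lt_abs.2 (Or.inr ?_)
    linarith

theorem compareStep_spec (hs : Consts p s) :
    ∀ s' ∈ (compareStep.run v A s).support,
      s'.mem.ireg 24 = s.mem.ireg 24 + 1 ∧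
      s'.mem.ireg 22 = s.mem.ireg 22 +
        (if s.mem.rarr 3 (s.mem.ireg 24) ≤ s.mem.rreg 7 then 1 else 0) ∧
      s'.mem.ireg 23 = s.mem.ireg 23 +
        (if s.mem.rreg 7 ≤ s.mem.rarr 3 (s.mem.ireg 24) then 1 else 0) := by
  intro s' hs'
  by_cases h1 : s.mem.rarr 3 (s.mem.ireg 24) ≤ s.mem.rreg 7 <;>
  by_cases h2 : s.mem.rreg 7 ≤ s.mem.rarr 3 (s.mem.ireg 24) <;>
  simp [compareStep, run, PMF.pure_bind, Config.tick, Config.setI, Config.setR, h1, h2,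
    hs.i1] at hs' <;>
  simp [hs', h1, h2]

theorem medianStep_spec (hs : main.Agrees p.mem s) :
    ∀ s' ∈ (medianStep.run v A s).support,
      main.Agrees p.mem s' ∧ s'.mem.rarr 3 = s.mem.rarr 3 ∧
      s'.mem.ireg 21 = s.mem.ireg 21 + 1 ∧
      (IsMedian (s.mem.rarr 3) p.G (s.mem.ireg 21) →
        s'.mem.rreg 6 = s.mem.rarr 3 (s.mem.ireg 21)) ∧
      (¬IsMedian (s.mem.rarr 3) p.G (s.mem.ireg 21) → s'.mem.rreg 6 = s.mem.rreg 6) := by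
  intro s' hs'
  have hc := consts hs
  refine ⟨hs.of_run (fun c => medianStep_writes) hs',
    frame (c := .rarr 3) (by simp [medianStep, compareStep, Writes]) s' hs', ?_⟩
  set r := s.mem.rarr 3 with hr
  set x := r (s.mem.ireg 21) with hx
  set s₁ := ((((s.tick.setR 7 x).tick.setI 22 0).tick.setI 23 0).tick.setI 24 0) with hs₁
  have hw : ∀ d, d ∈ [22, 23, 24] → main.Writes (.ireg d) := fun d hd => by
    simp at hd
    rcases hd with rfl | rfl | rfl <;> exact medianStep_writes (by simp [medianStep, Writes])
  have ha₁ : main.Agrees p.mem s₁.tick :=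
    (((hs.setR x (medianStep_writes (by simp [medianStep, Writes]))).setI 0 (hw _ (by simp))).setI 0
      (hw _ (by simp))).setI 0 (hw _ (by simp))
  have hn : s₁.mem.ireg 8 = 2 * p.G := (consts ha₁).i8
  have hrun : medianStep.run v A s = (iterate (compareStep.run v A) (2 * p.G) s₁.tick).bind
      ((Prog.seq (.ifI 25 22 (.ifI 25 23 (.opR .add 6 7 9) .skip) .skip) (.addI 21 21 1)).run
        v A) := by
    rw [← hn]
    simp only [medianStep, run, PMF.pure_bind]
    rfl
  rw [hrun, PMF.mem_support_bind_iff] at hs'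
  obtain ⟨a, ha, hs'⟩ := hs'
  obtain ⟨g1, g2, g3, g4, g5, g6, -, g7⟩ := iterate_support (fun t a => main.Agrees p.mem a ∧
      a.mem.rarr 3 = r ∧ a.mem.rreg 7 = x ∧ a.mem.rreg 6 = s.mem.rreg 6 ∧
      a.mem.ireg 21 = s.mem.ireg 21 ∧
      a.mem.ireg 22 = ((Finset.range t).filter fun j => r j ≤ x).card ∧
      a.mem.ireg 24 = t ∧
      a.mem.ireg 23 = ((Finset.range t).filter fun j => x ≤ r j).card)
    (fun t _ a ha b hb => by
      obtain ⟨g1, g2, g3, g4, g5, g6, g7, g8⟩ := ha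
      have f : ∀ c : Cell, ¬compareStep.Writes c → c.get b.mem = c.get a.mem := fun c h =>
        frame (s := a.tick) h b hb
      obtain ⟨k1, k2, k3⟩ := compareStep_spec (s := a.tick) (consts g1) b hb
      simp only [Config.tick, g2, g3, g6, g7, g8] at k1 k2 k3
      refine ⟨Agrees.of_run (s := a.tick) g1 (fun c => compareStep_writes) hb,
        (f (.rarr 3) (by simp [compareStep, Writes])).trans g2,
        (f (.rreg 7) (by simp [compareStep, Writes])).trans g3,
        (f (.rreg 6) (by simp [compareStep, Writes])).trans g4,
        (f (.ireg 21) (by simp [compareStep, Writes])).trans g5, ?_, k1, ?_⟩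
      · rw [k2, Finset.range_add_one, Finset.filter_insert]
        split_ifs
        · rw [Finset.card_insert_of_notMem (by simp)]
        · rfl
      · rw [k3, Finset.range_add_one, Finset.filter_insert]
        split_ifs
        · rw [Finset.card_insert_of_notMem (by simp)]
        · rfl)
    ⟨ha₁, rfl, rfl, rfl, rfl, rfl, rfl, rfl⟩ a ha
  have k := consts g1
  have hmed : IsMedian r p.G (s.mem.ireg 21) ↔ p.G ≤ a.mem.ireg 22 ∧ p.G ≤ a.mem.ireg 23 := by
    rw [g6, g7]; rfl
  rw [hmed]
  by_cases h1 : p.G ≤ a.mem.ireg 22 <;> by_cases h2 : p.G ≤ a.mem.ireg 23 <;>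
  simp [run, PMF.pure_bind, Config.tick, Config.setI, Config.setR, h1, h2, k.i25, k.i1, k.r9,
    RealOp.apply] at hs' <;>
  simp [hs', h1, h2, g5, g3, g4]

/-- Later medians overwrite earlier ones, which is harmless since all of them are within `ρ` of `c`.
Existence of a median ensures that the register is written at all. -/
theorem median_spec {c ρ : ℝ} (hs : main.Agrees p.mem s) (h0 : s.mem.ireg 21 = 0)
    (hG : 0 < p.G) (hbad : badCount c ρ (s.mem.rarr 3) (2 * p.G) < p.G) :
    ∀ s' ∈ (iterate (medianStep.run v A) (2 * p.G) s).support, |s'.mem.rreg 6 - c| ≤ ρ := by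
  intro s' hs'
  obtain ⟨-, -, -, h⟩ := iterate_support (fun t a => main.Agrees p.mem a ∧
      a.mem.rarr 3 = s.mem.rarr 3 ∧ a.mem.ireg 21 = t ∧
      ((∃ i < t, IsMedian (s.mem.rarr 3) p.G i) → |a.mem.rreg 6 - c| ≤ ρ))
    (fun t _ a ha b hb => by
      obtain ⟨g1, g2, g3, g4⟩ := ha
      obtain ⟨k1, k2, k3, k4, k5⟩ := medianStep_spec (s := a.tick) g1 b hb
      simp only [Config.tick, g2, g3] at k2 k3 k4 k5
      refine ⟨k1, k2, k3, ?_⟩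
      rintro ⟨i, hi, hm⟩
      by_cases ht : IsMedian (s.mem.rarr 3) p.G t
      · rw [k4 ht]
        exact ht.abs_sub_le hbad
      · rw [k5 ht]
        refine g4 ⟨i, ?_, hm⟩
        rcases Nat.lt_succ_iff_lt_or_eq.1 hi with h | rfl
        · exact h
        · exact absurd hm ht)
    ⟨hs, rfl, h0, by rintro ⟨i, hi, -⟩; omega⟩ s' hs'
  exact h (exists_isMedian _ hG)

theorem estimate_spec {c ρ : ℝ} (hG : 0 < p.G)
    (h : Samplable p v (p.rowPtr (s.mem.ireg 15)) c ρ) (hs : main.Agrees p.mem s) :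
    (estimate.run v A s).Holds (fun s' => |s'.mem.rreg 6 - c| ≤ ρ)
      (ENNReal.ofReal ((4 / 9) ^ p.G)) := by
  have hc := consts hs
  set s₁ := (s.tick.setI 17 (p.rowPtr (s.mem.ireg 15))).tick.setI 20 0 with hs₁
  have ha₁ : main.Agrees p.mem s₁.tick :=
    (hs.setI _ (estimate_writes (by simp [estimate, Writes]))).setI 0
      (estimate_writes (by simp [estimate, Writes]))
  have hrun : estimate.run v A s = (iterate (group.run v A) (2 * p.G) s₁.tick).bind
      ((Prog.seq (.constI 21 0) (.loop 8 medianStep)).run v A) := by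
    rw [← (consts ha₁).i8]
    simp only [estimate, run, PMF.pure_bind, hc.ia2]
    rfl
  rw [hrun, ← add_zero (ENNReal.ofReal _)]
  refine (groups_holds h ha₁ rfl rfl).bind fun a _ ha => PMF.holds_zero_iff.2 ?_
  have ha₂ : main.Agrees p.mem (a.tick.setI 21 0) :=
    ha.1.setI 0 (estimate_writes (by simp [estimate, Writes]))
  simp only [run, PMF.pure_bind, (consts ha₂).i8]
  exact median_spec (s := (a.tick.setI 21 0).tick) ha₂ rfl hG ha.2

end Recover

namespace Recover

open Prog

variable {p : Params} {s : Config} {N : ℕ} {v : Fin N → ℝ} {A : QueryProc N}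

/-! ## The main loop -/

theorem output_append {m m' : Mem} {h : ℕ} {z : ℝ} (h0 : m'.ireg 0 = m.ireg 0 + 1)
    (h1 : m'.iarr 0 = Function.update (m.iarr 0) (m.ireg 0) h)
    (h2 : m'.rarr 0 = Function.update (m.rarr 0) (m.ireg 0) z) :
    m'.output N = m.output N + spike N h z := by
  rw [Mem.output, Mem.output, h0, Finset.sum_range_succ, h1, h2, Function.update_self,
    Function.update_self]
  congr 1
  refine Finset.sum_congr rfl fun i hi => ?_
  have hi := (Finset.mem_range.1 hi).ne
  rw [Function.update_of_ne hi, Function.update_of_ne hi]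

theorem output_congr {m m' : Mem} (h0 : m'.ireg 0 = m.ireg 0) (h1 : m'.iarr 0 = m.iarr 0)
    (h2 : m'.rarr 0 = m.rarr 0) : m'.output N = m.output N := by
  rw [Mem.output, Mem.output, h0, h1, h2]

/-- Outside its promise the black box may even name an index that is not below `N`. Such an index
contributes the zero vector to the output, so its estimate need not be controlled. -/
theorem record_spec {vhat : ℕ → ℝ} {ρ : ℝ} (hG : 0 < p.G)
    (hv : ∀ h < N, Samplable p v (p.rowPtr h) (vhat h) ρ) (hs : main.Agrees p.mem s) :
    (record.run v A s).Holds (fun s' => main.Agrees p.mem s' ∧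
      s'.mem.ireg 11 = s.mem.ireg 11 ∧
      s'.mem.iarr 3 = Function.update (s.mem.iarr 3) (s.mem.ireg 15) 1 ∧
      ∃ z, s'.mem.output N = s.mem.output N + spike N (s.mem.ireg 15) z ∧
        (s.mem.ireg 15 < N → |z - vhat (s.mem.ireg 15)| ≤ ρ))
      (ENNReal.ofReal ((4 / 9) ^ p.G)) := by
  have hc := consts hs
  set s₁ := s.tick.storeI 3 (s.mem.ireg 15) 1 with hs₁
  have ha₁ : main.Agrees p.mem s₁ := hs.storeI _ _ (by simp [main, round, record, Writes])
  have hrun : record.run v A s = (estimate.run v A s₁).bind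
      ((Prog.seq (.saveI 0 0 15) (.seq (.saveR 0 0 6) (.addI 0 0 1))).run v A) := by
    simp only [record, run, PMF.pure_bind, hc.i1]
    rfl
  have hest : (estimate.run v A s₁).Holds
      (fun s' => s.mem.ireg 15 < N → |s'.mem.rreg 6 - vhat (s.mem.ireg 15)| ≤ ρ)
      (ENNReal.ofReal ((4 / 9) ^ p.G)) := by
    by_cases hlt : s.mem.ireg 15 < N
    · exact (estimate_spec (s := s₁) hG (hv _ hlt) ha₁).mono (fun _ _ h _ => h) le_rfl
    · exact (PMF.holds_zero_iff.2 fun _ _ h => absurd h hlt).mono (fun _ _ h => h) zero_le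
  rw [hrun, ← add_zero (ENNReal.ofReal _)]
  refine hest.bind fun a ha hP => PMF.holds_zero_iff.2 ?_
  have f : ∀ c : Cell, ¬estimate.Writes c → c.get a.mem = c.get s₁.mem := fun c h =>
    frame h a ha
  have haa := ha₁.of_run (fun c => estimate_writes) ha
  have hw : ∀ c : Cell, c ∈ [.ireg 0, .ireg 11, .ireg 15, .iarr 0, .iarr 3, .rarr 0] →
      ¬estimate.Writes c := by
    simp [estimate, medianStep, compareStep, group, sampleStep, Writes]
  have e0 : a.mem.ireg 0 = s.mem.ireg 0 := f (.ireg 0) (hw _ (by simp))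
  have e1 : a.mem.ireg 11 = s.mem.ireg 11 := f (.ireg 11) (hw _ (by simp))
  have e2 : a.mem.ireg 15 = s.mem.ireg 15 := f (.ireg 15) (hw _ (by simp))
  have e3 : a.mem.iarr 0 = s.mem.iarr 0 := f (.iarr 0) (hw _ (by simp))
  have e4 : a.mem.rarr 0 = s.mem.rarr 0 := f (.rarr 0) (hw _ (by simp))
  have e5 : a.mem.iarr 3 = Function.update (s.mem.iarr 3) (s.mem.ireg 15) 1 :=
    (f (.iarr 3) (hw _ (by simp))).trans (by
      change Function.update s.mem.iarr 3 _ 3 = _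
      rw [Function.update_self]; rfl)
  intro s' hs'
  refine ⟨haa.of_run (fun c h => ?_) hs', ?_⟩
  · simp only [main, round, record, Writes] at h ⊢
    tauto
  simp only [run, PMF.pure_bind, PMF.mem_support_pure_iff] at hs'
  subst hs'
  refine ⟨e1, ?_, a.mem.rreg 6, output_append ?_ ?_ ?_, hP⟩
  · simpa [Config.tick, Config.setI, Config.storeI, Config.storeR] using e5
  · simp [Config.tick, Config.setI, Config.storeI, Config.storeR, e0, (consts haa).i1]
  · simp [Config.tick, Config.setI, Config.storeI, Config.storeR, e0, e2, e3]
  · simp [Config.tick, Config.setI, Config.storeI, Config.storeR, e0, e4]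

/-- The memory holds the estimates, up to `ρ`, of the entries of `vhat` with indices in `H`. -/
structure Found (N : ℕ) (vhat : ℕ → ℝ) (ρ : ℝ) (m : Mem) (H : Finset ℕ) (e : ℕ → ℝ) : Prop where
  mark : ∀ h, m.iarr 3 h = if h ∈ H then 1 else 0
  output : m.output N = fun i : Fin N => if (i : ℕ) ∈ H then e i else 0
  err : ∀ i : Fin N, (i : ℕ) ∈ H → |e i - vhat i| ≤ ρ

/-- The invariant of the main loop: the entries with indices in `Big` have been found, if the
corresponding filter, with number `τ`, has been used. -/
def Inv (p : Params) (vhat : ℕ → ℝ) (ρ : ℝ) (Big : Finset (Fin N)) (τ : Fin N → ℕ) (t : ℕ)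
    (s : Config) : Prop :=
  main.Agrees p.mem s ∧ s.mem.ireg 11 = t * (p.N * p.W) ∧ ∃ H e, Found N vhat ρ s.mem H e ∧
    H.card ≤ t ∧ ∀ i ∈ Big, τ i < t → (i : ℕ) ∈ H

/-- Correctness of the black box matters only for those `i ∈ Big` whose filter is number `t`. For
any other answer it suffices that a new index gets a good estimate and a marked one is skipped,
since a second record would be added to the first. -/
theorem round_spec {vhat : ℕ → ℝ} {ρ : ℝ} {Big : Finset (Fin N)} {τ : Fin N → ℕ} {t : ℕ}
    {εA : ℝ≥0∞} (hG : 0 < p.G) (hv : ∀ h < N, Samplable p v (p.rowPtr h) (vhat h) ρ)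
    (hcall : ∀ i ∈ Big, τ i = t →
      ((Prog.call answer 10 1 15 0).run v A s).Holds (fun s' => s'.mem.ireg 15 = i) εA)
    (hs : Inv p vhat ρ Big τ t s) :
    (round.run v A s).Holds (Inv p vhat ρ Big τ (t + 1))
      ((∑ i ∈ Big, if τ i = t then εA else 0) + ENNReal.ofReal ((4 / 9) ^ p.G)) := by
  obtain ⟨hag, hptr, H, e, hF, hcard, hbig⟩ := hs
  have hcall' : ((Prog.call answer 10 1 15 0).run v A s).Holds
      (fun s' => ∀ i ∈ Big, τ i = t → s'.mem.ireg 15 = i)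
      (∑ i ∈ Big, if τ i = t then εA else 0) := by
    refine PMF.Holds.forall_finset fun i hi => ?_
    by_cases hit : τ i = t
    · simpa [hit] using hcall i hi hit
    · exact PMF.holds_zero_iff.2 (by simp [hit]) |>.mono (fun _ _ h => h) (by simp [hit])
  rw [round, run]
  refine hcall'.bind fun a ha hi => ?_
  have hcw : ∀ {c : Cell}, (Prog.call answer 10 1 15 0).Writes c → main.Writes c := fun {c} h => by
    simp only [main, round, Writes] at h ⊢
    tauto
  have f : ∀ c : Cell, ¬(Prog.call answer 10 1 15 0).Writes c → c.get a.mem = c.get s.mem :=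
    fun c h => frame h a ha
  have haa := hag.of_run (fun c => hcw) ha
  have hw : ∀ c : Cell, c ∈ [.ireg 0, .ireg 11, .iarr 0, .iarr 3, .rarr 0] →
      ¬(Prog.call answer 10 1 15 0).Writes c := by
    simp [answer, answerStep, Writes]
  have e1 : a.mem.ireg 11 = t * (p.N * p.W) := (f (.ireg 11) (hw _ (by simp))).trans hptr
  have e2 : a.mem.output N = s.mem.output N := output_congr (f (.ireg 0) (hw _ (by simp)))
    (f (.iarr 0) (hw _ (by simp))) (f (.rarr 0) (hw _ (by simp)))
  have e3 : a.mem.iarr 3 = s.mem.iarr 3 := f (.iarr 3) (hw _ (by simp))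
  set h := a.mem.ireg 15 with hh
  set b := (a.tick.setI 16 (a.mem.iarr 3 h)) with hb
  have hbag : main.Agrees p.mem b.tick := haa.setI _ (by simp [main, round, Writes])
  have k := consts hbag
  have hadd : ∀ {c : Cell}, (Prog.addI 11 11 5).Writes c → main.Writes c := fun {c} h => by
    simp only [main, round, Writes] at h ⊢
    tauto
  have hrun : ((Prog.loadI 16 3 15).seq ((Prog.ifI 16 9 record .skip).seq (.addI 11 11 5))).run v A a
      = if h ∈ H then (Prog.addI 11 11 5).run v A b.tick else
        (record.run v A b.tick).bind ((Prog.addI 11 11 5).run v A) := by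
    have hb16 : b.mem.ireg 16 = if h ∈ H then 1 else 0 := by
      rw [← hF.mark, ← e3, hb]; simp [Config.setI]
    have hb9 : b.mem.ireg 9 = 0 := k.i9
    simp only [run, PMF.pure_bind]
    rw [← hh, ← hb, hb16, hb9]
    by_cases hH : h ∈ H <;> simp [hH]
  rw [hrun]
  split_ifs with hH
  · refine (PMF.holds_zero_iff.2 fun s' hs' => ?_).mono (fun _ _ h => h) zero_le
    have hag' := hbag.of_run (fun c => hadd) hs'
    simp only [run, PMF.mem_support_pure_iff] at hs'
    subst hs'
    refine ⟨hag', ?_, H, e, ⟨fun l => ?_, ?_, hF.err⟩, by omega, fun i hiB hit => ?_⟩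
    · have h5 : b.tick.mem.ireg 11 = t * (p.N * p.W) := e1
      rw [k.i5, h5]
      simp [Config.setI]; ring
    · rw [← hF.mark, ← e3]; rfl
    · rw [← hF.output, ← e2]; exact output_congr rfl rfl rfl
    · rcases Nat.lt_succ_iff_lt_or_eq.1 hit with hlt | heq
      · exact hbig i hiB hlt
      · rw [← hi i hiB heq]; exact hH
  · rw [← add_zero (ENNReal.ofReal _)]
    refine (record_spec hG hv hbag).bind fun c _ hc => PMF.holds_zero_iff.2 fun s' hs' => ?_
    obtain ⟨c1, c2, c3, z, c4, c5⟩ := hc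
    have hag' := c1.of_run (fun c => hadd) hs'
    simp only [run, PMF.mem_support_pure_iff] at hs'
    subst hs'
    have hb15 : b.tick.mem.ireg 15 = h := rfl
    have hbo : b.tick.mem.output N = s.mem.output N := (output_congr rfl rfl rfl).trans e2
    have hb3 : b.tick.mem.iarr 3 = s.mem.iarr 3 := e3
    rw [hb15] at c3 c4 c5
    refine ⟨hag', ?_, insert h H, Function.update e h z, ⟨fun l => ?_, ?_, fun i hiH => ?_⟩,
      (Finset.card_insert_le h H).trans (by omega), fun i hiB hit => ?_⟩
    · have h5 : b.tick.mem.ireg 11 = t * (p.N * p.W) := e1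
      rw [c2, h5, (consts c1).i5]
      simp [Config.setI, Config.tick]; ring
    · change c.mem.iarr 3 l = _
      rw [c3, hb3, Function.update_apply, hF.mark]
      by_cases hl : l = h <;> simp [hl]
    · refine (output_congr (m := c.mem) rfl rfl rfl).trans ?_
      rw [c4, hbo, hF.output]
      funext i
      simp only [Pi.add_apply, spike, Finset.mem_insert, Function.update_apply]
      by_cases hl : (i : ℕ) = h <;> simp [hl, hH]
    · rw [Function.update_apply]
      split_ifs with hl
      · rw [hl]; exact c5 (hl ▸ i.2)
      · exact hF.err i (Finset.mem_of_mem_insert_of_ne hiH hl)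
    · rcases Nat.lt_succ_iff_lt_or_eq.1 hit with hlt | heq
      · exact Finset.mem_insert_of_mem (hbig i hiB hlt)
      · rw [← hi i hiB heq]; exact Finset.mem_insert_self _ _

/-- With high probability the output consists of estimates for at most `M` entries of `vhat`, among
them those in `Big`. -/
theorem main_spec {vhat : ℕ → ℝ} {ρ : ℝ} {Big : Finset (Fin N)} {τ : Fin N → ℕ} {εA : ℝ≥0∞}
    (hG : 0 < p.G) (hv : ∀ h < N, Samplable p v (p.rowPtr h) (vhat h) ρ)
    (hτ : ∀ i ∈ Big, τ i < p.M)
    (hcall : ∀ i ∈ Big, ∀ s, main.Agrees p.mem s → s.mem.ireg 11 = τ i * (p.N * p.W) →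
      ((Prog.call answer 10 1 15 0).run v A s).Holds (fun s' => s'.mem.ireg 15 = i) εA) :
    (main.run v A ⟨p.mem, 0, 0⟩).Holds
      (fun s => ∃ (H : Finset ℕ) (e : ℕ → ℝ),
        s.mem.output N = (fun i : Fin N => if (i : ℕ) ∈ H then e i else 0) ∧
        (∀ i : Fin N, (i : ℕ) ∈ H → |e i - vhat i| ≤ ρ) ∧ H.card ≤ p.M ∧
        ∀ i ∈ Big, (i : ℕ) ∈ H)
      (Big.card * εA + p.M * ENNReal.ofReal ((4 / 9) ^ p.G)) := by
  have h0 : Inv p vhat ρ Big τ 0 (Config.tick ⟨p.mem, 0, 0⟩) := by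
    refine ⟨fun _ _ => rfl, by simp [Config.tick, Params.mem], ∅, 0, ⟨?_, ?_, by simp⟩, by simp,
      by simp⟩
    · simp [Config.tick, Params.mem]
    · simp [Mem.output, Config.tick, Params.mem]
      rfl
  have key := holds_iterate (f := round.run v A) (Inv p vhat ρ Big τ)
    (fun t => (∑ i ∈ Big, if τ i = t then εA else 0) + ENNReal.ofReal ((4 / 9) ^ p.G)) p.M
    (fun t _ s hs => round_spec (s := s.tick) hG hv
      (fun i hi hit => hcall i hi s.tick hs.1 (hit ▸ hs.2.1)) hs) _ h0
  refine PMF.Holds.mono key (fun s _ hs => ?_) (le_of_eq ?_)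
  · obtain ⟨-, -, H, e, hF, hcard, hbig⟩ := hs
    exact ⟨H, e, hF.output, hF.err, hcard, fun i hi => hbig i hi (hτ i hi)⟩
  -- After exchanging the sums, each `i ∈ Big` is charged `εA` once, in round `τ i`.
  · rw [Finset.sum_add_distrib, Finset.sum_comm, Finset.sum_const, Finset.card_range, nsmul_eq_mul]
    congr 1
    rw [Finset.sum_congr rfl (g := fun _ => εA), Finset.sum_const, nsmul_eq_mul]
    intro i hi
    simp [hτ i hi]

end Recover

namespace Recover

variable {N : ℕ}

/-! ## The preprocessed arrays -/

/-- A matrix, extended by zero. -/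
noncomputable def ext₂ (M : Matrix (Fin N) (Fin N) ℝ) (i j : ℕ) : ℝ :=
  if h : i < N ∧ j < N then M ⟨i, h.1⟩ ⟨j, h.2⟩ else 0

theorem ext_fin (v : Fin N → ℝ) (i : Fin N) : ext v i = v i := by simp [ext]

theorem ext₂_fin (M : Matrix (Fin N) (Fin N) ℝ) (i j : Fin N) : ext₂ M i j = M i j := by
  simp [ext₂]

/-- The parameters for the transform of length `N` of a polynomial family, with filters of degree
`2 m`, groups of `S` samples and `2 G` groups. -/
noncomputable def params (p : ℕ → ℝ[X]) (N m S G : ℕ) : Params where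
  N := N
  W := 4 * m + 1
  D := 2 * m
  M := 2 * m + 1
  S := S
  G := G
  scale := N / S
  filterPtr j := if j < N then j * (4 * m + 1) else 0
  rowPtr h := if h < N then h * N else 0
  filter n := if n < (2 * m + 1) * (N * (4 * m + 1)) then
      if 2 * m ≤ n % (N * (4 * m + 1)) / (4 * m + 1) + n % (N * (4 * m + 1)) % (4 * m + 1) then
        ext₂ (filterMatrix p N (bump m (centre m (n / (N * (4 * m + 1))))))
          (n % (N * (4 * m + 1)) / (4 * m + 1))
          (n % (N * (4 * m + 1)) / (4 * m + 1) + n % (N * (4 * m + 1)) % (4 * m + 1) - 2 * m)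
      else 0
    else 0
  row n := if n < N * N then ext₂ (opTransform p N) (n / N) (n % N) else 0

theorem params_row (p : ℕ → ℝ[X]) (m S G : ℕ) (h j : Fin N) :
    (params p N m S G).row ((params p N m S G).rowPtr h + j) = opTransform p N h j := by
  have hN := h.pos
  have h1 : (h : ℕ) * N + j < N * N := by
    have : ((h : ℕ) + 1) * N ≤ N * N := Nat.mul_le_mul_right _ h.2
    have := j.2
    rw [add_mul] at *
    omega
  simp only [params, h.2, if_true, h1]
  rw [mul_comm, Nat.mul_add_div hN, Nat.div_eq_of_lt j.2, Nat.mul_add_mod, Nat.mod_eq_of_lt j.2,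
    add_zero, ext₂_fin]

/-- With `W = 4 m + 1`, position `t N W + j W + u` is decoded by division with remainder into filter
`t`, row `j` and place `u` in the band, that is, column `j + u - 2 m`. -/
theorem params_filter (p : ℕ → ℝ[X]) (m S G : ℕ) {t u : ℕ} (j : Fin N) (ht : t < 2 * m + 1)
    (hu : u < 4 * m + 1) :
    (params p N m S G).filter ((params p N m S G).filterPtr j + t * (N * (4 * m + 1)) + u) =
      if 2 * m ≤ j + u then ext₂ (filterMatrix p N (bump m (centre m t))) j (j + u - 2 * m)
      else 0 := by
  have hN := j.pos
  simp only [params, j.2, if_true]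
  set W := 4 * m + 1 with hW
  have hW0 : 0 < W := by omega
  have h0 : (j : ℕ) * W + u < N * W := by
    have : ((j : ℕ) + 1) * W ≤ N * W := Nat.mul_le_mul_right _ j.2
    rw [add_mul] at this
    omega
  have hNW : 0 < N * W := by positivity
  have e : (j : ℕ) * W + t * (N * W) + u = N * W * t + (j * W + u) := by ring
  have h1 : (j : ℕ) * W + t * (N * W) + u < (2 * m + 1) * (N * W) := by
    have : (t + 1) * (N * W) ≤ (2 * m + 1) * (N * W) := Nat.mul_le_mul_right _ ht
    rw [add_mul, one_mul] at this
    omega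
  rw [if_pos h1, e, Nat.mul_add_div hNW, Nat.div_eq_of_lt h0, Nat.mul_add_mod, Nat.mod_eq_of_lt h0,
    add_zero, mul_comm (j : ℕ) W, Nat.mul_add_div hW0, Nat.div_eq_of_lt hu, Nat.mul_add_mod,
    Nat.mod_eq_of_lt hu, add_zero]

/-- The substitution `i = j + u - D` matches the band with the full sum; terms outside the band or
beyond `N` vanish, and the test `D ≤ j + u` removes those where the subtraction is truncated. -/
theorem sum_band (g : ℕ → ℝ) (N D j : ℕ) (hj : j < N) (h0 : ∀ i, N ≤ i → g i = 0)
    (h1 : ∀ i, D + i < j ∨ D + j < i → g i = 0) :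
    ∑ u ∈ Finset.range (2 * D + 1), (if D ≤ j + u then g (j + u - D) else 0) =
      ∑ i ∈ Finset.range N, g i := by
  have e1 : ∑ i ∈ Finset.range N, g i =
      ∑ i ∈ (Finset.range N).filter (fun i => j ≤ i + D ∧ i ≤ j + D), g i := by
    refine (Finset.sum_filter_of_ne fun i _ hi => ?_).symm
    by_contra hcon
    exact hi (h1 i (by omega))
  have e2 : ∑ u ∈ Finset.range (2 * D + 1), (if D ≤ j + u then g (j + u - D) else 0) =
      ∑ u ∈ (Finset.range (2 * D + 1)).filter (fun u => D ≤ j + u ∧ j + u - D < N),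
        g (j + u - D) := by
    rw [Finset.sum_filter]
    refine Finset.sum_congr rfl fun u _ => ?_
    by_cases h : D ≤ j + u <;> by_cases h' : j + u - D < N <;> simp [h, h']
    exact h0 _ (not_lt.1 h')
  rw [e1, e2]
  refine Finset.sum_nbij' (fun u => j + u - D) (fun i => i + D - j) ?_ ?_ ?_ ?_ fun _ _ => rfl
  all_goals
    intro i hi
    simp only [Finset.mem_filter, Finset.mem_range] at hi ⊢
    omega

variable {p : ℕ → ℝ[X]} {ν : Measure ℝ}

theorem params_answer (hp : IsOrthonormalFamily p ν) (m S G : ℕ) {t : ℕ} (ht : t < 2 * m + 1)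
    (v : Fin N → ℝ) (j : Fin N) :
    ∑ u ∈ Finset.range (params p N m S G).W, ext v (j + u - (params p N m S G).D) *
      (params p N m S G).filter ((params p N m S G).filterPtr j + t * (N * (4 * m + 1)) + u) =
      (filterMatrix p N (bump m (centre m t))).mulVec v j := by
  set B := filterMatrix p N (bump m (centre m t)) with hB
  have e : ∀ u ∈ Finset.range (params p N m S G).W, ext v (j + u - (params p N m S G).D) *
      (params p N m S G).filter ((params p N m S G).filterPtr j + t * (N * (4 * m + 1)) + u) =
      if 2 * m ≤ j + u then (fun i => ext₂ B j i * ext v i) (j + u - 2 * m) else 0 := by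
    intro u hu
    rw [params_filter p m S G j ht (Finset.mem_range.1 hu)]
    split_ifs with h
    · rw [mul_comm]; rfl
    · rw [mul_zero]
  rw [Finset.sum_congr rfl e]
  have hW : (params p N m S G).W = 2 * (2 * m) + 1 := by simp only [params]; ring
  rw [hW, sum_band (fun i => ext₂ B j i * ext v i) N (2 * m) j j.2]
  · rw [← Fin.sum_univ_eq_sum_range (fun i => ext₂ B j i * ext v i)]
    simp only [ext₂_fin, ext_fin]
    rfl
  · intro i hi
    simp [ext, not_lt.2 hi]
  · intro i hi
    by_cases hiN : i < N
    · have := hp.filterMatrix_banded N _ (natDegree_bump_le m (centre m t)) (a := j)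
        (b := ⟨i, hiN⟩) hi
      simp only [ext₂, hiN, j.2, and_self, dif_pos, Fin.eta]
      rw [hB, this, zero_mul]
    · simp [ext, hiN]

theorem params_samplable {m S G : ℕ} (hS : 0 < S) {ρ U : ℝ} (hρ : 0 < ρ)
    (hU : ∀ i j, |opTransform p N i j| ≤ U) {v : Fin N → ℝ}
    (hvar : 9 * (N * (U ^ 2 * l2 v ^ 2)) ≤ S * ρ ^ 2) (h : ℕ) (hh : h < N) :
    Samplable (params p N m S G) v ((params p N m S G).rowPtr h)
      (ext ((opTransform p N).mulVec v) h) ρ := by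
  have e : ∀ j : Fin N, ext v j * (params p N m S G).row ((params p N m S G).rowPtr h + j) =
      v j * opTransform p N ⟨h, hh⟩ j := fun j => by
    rw [ext_fin, ← params_row p m S G ⟨h, hh⟩ j]
  refine ⟨by simp only [params]; omega, hS, rfl, hρ, ?_, ?_⟩
  · change ∑ j ∈ Finset.range N, _ = _
    rw [← Fin.sum_univ_eq_sum_range
      (fun j => ext v j * (params p N m S G).row ((params p N m S G).rowPtr h + j)),
      Finset.sum_congr rfl fun j _ => e j]
    simp only [ext, hh, dif_pos, Matrix.mulVec, dotProduct, mul_comm]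
  · change 9 * ((N : ℝ) * ∑ j ∈ Finset.range N, _) ≤ _
    rw [← Fin.sum_univ_eq_sum_range
      (fun j => (ext v j * (params p N m S G).row ((params p N m S G).rowPtr h + j)) ^ 2),
      Finset.sum_congr rfl fun j _ => by rw [e j]]
    refine le_trans ?_ hvar
    gcongr
    rw [l2_sq, Finset.mul_sum]
    refine Finset.sum_le_sum fun j _ => ?_
    rw [mul_pow, mul_comm, ← sq_abs (opTransform p N _ _)]
    gcongr
    exact hU _ _

/-! ## Isolating a spike -/

/-- Leakage from the other spikes is at most `δ² / (C k) · ‖x‖`, which `hbig` turns into `(δ / C)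
|x̂_h|`; the noise is not amplified and adds `δ / (2C) |x̂_h|`. As the filter keeps at least `3 / 4`
of the spike, the tolerance `6 δ / C` leaves ample room. -/
theorem isolate (hp : IsOrthonormalFamily p ν) {m t k : ℕ} {γ δ C : ℝ} (hm : 0 < m)
    (ht : t ≤ 2 * m) (hγ : 0 < γ) (hδ : 0 < δ) (hC : 1 ≤ C) (hk : 1 ≤ k)
    (hm1 : 40 / γ ^ 2 ≤ m) (hm2 : 6400 * C * k / (δ ^ 2 * γ ^ 4) ≤ m)
    {x w : Fin N → ℝ} {h : Fin N} (hc : |opRoot p N h - centre m t| ≤ 1 / m)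
    (hsep : ∀ i, (opTransform p N).mulVec x i ≠ 0 → i ≠ h →
      γ ^ 2 / 20 ≤ |opRoot p N i - opRoot p N h|)
    (hbig : δ * l2 x ≤ k * |(opTransform p N).mulVec x h|)
    (hw : l2 ((opTransform p N).mulVec w) ≤ δ / (2 * C) * |(opTransform p N).mulVec x h|) :
    ∃ w' : Fin N → ℝ, (opTransform p N).mulVec
        ((filterMatrix p N (bump m (centre m t))).mulVec (x + w)) =
      spike N h ((bump m (centre m t)).eval (opRoot p N h) * (opTransform p N).mulVec x h) + w' ∧
      l2 w' ≤ 6 * δ / C *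
        |(bump m (centre m t)).eval (opRoot p N h) * (opTransform p N).mulVec x h| := by
  set F := opTransform p N with hF
  set a := centre m t with ha
  set f : Fin N → ℝ := fun i => (bump m a).eval (opRoot p N i) with hf
  have hmR : (0 : ℝ) < m := by exact_mod_cast hm
  have hkR : (1 : ℝ) ≤ k := by exact_mod_cast hk
  have haI : a ∈ Set.Icc (-1 : ℝ) 1 := centre_mem hm ht
  have hf0 : ∀ i, 0 ≤ f i := fun i => eval_bump_nonneg m haI (hp.opRoot_mem i)
  have hf1 : ∀ i, f i ≤ 1 := fun i => eval_bump_le_one m haI (hp.opRoot_mem i)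
  have hfh : 3 / 4 ≤ f h := eval_bump_ge hm hc
  -- Half of the root gap `γ² / 20` remains after moving from `λ_h` to the centre. At distance `γ² /
  -- 40` the bump is at most `4 · 1600 / (m γ⁴)`, hence the constant `6400` in `hm2`.
  have hfar : ∀ i, F.mulVec x i ≠ 0 → i ≠ h → f i ≤ δ ^ 2 / (C * k) := by
    intro i hi hih
    have h1 := hsep i hi hih
    have h2 : (1 : ℝ) / m ≤ γ ^ 2 / 40 := by
      rw [div_le_div_iff₀ hmR (by norm_num)]
      rw [div_le_iff₀ (by positivity)] at hm1
      linarith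
    have h3 : γ ^ 2 / 40 ≤ |opRoot p N i - a| := by
      have := abs_sub_le (opRoot p N i) a (opRoot p N h)
      rw [abs_sub_comm a] at this
      linarith
    refine (eval_bump_le hm haI (hp.opRoot_mem i) (by positivity) h3).trans ?_
    rw [div_le_iff₀ (by positivity)] at hm2
    rw [div_le_div_iff₀ (by positivity) (by positivity)]
    nlinarith
  refine ⟨(fun i => f i * F.mulVec w i) + fun i => if i = h then 0 else f i * F.mulVec x i,
    ?_, ?_⟩
  · rw [hp.opTransform_mulVec_filterMatrix, Matrix.mulVec_add]
    funext i
    simp only [Pi.add_apply, spike, ← Fin.ext_iff]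
    by_cases hih : i = h
    · subst hih; simp [hf]; ring
    · simp [hih, hf]; ring
  · have b1 : l2 (fun i => f i * F.mulVec w i) ≤ l2 (F.mulVec w) := by
      refine l2_le_of_abs_le fun i => ?_
      rw [abs_mul, abs_of_nonneg (hf0 i)]
      exact mul_le_of_le_one_left (abs_nonneg _) (hf1 i)
    have b2 : l2 (fun i => if i = h then 0 else f i * F.mulVec x i) ≤
        δ ^ 2 / (C * k) * l2 (F.mulVec x) := by
      refine l2_le_mul_l2 (by positivity) fun i => ?_
      by_cases hih : i = h
      · simp only [hih, if_true, abs_zero]; positivity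
      · rw [if_neg hih, abs_mul, abs_of_nonneg (hf0 i)]
        by_cases hi : F.mulVec x i = 0
        · simp [hi]
        · exact mul_le_mul_of_nonneg_right (hfar i hi hih) (abs_nonneg _)
    rw [l2_mulVec (hp.opTransform_transpose_mul N)] at b2
    have b3 : δ ^ 2 / (C * k) * l2 x ≤ δ / C * |F.mulVec x h| := by
      have : δ ^ 2 / (C * k) * l2 x = δ / (C * k) * (δ * l2 x) := by ring
      rw [this]
      calc _ ≤ δ / (C * k) * (k * |F.mulVec x h|) := by gcongr
        _ = _ := by field_simp
    refine (l2_add_le _ _).trans ((add_le_add (b1.trans hw) (b2.trans b3)).trans ?_)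
    change _ ≤ 6 * δ / C * |f h * _|
    rw [abs_mul, abs_of_nonneg (hf0 h)]
    have hX := abs_nonneg (F.mulVec x h)
    have hδC : 0 < δ / C := by positivity
    have : δ / (2 * C) * |F.mulVec x h| + δ / C * |F.mulVec x h| =
        (3 / 2) * (δ / C * |F.mulVec x h|) := by field_simp; ring
    rw [this]
    have h5 : 6 * δ / C * (f h * |F.mulVec x h|) = 6 * f h * (δ / C * |F.mulVec x h|) := by ring
    rw [h5]
    have h6 : 0 ≤ δ / C * |F.mulVec x h| := by positivity
    nlinarith

/-! ## The error of the output -/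

/-- The error is `a` off `H`, and the estimation error minus `b` on `H`. Each of the at most `k`
missed entries has square at most `(δ ‖a‖)² / k`; spurious indices in `H` cost no more than genuine
ones. -/
theorem output_error {k M : ℕ} (hM : 1 ≤ M) {δ ρ : ℝ} (hρ : 0 ≤ ρ)
    (H : Finset ℕ) (e : ℕ → ℝ) {a b : Fin N → ℝ} (hcard : H.card ≤ M)
    (herr : ∀ i : Fin N, (i : ℕ) ∈ H → |e i - ext (a + b) i| ≤ ρ)
    (hk : {i | a i ≠ 0}.ncard = k) (hδ : 0 ≤ δ)
    (hmiss : ∀ i : Fin N, (i : ℕ) ∉ H → a i ≠ 0 → k * a i ^ 2 ≤ (δ * l2 a) ^ 2) :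
    l2 (a - fun i : Fin N => if (i : ℕ) ∈ H then e i else 0) ≤ δ * l2 a + l2 b + M * ρ := by
  have hsplit : (a - fun i : Fin N => if (i : ℕ) ∈ H then e i else 0) =
      ((fun i : Fin N => if (i : ℕ) ∈ H then 0 else a i) -
        fun i : Fin N => if (i : ℕ) ∈ H then b i else 0) +
      fun i : Fin N => if (i : ℕ) ∈ H then ext (a + b) i - e i else 0 := by
    funext i
    simp only [Pi.sub_apply, Pi.add_apply, ext_fin]
    split_ifs <;> ring
  have h1 : l2 (fun i : Fin N => if (i : ℕ) ∈ H then 0 else a i) ≤ δ * l2 a := by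
    refine (sq_le_sq₀ (l2_nonneg _) (mul_nonneg hδ (l2_nonneg _))).1 ?_
    rw [l2_sq]
    rcases Nat.eq_zero_or_pos k with rfl | hk0
    · rw [Set.ncard_eq_zero] at hk
      have hz : ∀ i, a i = 0 := fun i => by
        by_contra hi
        exact (hk ▸ (show i ∈ {i | a i ≠ 0} from hi) : i ∈ (∅ : Set (Fin N)))
      rw [Finset.sum_eq_zero fun i _ => by simp [hz]]
      positivity
    have hkR : (0 : ℝ) < k := by exact_mod_cast hk0
    calc ∑ i : Fin N, (if (i : ℕ) ∈ H then 0 else a i) ^ 2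
        ≤ ∑ i : Fin N, if a i ≠ 0 then (δ * l2 a) ^ 2 / k else 0 := by
          refine Finset.sum_le_sum fun i _ => ?_
          by_cases hi : a i = 0
          · simp [hi]
          · rw [if_pos hi]
            by_cases hH : (i : ℕ) ∈ H
            · simp only [hH, if_true, ne_eq, OfNat.ofNat_ne_zero, not_false_eq_true, zero_pow]; positivity
            · simp only [hH, if_false]
              rw [le_div_iff₀ hkR, mul_comm]
              exact hmiss i hH hi
      _ = (δ * l2 a) ^ 2 := by
          rw [← Finset.sum_filter, Finset.sum_const, nsmul_eq_mul]
          have : (Finset.univ.filter fun i => a i ≠ 0).card = k := by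
            rw [← hk, ← Set.ncard_coe_finset]; simp
          rw [this]
          field_simp
  have h2 : l2 (fun i : Fin N => if (i : ℕ) ∈ H then b i else 0) ≤ l2 b := by
    refine l2_le_of_abs_le fun i => ?_
    split_ifs <;> simp
  have h3 : l2 (fun i : Fin N => if (i : ℕ) ∈ H then ext (a + b) i - e i else 0) ≤ M * ρ := by
    refine (sq_le_sq₀ (l2_nonneg _) (by positivity)).1 ?_
    rw [l2_sq]
    calc ∑ i : Fin N, (if (i : ℕ) ∈ H then ext (a + b) i - e i else 0) ^ 2
        ≤ ∑ i : Fin N, if (i : ℕ) ∈ H then ρ ^ 2 else 0 := by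
          refine Finset.sum_le_sum fun i _ => ?_
          split_ifs with hH
          · rw [← sq_abs, abs_sub_comm]
            exact pow_le_pow_left₀ (abs_nonneg _) (herr i hH) 2
          · simp
      _ = (Finset.univ.filter fun i : Fin N => (i : ℕ) ∈ H).card * ρ ^ 2 := by
          rw [← Finset.sum_filter, Finset.sum_const, nsmul_eq_mul]
      _ ≤ M * ρ ^ 2 := by
          gcongr
          refine le_trans ?_ hcard
          exact Finset.card_le_card_of_injOn (fun i => (i : ℕ)) (fun i hi => by simpa using hi)
            (Fin.val_injective.injOn)
      _ ≤ (M * ρ) ^ 2 := by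
          have : (1 : ℝ) ≤ M := by exact_mod_cast hM
          rw [mul_pow]
          gcongr
          nlinarith
  rw [hsplit]
  refine (l2_add_le _ _).trans ?_
  have := l2_sub_le (fun i : Fin N => if (i : ℕ) ∈ H then 0 else a i)
    (fun i : Fin N => if (i : ℕ) ∈ H then b i else 0)
  linarith

end Recover

namespace Recover

variable {N : ℕ} {p : ℕ → ℝ[X]} {ν : Measure ℝ}

/-! ## Correctness -/

/-- The constant `3` is `1 + 1/2 + 3/2`, for missed entries, noise and estimates. The second bound
follows from the first by adding back the coefficients of `w`, whose norm is that of `w`. -/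
theorem main_holds (hp : IsOrthonormalFamily p ν) {A : QueryProc N} {k m S G Q T : ℕ}
    {γ δ C μ μ' U : ℝ} (hm : 0 < m) (hS : 0 < S) (hG : 0 < G) (hγ : 0 < γ) (hδ : 0 < δ)
    (hδ1 : δ < 1) (hC : 1 ≤ C) (hk : 1 ≤ k) (hm1 : 40 / γ ^ 2 ≤ m)
    (hm2 : 6400 * C * k / (δ ^ 2 * γ ^ 4) ≤ m)
    (hU : ∀ i j, |opTransform p N i j| ≤ U)
    (hSU : 9 * (N * U ^ 2) * (2 * m + 1 : ℕ) ^ 2 ≤ S * δ ^ 2)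
    (hμ'0 : 0 ≤ μ') (hμ'1 : μ' ≤ 1) (hμ : k * μ' + (2 * m + 1 : ℕ) * (4 / 9) ^ G ≤ μ)
    (hA : A.IsOneSparseRecovery (opTransform p N) (6 * δ / C) δ μ' Q T) {x w : Fin N → ℝ}
    (hx : {i | (opTransform p N).mulVec x i ≠ 0}.ncard = k)
    (hsep : ∀ i j, (opTransform p N).mulVec x i ≠ 0 → (opTransform p N).mulVec x j ≠ 0 → i ≠ j →
      γ ^ 2 / 20 ≤ |opRoot p N i - opRoot p N j|)
    (hw : l2 ((opTransform p N).mulVec w) ≤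
      δ / (2 * C) * large k ((opTransform p N).mulVec x)) :
    (main.run (x + w) (A.clock Q T) ⟨(params p N m S G).mem, 0, 0⟩).Holds
      (fun s => l2 ((opTransform p N).mulVec x - s.mem.output N) ≤ 3 * δ * l2 x ∧
        l2 ((opTransform p N).mulVec (x + w) - s.mem.output N) ≤ 3 * δ * l2 x + l2 w)
      (ENNReal.ofReal μ) := by
  classical
  set F := opTransform p N with hF
  have hFF := hp.opTransform_transpose_mul N
  have hkR : (1 : ℝ) ≤ k := by exact_mod_cast hk
  have hlx : l2 (F.mulVec x) = l2 x := l2_mulVec hFF x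
  have hlw : l2 (F.mulVec w) = l2 w := l2_mulVec hFF w
  have hw' : ∀ i, F.mulVec x i ≠ 0 → l2 (F.mulVec w) ≤ δ / (2 * C) * |F.mulVec x i| := fun i hi =>
    hw.trans (by gcongr; exact large_le_abs hx hi)
  obtain ⟨i₀, hi₀⟩ : {i | F.mulVec x i ≠ 0}.Nonempty :=
    (Set.ncard_pos (Set.toFinite _)).1 (by omega)
  have hxpos : 0 < l2 x := by
    rw [← hlx]
    exact (abs_pos.2 hi₀).trans_le (abs_le_l2 _ i₀)
  have hwx : l2 w ≤ δ / 2 * l2 x := by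
    rw [← hlw, ← hlx]
    refine (hw' i₀ hi₀).trans ?_
    gcongr
    · linarith
    · exact abs_le_l2 _ _
  have hv : l2 (x + w) ≤ 3 / 2 * l2 x := by
    have := l2_add_le x w
    nlinarith
  set M := 2 * m + 1 with hM
  have hMR : (0 : ℝ) < M := by positivity
  -- The factor `3 / 2` comes from `‖x + w‖ ≤ (3/2) ‖x‖`, so that the sample size does not depend on
  -- the input; the division by `M` pays for up to `M` recorded entries.
  set ρ := δ / M * (3 / 2 * l2 x) with hρ
  have hρ0 : 0 < ρ := by positivity
  -- These are the coefficients that must not be missed: a smaller one can be drowned by leakage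
  -- from the others, but all smaller ones together have norm at most `δ ‖x‖`.
  set Big : Finset (Fin N) := Finset.univ.filter fun i =>
    F.mulVec x i ≠ 0 ∧ (δ * l2 x) ^ 2 < k * F.mulVec x i ^ 2 with hBig
  have hτ : ∀ i : Fin N, ∃ t ≤ 2 * m, |opRoot p N i - centre m t| ≤ 1 / m := fun i =>
    exists_centre hm (hp.opRoot_mem i)
  choose τ hτ1 hτ2 using hτ
  have key := main_spec (p := params p N m S G) (v := x + w) (A := A.clock Q T)
    (vhat := ext (F.mulVec (x + w))) (ρ := ρ) (Big := Big) (τ := τ) (εA := ENNReal.ofReal μ') hG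
    (params_samplable hS hρ0 hU (by
      calc 9 * (N * (U ^ 2 * l2 (x + w) ^ 2)) = 9 * (N * U ^ 2) * l2 (x + w) ^ 2 := by ring
        _ ≤ 9 * (N * U ^ 2) * (3 / 2 * l2 x) ^ 2 := by
          have := l2_nonneg (x + w)
          gcongr
        _ = 9 * (N * U ^ 2) * M ^ 2 * (3 / 2 * l2 x / M) ^ 2 := by field_simp
        _ ≤ S * δ ^ 2 * (3 / 2 * l2 x / M) ^ 2 := by gcongr
        _ = S * ρ ^ 2 := by rw [hρ]; field_simp))
    (fun i _ => by have := hτ1 i; simp only [params]; omega)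
    (fun i hi s hs hptr => by
      obtain ⟨-, hi0, hi1⟩ := Finset.mem_filter.1 hi
      have hbig : δ * l2 x ≤ k * |F.mulVec x i| := by
        refine (sq_le_sq₀ (by positivity) (by positivity)).1 (hi1.le.trans ?_)
        rw [mul_pow, sq_abs]
        have := sq_nonneg (F.mulVec x i)
        nlinarith
      obtain ⟨w', hw1, hw2⟩ := isolate hp hm (hτ1 i) hγ hδ hC hk hm1 hm2 (hτ2 i)
        (fun j hj hji => hsep j i hj hi0 hji) hbig (hw' i hi0)
      refine call_spec (fun j => params_answer hp m S G (by have := hτ1 i; omega) (x + w) j) hA hw1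
        hw2 ?_ hδ1 hμ'0 hμ'1 hs hptr
      have := eval_bump_ge hm (hτ2 i)
      exact mul_ne_zero (by linarith) hi0)
  refine key.mono (fun s _ hs => ?_) ?_
  · obtain ⟨H, e, ho, herr, hcard, hbig⟩ := hs
    have hE : F.mulVec (x + w) = F.mulVec x + F.mulVec w := Matrix.mulVec_add _ _ _
    have h1 := output_error (M := M) (by omega) hρ0.le H e (a := F.mulVec x) (b := F.mulVec w) hcard
      (fun i hi => by rw [← hE]; exact herr i hi) hx hδ.le (fun i hiH hi => by
        by_contra hcon
        exact hiH (hbig i (Finset.mem_filter.2 ⟨Finset.mem_univ _, hi, by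
          rw [← hlx]; exact not_le.1 hcon⟩)))
    rw [← ho, hlx, hlw] at h1
    have h2 : (M : ℝ) * ρ = 3 / 2 * δ * l2 x := by rw [hρ]; field_simp
    have h3 : l2 (F.mulVec x - s.mem.output N) ≤ 3 * δ * l2 x := by
      rw [h2] at h1; linarith
    refine ⟨h3, ?_⟩
    have h4 : F.mulVec (x + w) - s.mem.output N = (F.mulVec x - s.mem.output N) + F.mulVec w := by
      rw [hE]; abel
    rw [h4]
    refine (l2_add_le _ _).trans ?_
    rw [hlw]
    linarith
  · have hcard : Big.card ≤ k := by
      rw [← hx, ← Set.ncard_coe_finset]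
      exact Set.ncard_le_ncard (fun i hi => by simp [hBig] at hi; exact hi.1) (Set.toFinite _)
    calc _ ≤ (k : ℝ≥0∞) * ENNReal.ofReal μ' + (M : ℝ≥0∞) * ENNReal.ofReal ((4 / 9) ^ G) := by
          exact add_le_add (mul_le_mul' (by exact_mod_cast hcard) le_rfl) le_rfl
      _ = ENNReal.ofReal (k * μ' + M * (4 / 9) ^ G) := by
          rw [ENNReal.ofReal_add (by positivity) (by positivity),
            ENNReal.ofReal_mul (by positivity), ENNReal.ofReal_mul (by positivity),
            ENNReal.ofReal_natCast, ENNReal.ofReal_natCast]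
      _ ≤ _ := ENNReal.ofReal_le_ofReal hμ

/-! ## The size of the preprocessed data -/

/-- The arrays are defined to be zero beyond their meaningful range, which keeps both support and
pointers bounded. The last preset register has number `25`. -/
theorem params_size (p : ℕ → ℝ[X]) {N m S G : ℕ} {B : ℝ} (h25 : 25 ≤ B) (hS : S ≤ B)
    (hG : 2 * G ≤ B) (hW : (2 * m + 1) * (N * (4 * m + 1)) ≤ B) (hN : N * N ≤ B) (hN1 : 1 ≤ N) :
    (params p N m S G).mem.SizeAtMost B := by
  have hW' : (((2 * m + 1) * (N * (4 * m + 1)) : ℕ) : ℝ) ≤ B := by exact_mod_cast hW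
  have hN' : ((N * N : ℕ) : ℝ) ≤ B := by exact_mod_cast hN
  have hG' : ((2 * G : ℕ) : ℝ) ≤ B := by exact_mod_cast hG
  have h1 : N * (4 * m + 1) ≤ (2 * m + 1) * (N * (4 * m + 1)) :=
    Nat.le_mul_of_pos_left _ (by omega)
  have h2 : 4 * m + 1 ≤ N * (4 * m + 1) := Nat.le_mul_of_pos_left _ hN1
  have h3 : N ≤ N * N := Nat.le_mul_of_pos_left _ hN1
  have h1' : ((N * (4 * m + 1) : ℕ) : ℝ) ≤ B := (Nat.cast_le.2 h1).trans hW'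
  have h2' : ((4 * m + 1 : ℕ) : ℝ) ≤ B := (Nat.cast_le.2 h2).trans h1'
  have hle : ∀ n : ℕ, n ≤ 4 * m + 1 ∨ n ≤ N * N ∨ n ≤ 2 * G ∨ n ≤ 25 → (n : ℝ) ≤ B := by
    rintro n (h | h | h | h)
    · exact (Nat.cast_le.2 h).trans h2'
    · exact (Nat.cast_le.2 h).trans hN'
    · exact (Nat.cast_le.2 h).trans hG'
    · exact le_trans (by exact_mod_cast h) h25
  refine ⟨fun i => ?_, fun a i => ?_, fun i hi => ?_, fun a i hai => ?_⟩
  · simp only [Params.mem, params]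
    split
    · exact hle _ (by omega)
    · exact hle _ (by omega)
    · exact hle _ (by omega)
    · exact hle _ (by omega)
    · exact h1'
    · exact hle _ (by omega)
    · exact hS
    · exact hle _ (by omega)
    · exact hle _ (by omega)
    · exact hle _ (by omega)
  · simp only [Params.mem, params]
    by_cases ha1 : a = 1
    · simp only [ha1, if_true]
      split_ifs with h
      · exact (Nat.cast_le.2 (Nat.mul_le_mul_right _ h.le)).trans h1'
      · exact hle _ (by omega)
    · by_cases ha2 : a = 2
      · simp only [ha2, if_true]
        norm_num
        split_ifs with h
        · exact_mod_cast (Nat.cast_le.2 (Nat.mul_le_mul_right N h.le)).trans hN'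
        · simpa using h25.trans' (by norm_num)
      · simp only [ha1, ha2, if_false]
        exact hle _ (by simp)
  · have h25 : 25 < i := by exact_mod_cast h25.trans_lt hi
    constructor
    · simp only [Params.mem]
      split <;> omega
    · simp only [Params.mem]
      rw [if_neg (by omega)]
  · have key : (2 < a ∨ a ≤ 2) := by omega
    rcases hai with ha | hi
    · have h25 : 25 < a := by exact_mod_cast h25.trans_lt ha
      simp only [Params.mem]
      rw [if_neg (by omega), if_neg (by omega), if_neg (by omega), if_neg (by omega)]
      exact ⟨rfl, rfl⟩
    · have hiW : (2 * m + 1) * (N * (4 * m + 1)) < i := by exact_mod_cast hW'.trans_lt hi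
      have hiN : N * N < i := by exact_mod_cast hN'.trans_lt hi
      simp only [Params.mem, params]
      constructor
      · by_cases ha1 : a = 1
        · rw [if_pos ha1, if_neg (by omega)]
        · rw [if_neg ha1]
          by_cases ha2 : a = 2
          · rw [if_pos ha2, if_neg (by omega)]
          · rw [if_neg ha2]; rfl
      · by_cases ha1 : a = 1
        · rw [if_pos ha1, if_neg (by omega)]
        · rw [if_neg ha1]
          by_cases ha2 : a = 2
          · rw [if_pos ha2, if_neg (by omega)]
          · rw [if_neg ha2]; rfl

end Recover

/-! ## Consequences of density -/

/-- The constants of a dense family. -/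
theorem dense_constants {p : ℕ → ℝ[X]} {C₀ C₁ γ₀ γ : ℝ} {N : ℕ} (hN : 0 < N)
    (hinj : Function.Injective (opAngle p N)) (h01 : C₀ < C₁) (h0 : 0 < C₀)
    (hd : ∀ i : Fin N, ∀ γ : ℝ, γ₀ / N ≤ γ → γ ≤ 2 * Real.pi →
      C₀ * γ * N ≤ ((Set.range (opAngle p N) ∩
          Set.Icc (opAngle p N i - γ / 2) (opAngle p N i + γ / 2)).ncard : ℝ) ∧
      ((Set.range (opAngle p N) ∩
          Set.Icc (opAngle p N i - γ / 2) (opAngle p N i + γ / 2)).ncard : ℝ) ≤ C₁ * γ * N)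
    (hpi : γ₀ / N ≤ 2 * Real.pi) (hγ : γ₀ / N ≤ γ) (hC : C₁ * γ < 1) :
    0 < γ ∧ γ ≤ 2 * Real.pi ∧ C₀ ≤ 1 := by
  have hNR : (0 : ℝ) < N := by exact_mod_cast hN
  have hπ := Real.pi_gt_three
  set i : Fin N := ⟨0, hN⟩
  have hall : Set.range (opAngle p N) ∩
      Set.Icc (opAngle p N i - 2 * Real.pi / 2) (opAngle p N i + 2 * Real.pi / 2) =
      Set.range (opAngle p N) := by
    refine Set.inter_eq_left.2 ?_
    rintro _ ⟨j, rfl⟩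
    have h1 := Real.arccos_nonneg (opRoot p N i)
    have h2 := Real.arccos_le_pi (opRoot p N i)
    have h3 := Real.arccos_nonneg (opRoot p N j)
    have h4 := Real.arccos_le_pi (opRoot p N j)
    constructor <;> simp only [opAngle] <;> linarith
  have hcard : (Set.range (opAngle p N)).ncard = N := by
    rw [← Set.image_univ, Set.ncard_image_of_injective _ hinj, Set.ncard_univ, Nat.card_fin]
  have h2 := hd i (2 * Real.pi) hpi le_rfl
  rw [hall, hcard] at h2
  -- A window of width `2π` contains all `N` angles, so both density bounds can be compared with
  -- `N`.
  have h3 : C₀ * (2 * Real.pi) ≤ 1 := by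
    by_contra hcon
    nlinarith [h2.1]
  have h4 : 1 ≤ C₁ * (2 * Real.pi) := by
    by_contra hcon
    nlinarith [h2.2]
  have h5 : γ ≤ 2 * Real.pi := by
    by_contra hcon
    nlinarith
  refine ⟨?_, h5, by nlinarith⟩
  -- Positivity of `γ` is not automatic, as `γ₀` may be negative or zero. A window of width `0`
  -- still contains its centre, and a negative width makes the upper density bound negative.
  by_contra hcon
  push Not at hcon
  obtain ⟨h6, h7⟩ := hd i γ hγ h5
  have h8 : (0 : ℝ) ≤ ((Set.range (opAngle p N) ∩
      Set.Icc (opAngle p N i - γ / 2) (opAngle p N i + γ / 2)).ncard : ℝ) := by positivity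
  rcases hcon.eq_or_lt with rfl | hlt
  · have h9 : Set.range (opAngle p N) ∩
        Set.Icc (opAngle p N i - 0 / 2) (opAngle p N i + 0 / 2) ≠ ∅ :=
      Set.Nonempty.ne_empty ⟨opAngle p N i, ⟨i, rfl⟩, by simp⟩
    have h10 := (Set.ncard_pos (Set.toFinite _)).2 (Set.nonempty_iff_ne_empty.2 h9)
    have : (0 : ℝ) < _ := Nat.cast_pos.2 h10
    simp only [mul_zero, zero_mul] at h7
    linarith
  · have : C₁ * γ * N < 0 := by
      have : C₁ * γ < 0 := mul_neg_of_pos_of_neg (h0.trans h01) hlt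
      exact mul_neg_of_neg_of_pos this hNR
    linarith

/-! ## Numerical bounds -/

/-- Since `4/9 ≤ exp(-1/2)`, the power is at most `exp(-M) μ`, and `2 M ≤ (1 + M/2)² ≤ exp M`
absorbs the factor `M`. Using `M` instead of `log M` only costs a power in the final bound. -/
theorem mul_pow_four_ninths_le {M : ℕ} {μ : ℝ} (hμ : 0 < μ) {G : ℕ}
    (hG : 2 * (M + Real.log (1 / μ)) ≤ G) : M * (4 / 9 : ℝ) ^ G ≤ μ / 2 := by
  have h1 : (4 / 9 : ℝ) ≤ Real.exp (-1 / 2) := by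
    linarith [Real.add_one_le_exp (-1 / 2 : ℝ)]
  have h2 : (4 / 9 : ℝ) ^ G ≤ Real.exp (-M) * μ := by
    calc (4 / 9 : ℝ) ^ G ≤ Real.exp (-1 / 2) ^ G := by gcongr
      _ = Real.exp (G * (-1 / 2)) := (Real.exp_nat_mul _ _).symm
      _ ≤ Real.exp (-M + Real.log μ) := by
          refine Real.exp_le_exp.2 ?_
          rw [one_div, Real.log_inv] at hG
          linarith
      _ = Real.exp (-M) * μ := by rw [Real.exp_add, Real.exp_log hμ]
  have h3 : 2 * (M : ℝ) * Real.exp (-M) ≤ 1 := by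
    have h4 : 2 * (M : ℝ) ≤ Real.exp M := by
      have e : Real.exp M = Real.exp (M / 2) ^ 2 := by rw [← Real.exp_nat_mul]; congr 1; push_cast; ring
      have h5 := Real.add_one_le_exp ((M : ℝ) / 2)
      have h6 : (0 : ℝ) ≤ M := by positivity
      rw [e]
      nlinarith [sq_nonneg (1 - (M : ℝ) / 2)]
    calc 2 * (M : ℝ) * Real.exp (-M) ≤ Real.exp M * Real.exp (-M) := by gcongr
      _ = 1 := by rw [← Real.exp_add]; simp
  calc (M : ℝ) * (4 / 9) ^ G ≤ M * (Real.exp (-M) * μ) := by gcongr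
    _ = (2 * M * Real.exp (-M)) * (μ / 2) := by ring
    _ ≤ 1 * (μ / 2) := by gcongr
    _ = μ / 2 := one_mul _

/-- After expansion every monomial is at most `Z⁴ X² R` or `Z⁴ X² T`, and the coefficients `1 + 8 +
6 + 140 + 28 + 32 + 14` add up to `229`. -/
theorem time_bound {M W G S T Z X R : ℝ} (hW0 : 0 ≤ W) (hG0 : 0 ≤ G) (hT : 0 ≤ T)
    (hM : M ≤ Z) (hW : W ≤ Z) (hG : G ≤ Z) (hS0 : 0 ≤ S) (hS : S ≤ 10 * R * Z ^ 2 * X ^ 2)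
    (hZ : 1 ≤ Z) (hX : 1 ≤ X) (hR : 1 ≤ R) :
    1 + M * (T * (8 * W + 6) + 2 * G * (7 * S + 14 * G + 16) + 14) ≤
      229 * (Z ^ 4 * X ^ 2) * (R + T) := by
  have h1 : 1 + M * (T * (8 * W + 6) + 2 * G * (7 * S + 14 * G + 16) + 14) ≤
      1 + Z * (T * (8 * Z + 6) + 2 * Z * (7 * (10 * R * Z ^ 2 * X ^ 2) + 14 * Z + 16) + 14) := by
    gcongr
  refine h1.trans ?_
  have p1 : 1 ≤ Z ^ 4 * X ^ 2 := one_le_mul_of_one_le_of_one_le (one_le_pow₀ hZ) (one_le_pow₀ hX)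
  have q1 : ∀ j ≤ 4, Z ^ j ≤ Z ^ 4 * X ^ 2 := fun j hj =>
    (pow_le_pow_right₀ hZ hj).trans (le_mul_of_one_le_right (by positivity) (one_le_pow₀ hX))
  have e1 := q1 1 (by norm_num)
  have e2 := q1 2 (by norm_num)
  have e3 := q1 3 (by norm_num)
  have t1 : Z * T ≤ Z ^ 4 * X ^ 2 * T := by gcongr; simpa using e1
  have t2 : Z ^ 2 * T ≤ Z ^ 4 * X ^ 2 * T := by gcongr
  have r1 : Z ^ 4 * X ^ 2 ≤ Z ^ 4 * X ^ 2 * R := le_mul_of_one_le_right (by positivity) hR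
  have t0 : 0 ≤ Z ^ 4 * X ^ 2 * T := by positivity
  rw [pow_one] at e1
  nlinarith

theorem query_bound {M W G S Q Z X R : ℝ} (hW0 : 0 ≤ W) (hG0 : 0 ≤ G) (hQ : 0 ≤ Q)
    (hM : M ≤ Z) (hW : W ≤ Z) (hG : G ≤ Z) (hS0 : 0 ≤ S) (hS : S ≤ 10 * R * Z ^ 2 * X ^ 2)
    (hZ : 1 ≤ Z) (hX : 1 ≤ X) (hR : 1 ≤ R) :
    M * (Q * W + 2 * G * S) ≤ 229 * (Z ^ 4 * X ^ 2) * (R + Q) := by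
  have h1 : M * (Q * W + 2 * G * S) ≤ Z * (Q * Z + 2 * Z * (10 * R * Z ^ 2 * X ^ 2)) := by
    gcongr
  refine h1.trans ?_
  have e2 : Z ^ 2 ≤ Z ^ 4 * X ^ 2 := (pow_le_pow_right₀ hZ (by norm_num)).trans
    (le_mul_of_one_le_right (by positivity) (one_le_pow₀ hX))
  have t2 : Z ^ 2 * Q ≤ Z ^ 4 * X ^ 2 * Q := by gcongr
  have t0 : 0 ≤ Z ^ 4 * X ^ 2 * Q := by positivity
  have r0 : 0 ≤ Z ^ 4 * X ^ 2 * R := by positivity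
  nlinarith

theorem sample_bound {N M δ U X Z : ℝ} (hδ : 0 < δ) (hdX : 1 / δ ≤ X) (hM0 : 0 ≤ M)
    (hM : M ≤ Z) (hR : 1 ≤ N * U ^ 2) (hZ : 1 ≤ Z) (hX : 1 ≤ X) {S : ℕ}
    (hS : S = ⌈9 * (N * U ^ 2) * M ^ 2 / δ ^ 2⌉₊) :
    (S : ℝ) ≤ 10 * (N * U ^ 2) * Z ^ 2 * X ^ 2 := by
  have h1 := (Nat.ceil_lt_add_one (show 0 ≤ 9 * (N * U ^ 2) * M ^ 2 / δ ^ 2 by positivity)).le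
  rw [← hS] at h1
  refine h1.trans ?_
  have h2 : 9 * (N * U ^ 2) * M ^ 2 / δ ^ 2 ≤ 9 * (N * U ^ 2) * Z ^ 2 * X ^ 2 := by
    calc 9 * (N * U ^ 2) * M ^ 2 / δ ^ 2 = 9 * (N * U ^ 2) * M ^ 2 * (1 / δ) ^ 2 := by
          rw [div_pow, one_pow, mul_one_div]
      _ ≤ _ := by gcongr
  have h3 : 1 ≤ (N * U ^ 2) * Z ^ 2 * X ^ 2 :=
    one_le_mul_of_one_le_of_one_le (one_le_mul_of_one_le_of_one_le hR (one_le_pow₀ hZ))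
      (one_le_pow₀ hX)
  linarith

/-- The exponent is `7 = 1 + 2 + 4`, from `k`, `δ⁻²` and `γ⁻⁴`. -/
theorem degree_bound {C k δ γ X : ℝ} (hC : 1 ≤ C) (hk : 1 ≤ k) (hδ : 0 < δ) (hγ : 0 < γ)
    (hX : 1 ≤ X) (hkX : k ≤ X) (hdX : 1 / δ ≤ X) (hgX : 1 / γ ≤ X) :
    (⌈6400 * C * k / (δ ^ 2 * γ ^ 4)⌉₊ : ℝ) ≤ 6401 * C * X ^ 7 := by
  have h1 := (Nat.ceil_lt_add_one (show 0 ≤ 6400 * C * k / (δ ^ 2 * γ ^ 4) by positivity)).le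
  refine h1.trans ?_
  have h2 : 6400 * C * k / (δ ^ 2 * γ ^ 4) ≤ 6400 * C * X ^ 7 := by
    calc 6400 * C * k / (δ ^ 2 * γ ^ 4) = 6400 * C * (k * ((1 / δ) ^ 2 * (1 / γ) ^ 4)) := by
          field_simp
      _ ≤ 6400 * C * (X * (X ^ 2 * X ^ 4)) := by gcongr
      _ = _ := by ring
  have h3 : 1 ≤ C * X ^ 7 := one_le_mul_of_one_le_of_one_le hC (one_le_pow₀ hX)
  linarith

theorem forty_div_sq_le {C k δ γ m : ℝ} (hC : 1 ≤ C) (hk : 1 ≤ k) (hδ : 0 < δ) (hδ1 : δ < 1)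
    (hγ : 0 < γ) (hγpi : γ ≤ 2 * Real.pi) (hm : 6400 * C * k / (δ ^ 2 * γ ^ 4) ≤ m) :
    40 / γ ^ 2 ≤ m := by
  refine le_trans ?_ hm
  rw [div_le_div_iff₀ (by positivity) (by positivity)]
  have h1 : δ ^ 2 ≤ 1 := pow_le_one₀ hδ.le hδ1.le
  have h2 : 1 ≤ C * k := one_le_mul_of_one_le_of_one_le hC hk
  have h3 : γ ^ 2 ≤ 6.3 ^ 2 := pow_le_pow_left₀ hγ.le (by linarith [Real.pi_lt_d2]) 2
  calc 40 * (δ ^ 2 * γ ^ 4) ≤ 40 * (1 * γ ^ 4) := by gcongr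
    _ = 40 * γ ^ 2 * γ ^ 2 := by ring
    _ ≤ 40 * 6.3 ^ 2 * γ ^ 2 := by gcongr
    _ ≤ 6400 * 1 * γ ^ 2 := mul_le_mul_of_nonneg_right (by norm_num) (by positivity)
    _ ≤ 6400 * (C * k) * γ ^ 2 := by gcongr
    _ = 6400 * C * k * γ ^ 2 := by ring

/-- All four bounds rest on the denominator being a product of `δ`, `C₀` and `C₀ γ`-type factors at
most `1`; they allow every parameter to be measured by `X` alone. -/
theorem complexity_lower_bounds {k l γ δ C₀ : ℝ} (hk : 1 ≤ k) (hl : 1 ≤ l) (hγ : 0 < γ)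
    (hδ : 0 < δ) (hδ1 : δ < 1) (h0 : 0 < C₀) (hC0 : C₀ ≤ 1) (hCγ : C₀ * γ ≤ 1) :
    k ≤ k * l / (γ * δ * C₀) ∧ l ≤ k * l / (γ * δ * C₀) ∧ 1 / δ ≤ k * l / (γ * δ * C₀) ∧
      1 / γ ≤ k * l / (γ * δ * C₀) := by
  have hden : 0 < γ * δ * C₀ := by positivity
  have hden1 : γ * δ * C₀ ≤ 1 := by
    calc γ * δ * C₀ = δ * (C₀ * γ) := by ring
      _ ≤ 1 := mul_le_one₀ hδ1.le (by positivity) hCγ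
  have hkl : 1 ≤ k * l := one_le_mul_of_one_le_of_one_le hk hl
  have hk0 : 0 ≤ k := by linarith
  have hl0 : 0 ≤ l := by linarith
  refine ⟨?_, ?_, ?_, ?_⟩
  · rw [le_div_iff₀ hden]
    exact mul_le_mul_of_nonneg_left (hden1.trans hl) hk0
  · rw [le_div_iff₀ hden, mul_comm k]
    exact mul_le_mul_of_nonneg_left (hden1.trans hk) hl0
  · rw [div_le_div_iff₀ hδ hden]
    calc 1 * (γ * δ * C₀) = C₀ * γ * δ := by ring
      _ ≤ k * l * δ := mul_le_mul_of_nonneg_right (hCγ.trans hkl) hδ.le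
  · rw [div_le_div_iff₀ hγ hden]
    calc 1 * (γ * δ * C₀) = δ * C₀ * γ := by ring
      _ ≤ k * l * γ := mul_le_mul_of_nonneg_right
          ((mul_le_one₀ hδ1.le h0.le hC0).trans hkl) hγ.le

theorem size_bound {N M W G S U Z X B : ℝ} (hN : 1 ≤ N) (hW0 : 0 ≤ W)
    (hM : M ≤ Z) (hW : W ≤ Z) (hG : G ≤ Z) (hU0 : 0 ≤ U) (hU1 : U ≤ 1)
    (hS : S ≤ 10 * (N * U ^ 2) * Z ^ 2 * X ^ 2) (hZ : 1 ≤ Z) (hX : 1 ≤ X)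
    (hB : 229 * (Z ^ 4 * X ^ 2) * N ^ 2 ≤ B) :
    25 ≤ B ∧ S ≤ B ∧ 2 * G ≤ B ∧ M * (N * W) ≤ B ∧ N * N ≤ B := by
  have hN2 : 1 ≤ N ^ 2 := one_le_pow₀ hN
  have hX2 : 1 ≤ X ^ 2 := one_le_pow₀ hX
  have hY : 1 ≤ Z ^ 4 * X ^ 2 := one_le_mul_of_one_le_of_one_le (one_le_pow₀ hZ) hX2
  have hZj : ∀ j ≤ 4, Z ^ j ≤ Z ^ 4 * X ^ 2 := fun j hj =>
    (pow_le_pow_right₀ hZ hj).trans (le_mul_of_one_le_right (by positivity) hX2)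
  have hYN : 1 ≤ Z ^ 4 * X ^ 2 * N ^ 2 := one_le_mul_of_one_le_of_one_le hY hN2
  have hYN' : Z ^ 4 * X ^ 2 ≤ Z ^ 4 * X ^ 2 * N ^ 2 := le_mul_of_one_le_right (by positivity) hN2
  refine ⟨by linarith, ?_, ?_, ?_, ?_⟩
  · have h1 : N * U ^ 2 ≤ N ^ 2 * 1 := by
      gcongr
      · nlinarith
      · exact pow_le_one₀ hU0 hU1
    calc S ≤ 10 * (N * U ^ 2) * Z ^ 2 * X ^ 2 := hS
      _ ≤ 10 * (N ^ 2 * 1) * Z ^ 4 * X ^ 2 := by gcongr; norm_num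
      _ = 10 * (Z ^ 4 * X ^ 2 * N ^ 2) := by ring
      _ ≤ B := by linarith
  · have := hZj 1 (by norm_num)
    rw [pow_one] at this
    linarith
  · have h2 := hZj 2 (by norm_num)
    calc M * (N * W) ≤ Z * (N * Z) := by gcongr
      _ = Z ^ 2 * N ^ 1 := by ring
      _ ≤ (Z ^ 4 * X ^ 2) * N ^ 2 := by gcongr; norm_num
      _ ≤ B := by linarith
  · have : N ^ 2 ≤ Z ^ 4 * X ^ 2 * N ^ 2 := le_mul_of_one_le_left (by positivity) hY
    nlinarith

/-- This is the union bound over at most `k` relevant calls of the black box, which uses up half of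
`μ`. -/
theorem failure_bound {k μ C₀ γ : ℝ} (hk : 1 ≤ k) (hμ : 0 < μ) (hμ1 : μ < 1) (h0 : 0 < C₀)
    (hγ : 0 < γ) (hCγ : C₀ * γ ≤ 1) :
    k * (μ ^ 2 * C₀ ^ 2 * γ ^ 2 / k ^ 2 / 2) ≤ μ / 2 := by
  have h1 : (C₀ * γ) ^ 2 ≤ 1 := pow_le_one₀ (by positivity) hCγ
  have h2 : μ * (C₀ * γ) ^ 2 ≤ k :=
    (mul_le_one₀ hμ1.le (by positivity) h1).trans hk
  calc k * (μ ^ 2 * C₀ ^ 2 * γ ^ 2 / k ^ 2 / 2) = μ / 2 * (μ * (C₀ * γ) ^ 2 / k) := by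
        field_simp
    _ ≤ μ / 2 * 1 := by
        gcongr
        rw [div_le_one (by positivity)]
        exact h2
    _ = μ / 2 := mul_one _

/-! ## The entries of the transform -/

theorem abs_le_maxAbsEntry {N : ℕ} (M : Matrix (Fin N) (Fin N) ℝ) (i j : Fin N) :
    |M i j| ≤ maxAbsEntry M :=
  le_ciSup (f := fun ij : Fin N × Fin N => |M ij.1 ij.2|) (Set.finite_range _).bddAbove (i, j)

/-- The inverse is the transpose, and the rows of the transform are unit vectors. The bound `1 ≤ N
U²` lets additive constants be absorbed into the complexity. -/
theorem IsOrthonormalFamily.maxAbsEntry_bounds {p : ℕ → ℝ[X]} {ν : Measure ℝ}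
    (hp : IsOrthonormalFamily p ν) {N : ℕ} (hN : 0 < N) :
    (∀ i j, |opTransform p N i j| ≤ maxAbsEntry (opTransform p N)⁻¹) ∧
      1 ≤ N * maxAbsEntry (opTransform p N)⁻¹ ^ 2 ∧ 0 ≤ maxAbsEntry (opTransform p N)⁻¹ ∧
      maxAbsEntry (opTransform p N)⁻¹ ≤ 1 := by
  rw [hp.opTransform_inv N]
  set F := opTransform p N with hF
  have hrow : ∀ i, ∑ j, F i j ^ 2 = 1 := fun i => by
    have := congrFun (congrFun (hp.opTransform_mul_transpose N) i) i
    rw [Matrix.mul_apply, Matrix.one_apply_eq] at this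
    simpa [sq] using this
  have hU : ∀ i j, |F i j| ≤ maxAbsEntry F.transpose := fun i j =>
    abs_le_maxAbsEntry F.transpose j i
  set i₀ : Fin N := ⟨0, hN⟩
  refine ⟨hU, ?_, (abs_nonneg _).trans (hU i₀ i₀), ?_⟩
  · rw [← hrow i₀]
    calc ∑ j, F i₀ j ^ 2 ≤ ∑ _j : Fin N, maxAbsEntry F.transpose ^ 2 := by
          refine Finset.sum_le_sum fun j _ => ?_
          rw [← sq_abs]
          exact pow_le_pow_left₀ (abs_nonneg _) (hU _ _) 2
      _ = N * maxAbsEntry F.transpose ^ 2 := by simp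
  · have : Nonempty (Fin N × Fin N) := ⟨(i₀, i₀)⟩
    refine ciSup_le fun ij => ?_
    rw [Matrix.transpose_apply, ← sq_le_one_iff_abs_le_one, ← hrow ij.2]
    exact Finset.single_le_sum (f := fun j => F ij.2 j ^ 2) (fun _ _ => sq_nonneg _)
      (Finset.mem_univ _)

/-! ## Recovery -/

theorem Recover.exists_params {p : ℕ → ℝ[X]} {ν : Measure ℝ} (hp : IsOrthonormalFamily p ν)
    {N k : ℕ} {C δ μ γ X U μ' : ℝ} (hC : 1 ≤ C) (hN : 0 < N) (hk : 1 ≤ k) (hδ : 0 < δ)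
    (hδ1 : δ < 1) (hμ : 0 < μ) (hμ1 : μ < 1) (hγ : 0 < γ) (hγpi : γ ≤ 2 * Real.pi)
    (hkX : k ≤ X) (hlX : 1 + Real.log (1 / μ) ≤ X) (hdX : 1 / δ ≤ X) (hgX : 1 / γ ≤ X)
    (hU : ∀ i j, |opTransform p N i j| ≤ U) (hR : 1 ≤ N * U ^ 2) (hU0 : 0 ≤ U) (hU1 : U ≤ 1)
    (hμ'0 : 0 ≤ μ') (hkμ : k * μ' ≤ μ / 2) :
    ∃ mem : Mem, mem.SizeAtMost (229 * (40000 * C) ^ 4 * (N * X) ^ 30) ∧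
    ∀ (A : QueryProc N) (Q T : ℕ),
      A.IsOneSparseRecovery (opTransform p N) (6 * δ / C) δ μ' Q T →
    ∀ x w : Fin N → ℝ, {i | (opTransform p N).mulVec x i ≠ 0}.ncard = k →
      (∀ i j, (opTransform p N).mulVec x i ≠ 0 → (opTransform p N).mulVec x j ≠ 0 → i ≠ j →
        γ ^ 2 / 20 ≤ |opRoot p N i - opRoot p N j|) →
      l2 ((opTransform p N).mulVec w) ≤ δ / (2 * C) * large k ((opTransform p N).mulVec x) →
    (main.run (x + w) (A.clock Q T) ⟨mem, 0, 0⟩).Holds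
      (fun s => l2 ((opTransform p N).mulVec x - s.mem.output N) ≤ 3 * δ * l2 x ∧
        l2 ((opTransform p N).mulVec (x + w) - s.mem.output N) ≤ 3 * δ * l2 x + l2 w)
      (ENNReal.ofReal μ) ∧
    ∀ s ∈ (main.run (x + w) (A.clock Q T) ⟨mem, 0, 0⟩).support,
      (s.queries : ℝ) ≤ 229 * (40000 * C) ^ 4 * X ^ 30 * (N * U ^ 2 + Q) ∧
      (s.time : ℝ) ≤ 229 * (40000 * C) ^ 4 * X ^ 30 * (N * U ^ 2 + T) := by
  have hNR : (1 : ℝ) ≤ N := by exact_mod_cast hN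
  have hkR : (1 : ℝ) ≤ k := by exact_mod_cast hk
  have hX1 : 1 ≤ X := hkR.trans hkX
  have hlog : 0 ≤ Real.log (1 / μ) := Real.log_nonneg (by rw [le_div_iff₀ hμ]; linarith)
  obtain ⟨m, hm⟩ : ∃ m, m = ⌈6400 * C * k / (δ ^ 2 * γ ^ 4)⌉₊ := ⟨_, rfl⟩
  have hm2 : 6400 * C * k / (δ ^ 2 * γ ^ 4) ≤ m := hm ▸ Nat.le_ceil _
  have hm1 : 40 / γ ^ 2 ≤ m := forty_div_sq_le hC hkR hδ hδ1 hγ hγpi hm2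
  have hmpos : 0 < m := hm ▸ Nat.ceil_pos.2 (by positivity)
  have hmX := degree_bound hC hkR hδ hγ hX1 hkX hdX hgX
  rw [← hm] at hmX
  -- One quantity dominates `2m + 1`, `4m + 1` and `G`; as `m ≤ 6401 C X⁷`, all of them are below
  -- `40000 C X⁷`. Then `Z⁴ X²` is a multiple of `X ^ 30`.
  obtain ⟨Z, hZ⟩ : ∃ Z, Z = 40000 * C * X ^ 7 := ⟨_, rfl⟩
  have hCX : 1 ≤ C * X ^ 7 := one_le_mul_of_one_le_of_one_le hC (one_le_pow₀ hX1)
  have hXC : X ≤ C * X ^ 7 :=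
    calc X = 1 * X ^ 1 := by ring
      _ ≤ C * X ^ 7 := by gcongr; norm_num
  have hZ1 : 1 ≤ Z := by linarith
  have hMZ : 2 * (m : ℝ) + 1 ≤ Z := by linarith
  have hWZ : 4 * (m : ℝ) + 1 ≤ Z := by linarith
  obtain ⟨G, hG⟩ : ∃ G, G = ⌈2 * (((2 * m + 1 : ℕ) : ℝ) + Real.log (1 / μ))⌉₊ := ⟨_, rfl⟩
  have hGl : 2 * (((2 * m + 1 : ℕ) : ℝ) + Real.log (1 / μ)) ≤ G := hG ▸ Nat.le_ceil _
  have hGZ : (G : ℝ) ≤ Z := by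
    rw [hG]
    refine (Nat.ceil_lt_add_one (by positivity)).le.trans ?_
    push_cast
    linarith
  have hGpos : 0 < G := hG ▸ Nat.ceil_pos.2 (by positivity)
  -- This makes the standard deviation of a group at most `ρ / 3`; the factor `3/2 · ‖x‖` in `ρ`
  -- cancels against the bound for `‖x + w‖`.
  obtain ⟨S, hS⟩ : ∃ S, S = ⌈9 * (N * U ^ 2) * (2 * (m : ℝ) + 1) ^ 2 / δ ^ 2⌉₊ := ⟨_, rfl⟩
  have hSl : 9 * (N * U ^ 2) * ((2 * m + 1 : ℕ) : ℝ) ^ 2 ≤ S * δ ^ 2 := by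
    rw [← div_le_iff₀ (by positivity), hS]
    push_cast
    exact Nat.le_ceil _
  have hSpos : 0 < S := hS ▸ Nat.ceil_pos.2 (by positivity)
  have hSZ := sample_bound hδ hdX (by positivity) hMZ hR hZ1 hX1 hS
  have hKX : 229 * (40000 * C) ^ 4 * X ^ 30 = 229 * (Z ^ 4 * X ^ 2) := by
    rw [hZ]; ring
  refine ⟨(Recover.params p N m S G).mem, ?_, fun A Q T hA x w hx hsep hw => ⟨?_, fun s hs => ?_⟩⟩
  · have hb : 229 * (Z ^ 4 * X ^ 2) * (N : ℝ) ^ 2 ≤ 229 * (40000 * C) ^ 4 * (N * X) ^ 30 :=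
      calc 229 * (Z ^ 4 * X ^ 2) * (N : ℝ) ^ 2 = 229 * (40000 * C) ^ 4 * (N ^ 2 * X ^ 30) := by
            rw [← hKX]; ring
        _ ≤ 229 * (40000 * C) ^ 4 * (N ^ 30 * X ^ 30) := by
            gcongr
            norm_num
        _ = _ := by rw [← mul_pow]
    obtain ⟨h1, h2, h3, h4, h5⟩ := size_bound hNR (by positivity) hMZ hWZ hGZ hU0 hU1 hSZ hZ1 hX1 hb
    exact Recover.params_size p h1 h2 h3 h4 h5 hN
  · have hμ'1 : μ' ≤ 1 := by
      have : μ' ≤ k * μ' := le_mul_of_one_le_left hμ'0 hkR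
      linarith
    refine Recover.main_holds hp hmpos hSpos hGpos hγ hδ hδ1 hC hk hm1 hm2 hU hSl hμ'0 hμ'1 ?_ hA
      hx hsep hw
    have := mul_pow_four_ninths_le hμ hGl
    linarith
  · obtain ⟨ht, hq⟩ := Prog.run_cost (P₀ := Recover.main) (m := (Recover.params p N m S G).mem)
      Recover.main (fun _ h => h) (fun _ h => Recover.not_writes_loopReg h) (fun _ _ => rfl) s hs
    rw [Recover.main_timeBound, zero_add] at ht
    rw [Recover.main_queryBound, zero_add] at hq
    have hG0 : (0 : ℝ) ≤ G := by positivity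
    have hS0 : (0 : ℝ) ≤ S := by positivity
    rw [hKX]
    constructor
    · refine le_trans ?_ (query_bound (by positivity) hG0 (Nat.cast_nonneg Q)
        hMZ hWZ hGZ hS0 hSZ hZ1 hX1 hR)
      have := Nat.cast_le (α := ℝ).2 hq
      simpa only [Recover.params, Nat.cast_add, Nat.cast_mul, Nat.cast_ofNat, Nat.cast_one] using this
    · refine le_trans ?_ (time_bound (by positivity) hG0 (Nat.cast_nonneg T)
        hMZ hWZ hGZ hS0 hSZ hZ1 hX1 hR)
      have := Nat.cast_le (α := ℝ).2 ht
      simpa only [Recover.params, Nat.cast_add, Nat.cast_mul, Nat.cast_ofNat, Nat.cast_one] using this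

theorem mainTheorem2 :
    ∃ (δ₀ C' : ℝ) (recover : Prog) (deg : ℕ), 0 < δ₀ ∧ 0 < C' ∧
    ∀ C : ℝ, C' ≤ C → ∃ K : ℝ, 0 < K ∧
    ∀ (p : ℕ → ℝ[X]) (ν : Measure ℝ) (C₀ C₁ γ₀ : ℝ),
      IsOrthonormalFamily p ν → IsDenseFamily p C₀ C₁ γ₀ →
    ∃ N₀ : ℕ, ∀ N : ℕ, N₀ ≤ N →
    ∀ (k : ℕ) (δ μ γ : ℝ), 1 ≤ k → k < N → 0 < δ → δ < δ₀ → 0 < μ → μ < 1 → γ₀ / N ≤ γ →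
      C₁ * γ < 1 →
    let F := opTransform p N
    let U := maxAbsEntry F⁻¹
    let μ₀ := μ ^ 2 * C₀ ^ 2 * γ ^ 2 / (k : ℝ) ^ 2
    let X := k * (1 + Real.log (1 / μ)) / (γ * δ * C₀)
    ∃ mem : Mem, mem.SizeAtMost (K * (N * X) ^ deg) ∧
    ∀ (A : QueryProc N) (Q T : ℕ), A.IsOneSparseRecovery F (6 * δ / C) δ (μ₀ / 2) Q T →
    ∀ x w : Fin N → ℝ, SparselySeparated k (C₁ * γ) (F.mulVec x) →
      l2 (F.mulVec w) ≤ δ / (2 * C) * large k (F.mulVec x) →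
    let result := recover.run (x + w) (A.clock Q T) ⟨mem, 0, 0⟩
    ENNReal.ofReal (1 - μ) ≤ result.toOuterMeasure
      {s | l2 (F.mulVec x - s.mem.output N) ≤ 3 * δ * l2 x ∧
        l2 (F.mulVec (x + w) - s.mem.output N) ≤ 3 * δ * l2 x + l2 w} ∧
    ∀ s ∈ result.support,
      (s.queries : ℝ) ≤ K * X ^ deg * (N * U ^ 2 + Q) ∧
      (s.time : ℝ) ≤ K * X ^ deg * (N * U ^ 2 + T) := by
  refine ⟨1, 1, Recover.main, 30, one_pos, one_pos, fun C hC => ?_⟩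
  refine ⟨229 * (40000 * C) ^ 4, by positivity, fun p ν C₀ C₁ γ₀ hp hdense => ?_⟩
  obtain ⟨h0, h01, hev⟩ := hdense
  obtain ⟨N₁, hN₁⟩ := eventually_atTop.1 hev
  -- Beyond this bound the density estimates hold at `N`, there is at least one root, and the width
  -- `2π` is an admissible window.
  refine ⟨max N₁ (max 1 ⌈γ₀ / (2 * Real.pi)⌉₊), fun N hN k δ μ γ hk _ hδ hδ1 hμ hμ1 hγ hCγ => ?_⟩
  have hπ := Real.pi_pos
  have hNpos : 0 < N := (le_max_left 1 _).trans ((le_max_right _ _).trans hN)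
  have hd := hN₁ N ((le_max_left _ _).trans hN)
  have hpi : γ₀ / N ≤ 2 * Real.pi := by
    have h1 : γ₀ / (2 * Real.pi) ≤ N := (Nat.le_ceil _).trans
      (Nat.cast_le.2 ((le_max_right _ _).trans ((le_max_right _ _).trans hN)))
    rw [div_le_iff₀ (by positivity)] at h1 ⊢
    linarith
  obtain ⟨hγ0, hγpi, hC01⟩ := dense_constants hNpos (hp.opAngle_strictAnti N).injective h01 h0 hd
    hpi hγ hCγ
  have hCγ0 : C₀ * γ ≤ 1 := (mul_le_mul_of_nonneg_right h01.le hγ0.le).trans hCγ.le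
  have hkR : (1 : ℝ) ≤ k := by exact_mod_cast hk
  have hl : 1 ≤ 1 + Real.log (1 / μ) :=
    le_add_of_nonneg_right (Real.log_nonneg (by rw [le_div_iff₀ hμ]; linarith))
  obtain ⟨hkX, hlX, hdX, hgX⟩ := complexity_lower_bounds hkR hl hγ0 hδ hδ1 h0 hC01 hCγ0
  obtain ⟨hU, hR, hU0, hU1⟩ := hp.maxAbsEntry_bounds hNpos
  intro F U μ₀ X
  obtain ⟨mem, hmem, h⟩ := Recover.exists_params hp hC hNpos hk hδ hδ1 hμ hμ1 hγ0 hγpi hkX hlX hdX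
    hgX hU hR hU0 hU1 (μ' := μ₀ / 2) (by positivity) (failure_bound hkR hμ hμ1 h0 hγ0 hCγ0)
  refine ⟨mem, hmem, fun A Q T hA x w hx hw => ?_⟩
  obtain ⟨h1, h2⟩ := h A Q T hA x w hx.2.2.1 (fun i j hi hj hij =>
    hp.root_gap hγ0.le (hp.angle_gap (fun i => (hd i γ hγ hγpi).2) (hx.2.2.2 i j hi hj hij))) hw
  exact ⟨(PMF.holds_ofReal_iff hμ.le hμ1.le).1 h1, h2⟩
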